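/- For each $n\in\mathbb N$ let $\boldsymbol d_n=(d_{n,i})_{i\in[n]}$ be a sequence of non-negative integers, and let $D_n$ be the degree of a uniformly random index, i.e. $\Pr(D_n=k)=\frac1n|\{i\in[n]:d_{n,i}=k\}|$. Assume that there is a probability distribution $D$ on $\mathbb N_0$ such that (i) every $\boldsymbol d_n$ is feasible, i.e. it is the degree sequence of at least one simple graph with vertex set $[n]$; (ii) $D_n\to D$ in distribution; (iii) $\mathbb E[D^2]<\infty$, $\mathbb E[D_n]\to\mathbb E[D]$ and $\mathbb E[D_n^2]\to\mathbb E[D^2]$; (iv) for all sufficiently large $n$, no $k\in\mathbb N_0$ with $\Pr(D=k)=0$ occurs among the $d_{n,i}$, $i\in[n]$. Let $\mathbb G_n(\boldsymbol d_n)$ be a uniformly random simple graph with vertex set $[n]$ and degree sequence $\boldsymbol d_n$. Put $\lambda_i=\Pr(D=i)$, $\rho_1=\mathbb E[D]$, $\rho_2=\mathbb E[D(D-1)]$ and $\nu=\rho_2/\rho_1$ (in the degenerate case $\rho_1=0$ every quotient by $\rho_1$ is read as $0$). A finite connected graph is unicyclic if it has as many edges as vertices. A simple fragment is a finite simple graph,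 possibly without vertices, all of whose connected components are unicyclic. For a finite simple graph $\Gamma$ let $\mathrm{Frag}(\Gamma)$ be the union of its unicyclic connected components, and put $\mathrm{Frag}_n=\mathrm{Frag}(\mathbb G_n(\boldsymbol d_n))$. Assume that $\nu<1$ and let $G$ be a simple fragment. Then $$\lim_{n\to\infty}\Pr(\mathrm{Frag}_n\simeq G)=\frac{\sqrt{1-\nu}\;e^{\nu/2+\nu^2/4}}{\mathrm{aut}(G)}\prod_{i\ge 0}\left(\frac{\lambda_i\, i!}{\rho_1}\right)^{g_i},$$ where the limit exists, $\mathrm{aut}(G)$ is the number of automorphisms of $G$, $g_i=|\{v\in V(G):\deg(v)=i\}|$, and $0^0=1$. -/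

import Mathlib

open MeasureTheory ProbabilityTheory Filter Topology
open scoped BoundedContinuousFunction Nat

noncomputable section

/-- `G` has degree sequence `d`: every vertex `v` has degree `d v`. -/
def HasDegreeSequence {n : ℕ} (d : Fin n → ℕ) (G : SimpleGraph (Fin n)) : Prop :=
  ∀ v, (G.neighborSet v).ncard = d v

/-- `d` is feasible: some simple graph on the vertex set `Fin n` has degree sequence `d`. -/
def Feasible {n : ℕ} (d : Fin n → ℕ) : Prop :=
  ∃ G : SimpleGraph (Fin n), HasDegreeSequence d G

/-- The law `D_n` of the degree of a uniformly random vertex: `k` has mass `#{i | d i = k} / n`. -/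
def degreeLaw {n : ℕ} (d : Fin n → ℕ) : Measure ℕ :=
  (uniformOn (Set.univ : Set (Fin n))).map d

/-- The standing assumption on a sequence `d` of degree sequences (`d n` has length `n`) and a
limiting degree distribution `D` on `ℕ`. -/
structure DegreeAssumption (d : (n : ℕ) → Fin n → ℕ) (D : ProbabilityMeasure ℕ) : Prop where
  /-- every `d n` is feasible -/
  feasible : ∀ n, Feasible (d n)
  /-- `D_n → D` in distribution -/
  tendsto_law : ∀ f : ℕ →ᵇ ℝ,
    Tendsto (fun n => ∫ k, f k ∂(degreeLaw (d n))) atTop (𝓝 (∫ k, f k ∂(D : Measure ℕ)))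
  /-- the second (hence also the first) moment of `D` is finite -/
  integrable_sq : Integrable (fun k : ℕ => (k : ℝ) ^ 2) (D : Measure ℕ)
  /-- `E[D_n] → E[D]` -/
  tendsto_mean :
    Tendsto (fun n => ∫ k, (k : ℝ) ∂(degreeLaw (d n))) atTop (𝓝 (∫ k, (k : ℝ) ∂(D : Measure ℕ)))
  /-- `E[D_n ^ 2] → E[D ^ 2]` -/
  tendsto_sq :
    Tendsto (fun n => ∫ k, (k : ℝ) ^ 2 ∂(degreeLaw (d n))) atTop
      (𝓝 (∫ k, (k : ℝ) ^ 2 ∂(D : Measure ℕ)))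
  /-- degrees of limiting probability `0` do not occur, for all sufficiently large `n` -/
  no_rare_degree : ∀ᶠ n in atTop, ∀ k, (D : Measure ℕ).real {k} = 0 → ∀ i, d n i ≠ k

/-- `λ_k = P(D = k)`. -/
def limitMass (D : ProbabilityMeasure ℕ) (k : ℕ) : ℝ := (D : Measure ℕ).real {k}

/-- `ρ_k = E[D (D - 1) ⋯ (D - k + 1)]`, the `k`-th factorial moment of `D`. -/
def factorialMoment (D : ProbabilityMeasure ℕ) (k : ℕ) : ℝ :=
  ∫ x, (x.descFactorial k : ℝ) ∂(D : Measure ℕ)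

/-- `ν = ρ_2 / ρ_1`. -/
def nuParam (D : ProbabilityMeasure ℕ) : ℝ := factorialMoment D 2 / factorialMoment D 1

/-- The probability that the uniformly random simple graph on `Fin n` with degree sequence `d`
has the property `P`. -/
def randomGraphProb {n : ℕ} (d : Fin n → ℕ) (P : SimpleGraph (Fin n) → Prop) : ℝ :=
  ({G | HasDegreeSequence d G ∧ P G}.ncard : ℝ) / ({G | HasDegreeSequence d G}.ncard : ℝ)

/-- A finite graph is unicyclic if it is connected and has as many edges as vertices
(excess zero). -/
def IsUnicyclic {V : Type*} [Finite V] (G : SimpleGraph V) : Prop :=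
  G.Connected ∧ Nat.card G.edgeSet = Nat.card V

/-- A finite simple graph is a (simple) fragment if it is a disjoint union of unicyclic
components. The graph without vertices is the empty fragment. -/
def IsSimpleFragment {V : Type*} [Finite V] (G : SimpleGraph V) : Prop :=
  ∀ c : G.ConnectedComponent, IsUnicyclic c.toSimpleGraph

/-- The vertices of `G` that lie in unicyclic components. -/
def fragVerts {V : Type*} [Finite V] (G : SimpleGraph V) : Set V :=
  {v | IsUnicyclic (G.connectedComponentMk v).toSimpleGraph}

/-- `Frag(G)`, the union of the unicyclic components of `G`. -/
def Frag {V : Type*} [Finite V] (G : SimpleGraph V) : SimpleGraph (fragVerts G) :=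
  G.induce (fragVerts G)

/-- The number of vertices of degree `i` in `G`. -/
def numDegree {V : Type*} (G : SimpleGraph V) (i : ℕ) : ℕ :=
  {v | (G.neighborSet v).ncard = i}.ncard

/-- The number of automorphisms of `G`. -/
def autCount {V : Type*} (G : SimpleGraph V) : ℕ := Nat.card (G ≃g G)

end

noncomputable section

open scoped Classical

section Pairings

variable {H : Type*} [Fintype H]

/-- The perfect matchings of `H`, as fixed-point-free involutions. -/
def pairings (H : Type*) [Fintype H] : Finset (H → H) :=
  {σ | (∀ h, σ (σ h) = h) ∧ ∀ h, σ h ≠ h}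

lemma mem_pairings {σ : H → H} :
    σ ∈ pairings H ↔ (∀ h, σ (σ h) = h) ∧ ∀ h, σ h ≠ h := by
  simp [pairings]

/-- The probability of an event for a uniformly random perfect matching. -/
def pairProb (E : (H → H) → Prop) : ℝ :=
  ((pairings H).filter E).card / (pairings H).card

lemma pairProb_nonneg (E : (H → H) → Prop) : 0 ≤ pairProb E := by
  unfold pairProb; positivity

lemma pairProb_mono {E F : (H → H) → Prop} (h : ∀ σ ∈ pairings H, E σ → F σ) :
    pairProb E ≤ pairProb F := by
  unfold pairProb
  gcongr 1
  exact_mod_cast Finset.card_le_card (fun σ hσ => by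
    rw [Finset.mem_filter] at hσ ⊢
    exact ⟨hσ.1, h σ hσ.1 hσ.2⟩)

lemma pairProb_eq_sum (E : (H → H) → Prop) :
    pairProb E = (∑ σ ∈ pairings H, if E σ then (1 : ℝ) else 0) / (pairings H).card := by
  unfold pairProb
  congr 1
  rw [Finset.sum_boole]

lemma pairProb_exists_le {X : Type*} (s : Finset X) (E : X → (H → H) → Prop) :
    pairProb (fun σ => ∃ x ∈ s, E x σ) ≤ ∑ x ∈ s, pairProb (E x) := by
  unfold pairProb
  rw [← Finset.sum_div]
  gcongr 1
  have : (pairings H).filter (fun σ => ∃ x ∈ s, E x σ)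
      ⊆ s.biUnion (fun x => (pairings H).filter (E x)) := by
    intro σ hσ
    simp only [Finset.mem_filter, Finset.mem_biUnion] at hσ ⊢
    obtain ⟨h1, x, hx, h2⟩ := hσ
    exact ⟨x, hx, h1, h2⟩
  have h := (Finset.card_le_card this).trans Finset.card_biUnion_le
  rw [← Nat.cast_sum]
  exact Nat.cast_le.2 (le_trans (le_of_eq (by congr!)) h)

lemma pairProb_or_le (E F : (H → H) → Prop) :
    pairProb (fun σ => E σ ∨ F σ) ≤ pairProb E + pairProb F := by
  unfold pairProb
  rw [← add_div, ← Nat.cast_add]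
  gcongr 2
  refine le_trans (le_of_eq ?_) (Finset.card_union_le _ _)
  rw [← Finset.filter_or]
  congr!

lemma abs_pairProb_sub_le {E F B : (H → H) → Prop}
    (h : ∀ σ ∈ pairings H, ¬ B σ → (E σ ↔ F σ)) :
    |pairProb E - pairProb F| ≤ pairProb B := by
  have h1 : pairProb E ≤ pairProb F + pairProb B :=
    (pairProb_mono (fun σ hσ hE => by
      by_cases hB : B σ
      · exact Or.inr hB
      · exact Or.inl ((h σ hσ hB).1 hE))).trans (pairProb_or_le F B)
  have h2 : pairProb F ≤ pairProb E + pairProb B :=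
    (pairProb_mono (fun σ hσ hE => by
      by_cases hB : B σ
      · exact Or.inr hB
      · exact Or.inl ((h σ hσ hB).2 hE))).trans (pairProb_or_le E B)
  rw [abs_le]
  constructor <;> linarith

/-- Conjugation by a transposition preserves perfect matchings. -/
lemma conj_swap_mem_pairings {σ : H → H} (hσ : σ ∈ pairings H) (y z : H) :
    (fun h => Equiv.swap y z (σ (Equiv.swap y z h))) ∈ pairings H := by
  rw [mem_pairings] at hσ ⊢
  refine ⟨fun h => by simp [hσ.1], fun h hh => ?_⟩
  have := congrArg (Equiv.swap y z) hh
  simp only [Equiv.swap_apply_self] at this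
  exact hσ.2 _ this

lemma card_pairings_prescribed_le (Q : Finset H) (f : H → H)
    {x y z : H} (hy : y ∉ Q) (hz : z ∉ Q) (hf : ∀ q ∈ Q, f q ∈ Q)
    (hxy : x ≠ y) (hxz : x ≠ z) :
    ((pairings H).filter (fun σ => (∀ q ∈ Q, σ q = f q) ∧ σ x = y)).card
      ≤ ((pairings H).filter (fun σ => (∀ q ∈ Q, σ q = f q) ∧ σ x = z)).card := by
  have hsw : ∀ q ∈ Q, Equiv.swap y z q = q := fun q hq =>
    Equiv.swap_apply_of_ne_of_ne (by rintro rfl; exact hy hq) (by rintro rfl; exact hz hq)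
  apply Finset.card_le_card_of_injOn (fun σ h => Equiv.swap y z (σ (Equiv.swap y z h)))
  · intro σ hσ
    simp only [Finset.coe_filter, Set.mem_ofPred_eq] at hσ ⊢
    refine ⟨conj_swap_mem_pairings hσ.1 y z, fun q hq => ?_, ?_⟩
    · rw [hsw q hq, hσ.2.1 q hq, hsw _ (hf q hq)]
    · rw [Equiv.swap_apply_of_ne_of_ne hxy hxz, hσ.2.2, Equiv.swap_apply_left]
  · intro σ _ τ _ h
    funext w
    have := congrFun h (Equiv.swap y z w)
    simpa using this

/-- Given the matching on `Q`, the partner of `x` is uniform on the other free points. -/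
lemma card_pairings_prescribed_mul (Q : Finset H) (f : H → H)
    {x y : H} (hx : x ∉ Q) (hy : y ∉ Q) (hf : ∀ q ∈ Q, f q ∈ Q)
    (hxy : x ≠ y) :
    (((pairings H).filter (fun σ => (∀ q ∈ Q, σ q = f q) ∧ σ x = y)).card : ℝ)
      * (Fintype.card H - 1 - Q.card)
      = ((pairings H).filter (fun σ => ∀ q ∈ Q, σ q = f q)).card := by
  have hmaps : ∀ σ ∈ (pairings H).filter (fun σ => ∀ q ∈ Q, σ q = f q),
      σ x ∈ (Qᶜ).erase x := by
    intro σ hσ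
    rw [Finset.mem_filter, mem_pairings] at hσ
    rw [Finset.mem_erase, Finset.mem_compl]
    refine ⟨hσ.1.2 x, fun h => hx ?_⟩
    have := hf _ h
    rw [← hσ.2 _ h, hσ.1.1] at this
    exact this
  rw [Finset.card_eq_sum_card_fiberwise hmaps]
  have hc : ∀ z ∈ (Qᶜ).erase x,
      (((pairings H).filter (fun σ => ∀ q ∈ Q, σ q = f q)).filter (fun σ => σ x = z)).card
      = ((pairings H).filter (fun σ => (∀ q ∈ Q, σ q = f q) ∧ σ x = y)).card := by
    intro z hz
    rw [Finset.mem_erase, Finset.mem_compl] at hz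
    rw [Finset.filter_filter]
    exact le_antisymm
      (card_pairings_prescribed_le Q f hz.2 hy hf hz.1.symm hxy)
      (card_pairings_prescribed_le Q f hy hz.2 hf hxy hz.1.symm)
  rw [Finset.sum_congr rfl hc, Finset.sum_const, smul_eq_mul]
  have hcard : ((Qᶜ).erase x).card + 1 + Q.card = Fintype.card H := by
    rw [Finset.card_erase_add_one (by simpa using hx), Finset.card_compl_add_card]
  have : (((Qᶜ).erase x).card : ℝ) = Fintype.card H - 1 - Q.card := by
    rw [← hcard]; push_cast; ring
  push_cast
  rw [this, mul_comm]

/-- `∏_{i<k} 1/(M-1-2i)`, the probability that `k` given pairs belong to a random matching. -/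
def pairWeight (M k : ℕ) : ℝ := ∏ i ∈ Finset.range k, ((M : ℝ) - 1 - 2 * i)⁻¹

lemma pairWeight_succ (M k : ℕ) :
    pairWeight M (k + 1) = pairWeight M k * ((M : ℝ) - 1 - 2 * k)⁻¹ := by
  rw [pairWeight, Finset.prod_range_succ, pairWeight]

variable {J : Type*}

lemma card_pairings_prescribed_finset {x y : J → H}
    (hinj : Function.Injective (Sum.elim x y)) (s : Finset J) :
    (((pairings H).filter (fun σ => ∀ j ∈ s, σ (x j) = y j)).card : ℝ)
      = (pairings H).card * pairWeight (Fintype.card H) s.card ∧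
    ∀ a b, a ∉ s.image x ∪ s.image y →
      (((pairings H).filter (fun σ => (∀ j ∈ s, σ (x j) = y j) ∧ σ a = b)).card : ℝ)
      ≤ (pairings H).card * pairWeight (Fintype.card H) (s.card + 1) ∧
      (b ∉ s.image x ∪ s.image y → a ≠ b → 
      (((pairings H).filter (fun σ => (∀ j ∈ s, σ (x j) = y j) ∧ σ a = b)).card : ℝ)
      = (pairings H).card * pairWeight (Fintype.card H) (s.card + 1)) := by
  have hx : Function.Injective x := fun i j h => by
    have := @hinj (Sum.inl i) (Sum.inl j) h; simpa using this
  have hy : Function.Injective y := fun i j h => by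
    have := @hinj (Sum.inr i) (Sum.inr j) h; simpa using this
  have hxy : ∀ i j, x i ≠ y j := fun i j h => by
    have := @hinj (Sum.inl i) (Sum.inr j) h; simp at this
  have key : ∀ s : Finset J, 
    (((pairings H).filter (fun σ => ∀ j ∈ s, σ (x j) = y j)).card : ℝ)
      = (pairings H).card * pairWeight (Fintype.card H) s.card →
    ∀ a b, a ∉ s.image x ∪ s.image y →
      (((pairings H).filter (fun σ => (∀ j ∈ s, σ (x j) = y j) ∧ σ a = b)).card : ℝ)
      ≤ (pairings H).card * pairWeight (Fintype.card H) (s.card + 1) ∧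
      (b ∉ s.image x ∪ s.image y → a ≠ b → 
      (((pairings H).filter (fun σ => (∀ j ∈ s, σ (x j) = y j) ∧ σ a = b)).card : ℝ)
      = (pairings H).card * pairWeight (Fintype.card H) (s.card + 1)) := by
    intro s hs a b ha
    set Q := s.image x ∪ s.image y with hQ
    have hQcard : Q.card = 2 * s.card := by
      rw [hQ, Finset.card_union_of_disjoint, Finset.card_image_of_injective _ hx,
        Finset.card_image_of_injective _ hy]
      · ring
      · rw [Finset.disjoint_left]
        intro h h1 h2
        simp only [Finset.mem_image] at h1 h2
        obtain ⟨i, _, rfl⟩ := h1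
        obtain ⟨j, _, h2⟩ := h2
        exact hxy i j h2.symm
    rcases Finset.eq_empty_or_nonempty
      ((pairings H).filter (fun σ => ∀ j ∈ s, σ (x j) = y j)) with he | ⟨τ, hτ⟩
    · have he2 : (pairings H).filter (fun σ => (∀ j ∈ s, σ (x j) = y j) ∧ σ a = b) = ∅ := by
        rw [← Finset.filter_filter, he, Finset.filter_empty]
      rw [he] at hs
      rw [he2, pairWeight_succ, ← mul_assoc, ← hs]
      simp
    · rw [Finset.mem_filter, mem_pairings] at hτ
      have hτy : ∀ j ∈ s, τ (y j) = x j := fun j hj => by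
        rw [← hτ.2 j hj, hτ.1.1]
      have hQiff : ∀ σ ∈ pairings H, (∀ j ∈ s, σ (x j) = y j) ↔ ∀ q ∈ Q, σ q = τ q := by
        intro σ hσ
        rw [mem_pairings] at hσ
        constructor
        · intro h q hq
          simp only [hQ, Finset.mem_union, Finset.mem_image] at hq
          rcases hq with ⟨j, hj, rfl⟩ | ⟨j, hj, rfl⟩
          · rw [h j hj, hτ.2 j hj]
          · rw [hτy j hj, ← h j hj, hσ.1]
        · intro h j hj
          rw [h _ (by simp only [hQ, Finset.mem_union, Finset.mem_image]; exact Or.inl ⟨j, hj, rfl⟩), hτ.2 j hj]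
      have hf : ∀ q ∈ Q, τ q ∈ Q := by
        intro q hq
        simp only [hQ, Finset.mem_union, Finset.mem_image] at hq ⊢
        rcases hq with ⟨j, hj, rfl⟩ | ⟨j, hj, rfl⟩
        · exact Or.inr ⟨j, hj, (hτ.2 j hj).symm⟩
        · exact Or.inl ⟨j, hj, (hτy j hj).symm⟩
      have e1 : (pairings H).filter (fun σ => ∀ j ∈ s, σ (x j) = y j)
          = (pairings H).filter (fun σ => ∀ q ∈ Q, σ q = τ q) :=
        Finset.filter_congr (fun σ hσ => hQiff σ hσ)
      have e2 : (pairings H).filter (fun σ => (∀ j ∈ s, σ (x j) = y j) ∧ σ a = b)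
          = (pairings H).filter (fun σ => (∀ q ∈ Q, σ q = τ q) ∧ σ a = b) :=
        Finset.filter_congr (fun σ hσ => by rw [hQiff σ hσ])
      have hQa : (Q.card : ℝ) + 1 + 1 ≤ Fintype.card H := by
        have h3 : τ a ∉ insert a Q := by
          rw [Finset.mem_insert, not_or]
          refine ⟨hτ.1.2 a, fun h => ha ?_⟩
          have := hf _ h
          rwa [hτ.1.1] at this
        have := Finset.card_le_univ (insert (τ a) (insert a Q))
        rw [Finset.card_insert_of_notMem h3, Finset.card_insert_of_notMem ha] at this
        exact_mod_cast this
      have hpos : (0 : ℝ) < Fintype.card H - 1 - Q.card := by linarith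
      have heq : ∀ b, b ∉ Q → a ≠ b →
         (((pairings H).filter (fun σ => (∀ q ∈ Q, σ q = τ q) ∧ σ a = b)).card : ℝ)
          = (pairings H).card * pairWeight (Fintype.card H) (s.card + 1) := by
        intro b hb hab
        have := card_pairings_prescribed_mul Q τ ha hb hf hab
        rw [← e1, hs] at this
        rw [pairWeight_succ, ← mul_assoc, ← this]
        have h2 : (Fintype.card H : ℝ) - 1 - 2 * s.card = Fintype.card H - 1 - Q.card := by
          rw [hQcard]; push_cast; ring
        rw [h2]
        field_simp
      rw [e2]
      refine ⟨?_, fun hb hab => heq b hb hab⟩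
      by_cases hb : b ∉ Q ∧ a ≠ b
      · exact (heq b hb.1 hb.2).le
      · have he : (pairings H).filter (fun σ => (∀ q ∈ Q, σ q = τ q) ∧ σ a = b) = ∅ := by
          rw [Finset.filter_eq_empty_iff]
          rintro σ hσ ⟨h1, h2⟩
          rw [mem_pairings] at hσ
          apply hb
          refine ⟨fun hbQ => ha ?_, ?_⟩
          · have := hf b hbQ
            rwa [← h1 b hbQ, ← h2, hσ.1] at this
          · rw [← h2]; exact (hσ.2 a).symm
        have h0 := heq (τ a) (fun h => ha (by have := hf _ h; rwa [hτ.1.1] at this)) (hτ.1.2 a).symm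
        rw [he, ← h0]
        simp
  have base : ∀ s : Finset J, 
    (((pairings H).filter (fun σ => ∀ j ∈ s, σ (x j) = y j)).card : ℝ)
      = (pairings H).card * pairWeight (Fintype.card H) s.card := by
    intro s
    induction s using Finset.induction_on with
    | empty => simp [pairWeight]
    | insert i s hi ih =>
      have hfresh : ∀ z, (z = x i ∨ z = y i) → z ∉ s.image x ∪ s.image y := by
        intro z hz h
        simp only [Finset.mem_union, Finset.mem_image] at h
        rcases hz with rfl | rfl
        · rcases h with ⟨j, hj, h⟩ | ⟨j, hj, h⟩
          · exact hi (hx h ▸ hj)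
          · exact hxy i j h.symm
        · rcases h with ⟨j, hj, h⟩ | ⟨j, hj, h⟩
          · exact hxy j i h
          · exact hi (hy h ▸ hj)
      have := (key s ih (x i) (y i) (hfresh _ (Or.inl rfl))).2 (hfresh _ (Or.inr rfl)) (hxy i i)
      rw [Finset.card_insert_of_notMem hi, ← this]
      congr 2
      apply Finset.filter_congr
      intro σ _
      rw [Finset.forall_mem_insert, and_comm]
  exact ⟨base s, key s (base s)⟩

lemma pairProb_prescribed [Fintype J] {x y : J → H}
    (hne : (pairings H).Nonempty)
    (hinj : Function.Injective (Sum.elim x y)) :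
    pairProb (fun σ => ∀ j, σ (x j) = y j) = pairWeight (Fintype.card H) (Fintype.card J) := by
  have h := (card_pairings_prescribed_finset hinj Finset.univ).1
  have hpos : (0 : ℝ) < (pairings H).card := by exact_mod_cast hne.card_pos
  simp only [Finset.mem_univ, true_imp_iff] at h
  rw [← Finset.card_univ (α := J), pairProb, div_eq_iff hpos.ne', mul_comm (pairWeight _ _), ← h]
  congr!

lemma pairProb_prescribed_and_le [Fintype J] {x y : J → H}
    (hne : (pairings H).Nonempty)
    (hinj : Function.Injective (Sum.elim x y)) {a : H} (ha : ∀ j, a ≠ x j ∧ a ≠ y j) (b : H) :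
    pairProb (fun σ => (∀ j, σ (x j) = y j) ∧ σ a = b)
      ≤ pairWeight (Fintype.card H) (Fintype.card J + 1) := by
  have h := ((card_pairings_prescribed_finset hinj Finset.univ).2 a b (by
    simp only [Finset.mem_union, Finset.mem_image, Finset.mem_univ, true_and, not_or, not_exists]
    exact ⟨fun j h => (ha j).1 h.symm, fun j h => (ha j).2 h.symm⟩)).1
  have hpos : (0 : ℝ) < (pairings H).card := by exact_mod_cast hne.card_pos
  simp only [Finset.mem_univ, true_imp_iff] at h
  rw [pairProb, div_le_iff₀ hpos, mul_comm (pairWeight _ _),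
    ← Finset.card_univ (α := J)]
  refine le_trans (le_of_eq ?_) h
  congr!

/-- The number of perfect matchings depends only on the number of points. -/
lemma card_pairings_congr {H' : Type*} [Fintype H'] (e : H ≃ H') :
    (pairings H).card = (pairings H').card := by
  apply Finset.card_equiv (e.arrowCongr e)
  intro σ
  rw [mem_pairings, mem_pairings]
  simp only [Equiv.arrowCongr_apply, Function.comp_apply, Equiv.symm_apply_apply]
  constructor
  · rintro ⟨h1, h2⟩
    refine ⟨fun h => by rw [h1]; simp, fun h hh => h2 (e.symm h) ?_⟩
    rw [Equiv.eq_symm_apply, hh]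
  · rintro ⟨h1, h2⟩
    refine ⟨fun h => ?_, fun h hh => h2 (e h) ?_⟩
    · have := h1 (e h); simpa using this
    · simp [hh]

/-- The number of perfect matchings of an `N`-element set. -/
def numPairings (N : ℕ) : ℕ := (pairings (Fin N)).card

lemma card_pairings (H : Type*) [Fintype H] :
    (pairings H).card = numPairings (Fintype.card H) :=
  card_pairings_congr (Fintype.equivFin H)

lemma numPairings_zero : numPairings 0 = 1 := by
  unfold numPairings
  rw [Finset.card_eq_one]
  refine ⟨id, ?_⟩
  ext σ
  simp [mem_pairings, eq_iff_true_of_subsingleton]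

lemma numPairings_add_two (N : ℕ) : numPairings (N + 2) = (N + 1) * numPairings N := by
  have h := card_pairings_prescribed_mul (H := Option (Option (Fin N))) ∅ id (x := none)
    (y := some none) (by simp) (by simp) (by simp) (by simp)
  simp only [Finset.notMem_empty, false_imp_iff, implies_true, true_and, Finset.filter_true,
    Finset.card_empty, Nat.cast_zero, sub_zero, Fintype.card_option, Fintype.card_fin,
    card_pairings (Option (Option (Fin N)))] at h
  have h2 : ((pairings (Option (Option (Fin N)))).filter
      (fun σ => σ none = some none)).card = numPairings N := by
    symm
    let F : (Fin N → Fin N) → Option (Option (Fin N)) → Option (Option (Fin N)) := fun τ o =>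
      match o with
      | none => some none
      | some none => none
      | some (some i) => some (some (τ i))
    apply Finset.card_bij (fun τ _ => F τ)
    · intro τ hτ
      rw [mem_pairings] at hτ
      rw [Finset.mem_filter, mem_pairings]
      refine ⟨⟨?_, ?_⟩, rfl⟩
      · rintro (_ | _ | i) <;> simp [F, hτ.1]
      · rintro (_ | _ | i) <;> simp [F, hτ.2]
    · intro τ _ τ' _ h
      funext i
      have := congrFun h (some (some i))
      simpa [F] using this
    · intro σ hσ
      rw [Finset.mem_filter, mem_pairings] at hσ
      obtain ⟨⟨h1, h2⟩, h3⟩ := hσ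
      have h4 : σ (some none) = none := by rw [← h3, h1]
      have h5 : ∀ i, ∃ j, σ (some (some i)) = some (some j) := by
        intro i
        rcases h : σ (some (some i)) with _ | _ | j
        · have := h1 (some (some i)); rw [h, h3] at this; simp at this
        · have := h1 (some (some i)); rw [h, h4] at this; simp at this
        · exact ⟨j, rfl⟩
      choose τ hτ using h5
      refine ⟨τ, ?_, ?_⟩
      · rw [mem_pairings]
        refine ⟨fun i => ?_, fun i hi => h2 (some (some i)) (by rw [hτ, hi])⟩
        have := h1 (some (some i))
        rw [hτ, hτ] at this
        simpa using this
      · funext o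
        rcases o with _ | _ | i
        · exact h3.symm
        · exact h4.symm
        · exact (hτ i).symm
  rw [h2] at h
  have : (numPairings (N + 2) : ℝ) = ((N + 1) * numPairings N : ℕ) := by
    push_cast
    rw [show N + 2 = N + 1 + 1 from rfl, ← h]
    push_cast
    ring
  exact_mod_cast this

lemma numPairings_pos {N : ℕ} (hN : Even N) : 0 < numPairings N := by
  obtain ⟨k, rfl⟩ := hN
  induction k with
  | zero => simp [numPairings_zero]
  | succ k ih =>
    rw [show k + 1 + (k + 1) = k + k + 2 by ring, numPairings_add_two]
    positivity

lemma pairings_nonempty (h : Even (Fintype.card H)) : (pairings H).Nonempty := by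
  rw [← Finset.card_pos, card_pairings]
  exact numPairings_pos h

lemma numPairings_div (N k : ℕ) (hN : Even N) :
    (numPairings N : ℝ) / numPairings (N + 2 * k) = pairWeight (N + 2 * k) k := by
  have h : ∀ k, (numPairings (N + 2 * k) : ℝ)
      = numPairings N * ∏ i ∈ Finset.range k, ((N : ℝ) + 1 + 2 * i) := by
    intro k
    induction k with
    | zero => simp
    | succ k ih =>
      rw [Finset.prod_range_succ, ← mul_assoc, ← ih, show N + 2 * (k + 1) = N + 2 * k + 2 by ring,
        numPairings_add_two]
      push_cast
      ring
  have hpos : (0 : ℝ) < numPairings N := by exact_mod_cast numPairings_pos hN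
  rw [h, pairWeight, Finset.prod_inv_distrib, ← Finset.prod_range_reflect]
  rw [div_mul_cancel_left₀ hpos.ne']
  congr 1
  apply Finset.prod_congr rfl
  intro i hi
  rw [Finset.mem_range] at hi
  rw [show k - 1 - i = k - (1 + i) by omega, Nat.cast_sub (by omega)]
  push_cast
  ring

end Pairings

section Turns

variable {H ι : Type*} (v : H → ι)

/-- A turn at a vertex: an ordered pair of distinct half-edges at it. -/
abbrev Turn : Type _ := {p : H × H // v p.1 = v p.2 ∧ p.1 ≠ p.2}

/-- The vertex of a turn. -/
def Turn.vert {v : H → ι} (p : Turn v) : ι := v p.1.1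

/-- The half-edge through which a turn enters its vertex. -/
def Turn.enter {v : H → ι} (p : Turn v) : H := p.1.1

/-- The half-edge through which a turn leaves its vertex. -/
def Turn.leave {v : H → ι} (p : Turn v) : H := p.1.2

/-- The reversed turn. -/
def Turn.rev {v : H → ι} (p : Turn v) : Turn v := ⟨(p.1.2, p.1.1), p.2.1.symm, p.2.2.symm⟩

variable {v}

lemma Turn.vert_enter (p : Turn v) : v p.enter = p.vert := rfl

lemma Turn.vert_leave (p : Turn v) : v p.leave = p.vert := p.2.1.symm

lemma Turn.enter_ne_leave (p : Turn v) : p.enter ≠ p.leave := p.2.2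

@[simp] lemma Turn.vert_rev (p : Turn v) : p.rev.vert = p.vert := p.2.1.symm

@[simp] lemma Turn.enter_rev (p : Turn v) : p.rev.enter = p.leave := rfl

@[simp] lemma Turn.leave_rev (p : Turn v) : p.rev.leave = p.enter := rfl

lemma Turn.ext_halves {p q : Turn v} (h1 : p.enter = q.enter) (h2 : p.leave = q.leave) : p = q :=
  Subtype.ext (Prod.ext h1 h2)

variable [Fintype H] (v)

/-- Families of turns at distinct vertices. -/
def transversals (J : Type*) [Fintype J] : Finset (J → Turn v) :=
  {α | Function.Injective (fun j => (α j).vert)}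

variable {v}

lemma mem_transversals {J : Type*} [Fintype J] {α : J → Turn v} :
    α ∈ transversals v J ↔ Function.Injective (fun j => (α j).vert) := by
  simp [transversals]

lemma card_transversals_congr {J J' : Type*} [Fintype J] [Fintype J'] (e : J ≃ J') :
    (transversals v J).card = (transversals v J').card := by
  apply Finset.card_equiv (e.arrowCongr (Equiv.refl _))
  intro α
  rw [mem_transversals, mem_transversals]
  exact (Function.Injective.of_comp_iff' (f := fun j => (α j).vert) (g := e.symm) e.symm.bijective).symm

lemma card_transversals {J : Type*} [Fintype J] :
    (transversals v J).card = (transversals v (Fin (Fintype.card J))).card :=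
  card_transversals_congr (Fintype.equivFin J)

lemma card_transversals_succ (k : ℕ) :
    (transversals v (Fin (k + 1))).card
      = ∑ α ∈ transversals v (Fin k),
          (Finset.univ.filter (fun p : Turn v => ∀ j, p.vert ≠ (α j).vert)).card := by
  rw [← Finset.card_sigma]
  symm
  apply Finset.card_bij (fun x _ => (Fin.cons x.2 x.1 : Fin (k + 1) → Turn v))
  · rintro ⟨α, p⟩ h
    simp only [Finset.mem_sigma, mem_transversals, Finset.mem_filter, Finset.mem_univ,
      true_and] at h ⊢
    have : (fun j => (Fin.cons p α : Fin (k + 1) → Turn v) j |>.vert)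
        = Fin.cons p.vert (fun j => (α j).vert) := by
      funext j
      refine Fin.cases ?_ (fun i => ?_) j <;> simp
    rw [this, Fin.cons_injective_iff]
    refine ⟨?_, h.1⟩
    rintro ⟨j, hj⟩
    exact h.2 j hj.symm
  · rintro ⟨α, p⟩ _ ⟨β, q⟩ _ h
    have h' := (Fin.cons_inj (α := fun _ => Turn v)).1 h
    obtain ⟨rfl, rfl⟩ := h'
    rfl
  · intro γ hγ
    rw [mem_transversals] at hγ
    refine ⟨⟨Fin.tail γ, γ 0⟩, ?_, Fin.cons_self_tail γ⟩
    simp only [Finset.mem_sigma, mem_transversals, Finset.mem_filter, Finset.mem_univ, true_and]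
    refine ⟨fun i j h => ?_, fun j h => ?_⟩
    · exact Fin.succ_injective _ (hγ h)
    · exact Fin.succ_ne_zero j (hγ h).symm

lemma card_turn_avoiding {k : ℕ} {α : Fin k → Turn v} (hα : α ∈ transversals v (Fin k)) :
    (Finset.univ.filter (fun p : Turn v => ∀ j, p.vert ≠ (α j).vert)).card
      + ∑ j, (Finset.univ.filter (fun p : Turn v => p.vert = (α j).vert)).card
      = Fintype.card (Turn v) := by
  rw [mem_transversals] at hα
  rw [← Finset.card_biUnion, ← Finset.card_union_of_disjoint, ← Finset.card_univ]
  · congr 1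
    ext p
    simp only [Finset.mem_union, Finset.mem_filter, Finset.mem_univ, true_and, Finset.mem_biUnion,
      iff_true]
    by_cases h : ∃ j, p.vert = (α j).vert
    · exact Or.inr h
    · exact Or.inl (fun j hj => h ⟨j, hj⟩)
  · rw [Finset.disjoint_left]
    intro p h1 h2
    simp only [Finset.mem_filter, Finset.mem_univ, true_and, Finset.mem_biUnion] at h1 h2
    obtain ⟨j, hj⟩ := h2
    exact h1 j hj
  · intro i _ j _ hij
    rw [Function.onFun, Finset.disjoint_left]
    intro p h1 h2
    simp only [Finset.mem_filter, Finset.mem_univ, true_and] at h1 h2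
    exact hij (hα (h1.symm.trans h2))

lemma two_le_card_turn_at (p : Turn v) :
    2 ≤ (Finset.univ.filter (fun q : Turn v => q.vert = p.vert)).card := by
  rw [← Nat.succ_le_iff.symm.trans Iff.rfl]
  apply Finset.one_lt_card.2
  refine ⟨p, by simp, p.rev, by simp, fun h => ?_⟩
  have := congrArg Turn.enter h
  exact p.enter_ne_leave this

lemma card_turn_at_le {Δ : ℕ} (hΔ : ∀ u, (Finset.univ.filter (fun h => v h = u)).card ≤ Δ) (u : ι) :
    (Finset.univ.filter (fun q : Turn v => q.vert = u)).card ≤ Δ ^ 2 := by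
  have : (Finset.univ.filter (fun q : Turn v => q.vert = u)).card
      ≤ ((Finset.univ.filter (fun h => v h = u)) ×ˢ (Finset.univ.filter (fun h => v h = u))).card := by
    apply Finset.card_le_card_of_injOn Subtype.val
    · intro q hq
      simp only [Finset.coe_filter, Finset.mem_univ, true_and, Set.mem_ofPred_eq] at hq
      simp only [Finset.coe_product, Set.mem_prod, Finset.coe_filter, Finset.mem_univ, true_and, Set.mem_ofPred_eq]
      exact ⟨hq, by rw [← hq]; exact q.2.1.symm⟩
    · exact Subtype.val_injective.injOn
  rw [Finset.card_product] at this
  calc _ ≤ _ := this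
    _ ≤ Δ * Δ := Nat.mul_le_mul (hΔ u) (hΔ u)
    _ = Δ ^ 2 := by ring

variable (v)

/-- The number of families of `k` turns at distinct vertices. -/
def numTrans (k : ℕ) : ℕ := (transversals v (Fin k)).card

/-- The number of turns. -/
def numTurns : ℕ := Fintype.card (Turn v)

variable {v}

lemma numTrans_zero : numTrans v 0 = 1 := by
  simp [numTrans, transversals, Function.injective_of_subsingleton]

lemma numTrans_succ_add_le (k : ℕ) :
    numTrans v (k + 1) + 2 * k * numTrans v k ≤ numTurns v * numTrans v k := by
  rw [numTrans, card_transversals_succ]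
  have h : 2 * k * numTrans v k = ∑ α ∈ transversals v (Fin k), 2 * k := by
    rw [Finset.sum_const, smul_eq_mul, mul_comm]; rfl
  have h' : numTurns v * numTrans v k = ∑ α ∈ transversals v (Fin k), numTurns v := by
    rw [Finset.sum_const, smul_eq_mul, mul_comm]; rfl
  rw [h, h', ← Finset.sum_add_distrib]
  apply Finset.sum_le_sum
  intro α hα
  rw [numTurns, ← card_turn_avoiding hα]
  gcongr
  calc 2 * k = ∑ j : Fin k, 2 := by simp [mul_comm]
    _ ≤ _ := Finset.sum_le_sum (fun j _ => two_le_card_turn_at (α j))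

lemma numTurns_mul_le {Δ : ℕ} (hΔ : ∀ u, (Finset.univ.filter (fun h => v h = u)).card ≤ Δ)
    (k : ℕ) :
    numTurns v * numTrans v k ≤ numTrans v (k + 1) + k * Δ ^ 2 * numTrans v k := by
  rw [numTrans, numTrans, card_transversals_succ]
  have h : k * Δ ^ 2 * (transversals v (Fin k)).card
      = ∑ α ∈ transversals v (Fin k), k * Δ ^ 2 := by
    rw [Finset.sum_const, smul_eq_mul, mul_comm]
  have h' : numTurns v * (transversals v (Fin k)).card
      = ∑ α ∈ transversals v (Fin k), numTurns v := by
    rw [Finset.sum_const, smul_eq_mul, mul_comm]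
  rw [h, h', ← Finset.sum_add_distrib]
  apply Finset.sum_le_sum
  intro α hα
  rw [numTurns, ← card_turn_avoiding hα]
  gcongr
  calc _ ≤ ∑ j : Fin k, Δ ^ 2 := Finset.sum_le_sum (fun j _ => card_turn_at_le hΔ _)
    _ = k * Δ ^ 2 := by simp

variable (v)

/-- The expected number of families of `k` turns at distinct vertices that follow
prescribed connections. -/
def meanTrans (k : ℕ) : ℝ := numTrans v k * pairWeight (Fintype.card H) k

/-- Quantitative form of subcriticality of a configuration model. -/
structure Subcritical (c : ℝ) : Prop where
  nonneg : 0 ≤ c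
  lt_one : c < 1
  even : Even (Fintype.card H)
  turns_le : (numTurns v : ℝ) ≤ c * (Fintype.card H - 1)
  large : 2 ≤ (1 - c) * ((Fintype.card H : ℝ) - 1)

variable {v} {c : ℝ}

lemma Subcritical.half_le (h : Subcritical v c) {k i : ℕ} (hk : numTrans v k ≠ 0) (hi : i ≤ k) :
    (1 - c) * ((Fintype.card H : ℝ) - 1) / 2 ≤ (Fintype.card H : ℝ) - 1 - 2 * i := by
  have h2 : (2 * k : ℝ) ≤ numTurns v + 1 := by
    cases k with
    | zero => simp; positivity
    | succ k =>
      have h1 := numTrans_succ_add_le (v := v) k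
      have h3 : 2 * k < numTurns v := by
        by_contra hcon
        have : numTurns v * numTrans v k ≤ 2 * k * numTrans v k :=
          Nat.mul_le_mul_right _ (not_lt.1 hcon)
        omega
      have : 2 * (k + 1) ≤ numTurns v + 1 := by omega
      exact_mod_cast this
  have h3 : (i : ℝ) ≤ k := by exact_mod_cast hi
  have := h.turns_le
  have := h.large
  linarith

lemma Subcritical.pairWeight_nonneg (h : Subcritical v c) {k j : ℕ} (hk : numTrans v k ≠ 0)
    (hj : j ≤ k + 1) : 0 ≤ pairWeight (Fintype.card H) j := by
  apply Finset.prod_nonneg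
  intro i hi
  rw [Finset.mem_range] at hi
  have h1 := h.half_le hk (i := i) (by omega)
  have := h.large
  apply inv_nonneg.2
  linarith

lemma Subcritical.meanTrans_succ_le (h : Subcritical v c) (k : ℕ) :
    meanTrans v (k + 1) ≤ c * meanTrans v k := by
  have h1 : (numTrans v (k + 1) : ℝ) + 2 * k * numTrans v k ≤ numTurns v * numTrans v k := by
    exact_mod_cast numTrans_succ_add_le (v := v) k
  by_cases hk : numTrans v k = 0
  · rw [hk] at h1
    have : (numTrans v (k + 1) : ℝ) = 0 := le_antisymm (by simpa using h1) (by positivity)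
    simp [meanTrans, hk, this]
  · have h2 := h.half_le hk le_rfl
    have h3 := h.large
    have h4 := h.pairWeight_nonneg hk (j := k) (by omega)
    have h5 : 0 < (Fintype.card H : ℝ) - 1 - 2 * k := by linarith
    have h6 : (numTrans v (k + 1) : ℝ) ≤ c * (numTrans v k * (Fintype.card H - 1 - 2 * k)) := by
      have h7 : (numTurns v : ℝ) - 2 * k ≤ c * (Fintype.card H - 1 - 2 * k) := by
        have := h.turns_le
        have : c * k ≤ k := by nlinarith [h.lt_one.le, (Nat.cast_nonneg k : (0 : ℝ) ≤ k)]
        nlinarith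
      have h8 := mul_le_mul_of_nonneg_left h7 (Nat.cast_nonneg (numTrans v k) : (0 : ℝ) ≤ _)
      linarith
    rw [meanTrans, meanTrans, pairWeight_succ]
    calc (numTrans v (k + 1) : ℝ) * (pairWeight (Fintype.card H) k * ((Fintype.card H : ℝ) - 1 - 2 * k)⁻¹)
        ≤ c * (numTrans v k * (Fintype.card H - 1 - 2 * k))
          * (pairWeight (Fintype.card H) k * ((Fintype.card H : ℝ) - 1 - 2 * k)⁻¹) := by
          gcongr
      _ = _ := by field_simp

lemma Subcritical.meanTrans_le (h : Subcritical v c) (k : ℕ) : meanTrans v k ≤ c ^ k := by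
  induction k with
  | zero => simp [meanTrans, numTrans_zero, pairWeight]
  | succ k ih =>
    calc _ ≤ c * meanTrans v k := h.meanTrans_succ_le k
      _ ≤ c * c ^ k := mul_le_mul_of_nonneg_left ih h.nonneg
      _ = c ^ (k + 1) := by ring

lemma Subcritical.numTrans_mul_pairWeight_succ_le (h : Subcritical v c) (k : ℕ) :
    numTrans v k * pairWeight (Fintype.card H) (k + 1)
      ≤ c ^ k * (2 / ((1 - c) * ((Fintype.card H : ℝ) - 1))) := by
  have h3 := h.large
  by_cases hk : numTrans v k = 0
  · simp only [hk, Nat.cast_zero, zero_mul]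
    exact mul_nonneg (pow_nonneg h.nonneg _) (div_nonneg (by norm_num) (by linarith))
  · rw [pairWeight_succ, ← mul_assoc]
    have h2 := h.half_le hk le_rfl
    apply mul_le_mul (h.meanTrans_le k)
    · rw [show 2 / ((1 - c) * ((Fintype.card H : ℝ) - 1))
        = ((1 - c) * ((Fintype.card H : ℝ) - 1) / 2)⁻¹ by rw [inv_div]]
      exact inv_anti₀ (by linarith) h2
    · exact inv_nonneg.2 (by linarith)
    · exact pow_nonneg h.nonneg _

end Turns

section Limit

/-- A family of configuration models in the subcritical regime: the number of half-edges tends to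
infinity, the ratio of turns to half-edges converges to `ν < 1`, and the maximum degree is of
smaller order than the square root of the number of half-edges. -/
structure ConfigLimit {A : Type*} (l : Filter A) {H ι : A → Type} [∀ a, Fintype (H a)]
    (v : ∀ a, H a → ι a) (Δ : A → ℕ) (ν : ℝ) : Prop where
  even : ∀ᶠ a in l, Even (Fintype.card (H a))
  degree_le : ∀ᶠ a in l, ∀ u, (Finset.univ.filter (fun h => v a h = u)).card ≤ Δ a
  tendsto_card : Tendsto (fun a => (Fintype.card (H a) : ℝ)) l atTop
  tendsto_ratio : Tendsto (fun a => (numTurns (v a) : ℝ) / Fintype.card (H a)) l (𝓝 ν)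
  tendsto_max : Tendsto (fun a => (Δ a : ℝ) ^ 2 / Fintype.card (H a)) l (𝓝 0)
  lt_one : ν < 1

variable {A : Type*} {l : Filter A} {H ι : A → Type} [∀ a, Fintype (H a)]
    {v : ∀ a, H a → ι a} {Δ : A → ℕ} {ν : ℝ}

lemma ConfigLimit.tendsto_div_sub (h : ConfigLimit l v Δ ν) {f : A → ℝ} {x : ℝ}
    (hf : Tendsto (fun a => f a / Fintype.card (H a)) l (𝓝 x)) (C : ℝ) :
    Tendsto (fun a => f a / ((Fintype.card (H a) : ℝ) - C)) l (𝓝 x) := by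
  have h1 : Tendsto (fun a => 1 - C / (Fintype.card (H a) : ℝ)) l (𝓝 (1 - 0)) :=
    tendsto_const_nhds.sub (tendsto_const_nhds.div_atTop h.tendsto_card)
  have h2 := hf.div h1 (by norm_num)
  rw [sub_zero, div_one] at h2
  refine h2.congr' ?_
  filter_upwards [h.tendsto_card.eventually_gt_atTop (max 0 C)] with a ha
  have h3 : (0 : ℝ) < Fintype.card (H a) := (le_max_left _ _).trans_lt ha
  have h4 : (0 : ℝ) < Fintype.card (H a) - C := sub_pos.2 ((le_max_right _ _).trans_lt ha)
  have h5 : 1 - C / (Fintype.card (H a) : ℝ) = (Fintype.card (H a) - C) / Fintype.card (H a) := by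
    field_simp
  rw [Pi.div_apply, h5, div_div_div_cancel_right₀ h3.ne']

lemma ConfigLimit.exists_subcritical (h : ConfigLimit l v Δ ν) :
    ∃ c, 0 ≤ c ∧ c < 1 ∧ ∀ᶠ a in l, Subcritical (v a) c := by
  have hm : max ν 0 < 1 := max_lt h.lt_one one_pos
  refine ⟨(1 + max ν 0) / 2, by positivity, by linarith, ?_⟩
  have hc : ν < (1 + max ν 0) / 2 := by
    have := le_max_left ν 0
    linarith
  have hc1 : (1 + max ν 0) / 2 < 1 := by linarith
  generalize (1 + max ν 0) / 2 = c at hc hc1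
  have hc0 : 0 ≤ max c 0 := le_max_right _ _
  have h1 := h.tendsto_div_sub h.tendsto_ratio 1
  filter_upwards [h.even, h1.eventually_lt_const hc,
    h.tendsto_card.eventually_gt_atTop (1 + 2 / (1 - c))] with a h2 h3 h4
  have h5 : (0 : ℝ) < 1 - c := by linarith
  have h6 : 0 < 2 / (1 - c) := by positivity
  have h7 : (0 : ℝ) < Fintype.card (H a) - 1 := by linarith
  rw [div_lt_iff₀ h7] at h3
  refine ⟨?_, hc1, h2, h3.le, ?_⟩
  · by_contra hcon
    push Not at hcon
    have : (0 : ℝ) ≤ numTurns (v a) := by positivity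
    nlinarith
  · have : 2 / (1 - c) ≤ Fintype.card (H a) - 1 := by linarith
    rw [div_le_iff₀ h5] at this
    linarith

lemma ConfigLimit.tendsto_meanTrans (h : ConfigLimit l v Δ ν) (k : ℕ) :
    Tendsto (fun a => meanTrans (v a) k) l (𝓝 (ν ^ k)) := by
  induction k with
  | zero => simp [meanTrans, numTrans_zero, pairWeight, tendsto_const_nhds]
  | succ k ih =>
    obtain ⟨c, hc0, hc1, hsub⟩ := h.exists_subcritical
    have h1 : Tendsto (fun a => (numTurns (v a) : ℝ) / (Fintype.card (H a) - (1 + 2 * k))) l (𝓝 ν) :=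
      h.tendsto_div_sub h.tendsto_ratio _
    have h2 : Tendsto (fun a => (Δ a : ℝ) ^ 2 / (Fintype.card (H a) - (1 + 2 * k))) l (𝓝 0) :=
      h.tendsto_div_sub h.tendsto_max _
    have h3 := ih.mul h1
    have h4 := ih.mul (h1.sub (h2.const_mul (k : ℝ)))
    rw [mul_zero, sub_zero, ← pow_succ] at h4
    rw [← pow_succ] at h3
    refine tendsto_of_tendsto_of_tendsto_of_le_of_le' h4 h3 ?_ ?_
    · filter_upwards [hsub, h.degree_le, h.tendsto_card.eventually_gt_atTop (1 + 2 * k : ℝ)]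
        with a ha hΔ hM
      have h5 : (numTurns (v a) : ℝ) * numTrans (v a) k
          ≤ numTrans (v a) (k + 1) + k * Δ a ^ 2 * numTrans (v a) k := by
        exact_mod_cast numTurns_mul_le hΔ k
      have h6 : (0 : ℝ) < Fintype.card (H a) - 1 - 2 * k := by linarith
      have h7 : 0 ≤ pairWeight (Fintype.card (H a)) k := by
        apply Finset.prod_nonneg
        intro i hi
        rw [Finset.mem_range] at hi
        have : (i : ℝ) ≤ k := by exact_mod_cast hi.le
        apply inv_nonneg.2
        linarith
      rw [meanTrans, meanTrans, pairWeight_succ, ← sub_sub]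
      have h8 : (numTrans (v a) k : ℝ) * numTurns (v a) - k * (Δ a ^ 2 * numTrans (v a) k)
        ≤ numTrans (v a) (k + 1) := by linarith
      calc _ = ((numTrans (v a) k : ℝ) * numTurns (v a) - k * (Δ a ^ 2 * numTrans (v a) k))
            * (pairWeight (Fintype.card (H a)) k * ((Fintype.card (H a) : ℝ) - 1 - 2 * k)⁻¹) := by
            field_simp
        _ ≤ _ := by gcongr
    · filter_upwards [hsub, h.degree_le, h.tendsto_card.eventually_gt_atTop (1 + 2 * k : ℝ)]
        with a ha hΔ hM
      have h5 : (numTrans (v a) (k + 1) : ℝ) ≤ numTurns (v a) * numTrans (v a) k := by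
        have := numTrans_succ_add_le (v := v a) k
        have h9 : numTrans (v a) (k + 1) ≤ numTurns (v a) * numTrans (v a) k := by omega
        exact_mod_cast h9
      have h6 : (0 : ℝ) < Fintype.card (H a) - 1 - 2 * k := by linarith
      have h7 : 0 ≤ pairWeight (Fintype.card (H a)) k := by
        apply Finset.prod_nonneg
        intro i hi
        rw [Finset.mem_range] at hi
        have : (i : ℝ) ≤ k := by exact_mod_cast hi.le
        apply inv_nonneg.2
        linarith
      rw [meanTrans, meanTrans, pairWeight_succ, ← sub_sub]
      calc _ ≤ (numTurns (v a) * numTrans (v a) k : ℝ)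
            * (pairWeight (Fintype.card (H a)) k * ((Fintype.card (H a) : ℝ) - 1 - 2 * k)⁻¹) := by
            gcongr
        _ = _ := by field_simp

end Limit

section Follows

variable {H ι J : Type*} {v : H → ι}

lemma Turn.vert_eq_of_leave_eq {p q : Turn v} (h : p.leave = q.leave) : p.vert = q.vert :=
  p.vert_leave.symm.trans ((congrArg v h).trans q.vert_leave)

lemma Turn.vert_eq_of_enter_eq {p q : Turn v} (h : p.enter = q.enter) : p.vert = q.vert :=
  p.vert_enter.symm.trans ((congrArg v h).trans q.vert_enter)

lemma Turn.vert_eq_of_enter_eq_leave {p q : Turn v} (h : p.enter = q.leave) :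
    p.vert = q.vert :=
  p.vert_enter.symm.trans ((congrArg v h).trans q.vert_leave)

/-- The matching `σ` connects each turn of the family `α` with its successor. -/
def Follows (next : J → J) (α : J → Turn v) (σ : H → H) : Prop :=
  ∀ j, σ (α j).leave = (α (next j)).enter

/-- The half-edge `h` occurs in one of the turns of `α`. -/
def Uses (α : J → Turn v) (h : H) : Prop := ∃ j, h = (α j).enter ∨ h = (α j).leave

/-- The half-edges that non-backtracking walks traverse which leave the vertices of `α` through
a half-edge not used by `α`. -/
inductive Escapes (σ : H → H) (α : J → Turn v) : H → Prop
  | exit {h : H} (j : J) (hv : v h = (α j).vert) (hu : ¬ Uses α h) : Escapes σ α h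
  | step {h h' : H} (hr : Escapes σ α h) (hv : v h' = v (σ h)) (hne : h' ≠ σ h) : Escapes σ α h'

/-- No non-backtracking walk leaves the vertices of `α` through an unused half-edge and
returns. -/
def Isolated (σ : H → H) (α : J → Turn v) : Prop :=
  ∀ h, Escapes σ α h → ∀ j, v (σ h) ≠ (α j).vert

/-- The half-edges through which a path is left that starts with the half-edge `h₀` and
proceeds with the turns `γ`. -/
def pathExits (h₀ : H) {i : ℕ} (γ : Fin i → Turn v) : Fin (i + 1) → H :=
  Fin.cons h₀ (fun l => (γ l).leave)

lemma pathExits_snoc_castSucc (h₀ : H) {i : ℕ} (γ : Fin i → Turn v) (p : Turn v)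
    (l : Fin (i + 1)) :
    pathExits h₀ (Fin.snoc γ p : Fin (i + 1) → Turn v) l.castSucc = pathExits h₀ γ l := by
  refine Fin.cases ?_ (fun l => ?_) l
  · simp [pathExits]
  · rw [← Fin.succ_castSucc]
    simp only [pathExits, Fin.cons_succ]
    rw [Fin.snoc_castSucc]

lemma pathExits_snoc_last (h₀ : H) {i : ℕ} (γ : Fin i → Turn v) (p : Turn v) :
    pathExits h₀ (Fin.snoc γ p : Fin (i + 1) → Turn v) (Fin.last _) = p.leave := by
  rw [← Fin.succ_last]
  simp only [pathExits, Fin.cons_succ]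
  rw [Fin.snoc_last]

/-- `h₀` and `γ` describe a path of `σ` that leaves the vertices of `α` and visits new vertices
only. -/
structure IsEscapePath (σ : H → H) (α : J → Turn v) (h₀ : H) {i : ℕ} (γ : Fin i → Turn v) :
    Prop where
  injective : Function.Injective (fun j => (Sum.elim α γ j).vert)
  start : ∃ j, v h₀ = (α j).vert
  not_uses : ¬ Uses α h₀
  follows : ∀ l : Fin i, σ (pathExits h₀ γ l.castSucc) = (γ l).enter

/-- An escape path whose last half-edge leads back to a visited vertex. -/
def HasLasso (σ : H → H) (α : J → Turn v) : Prop :=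
  ∃ (i : ℕ) (γ : Fin i → Turn v) (h₀ : H), IsEscapePath σ α h₀ γ ∧
    ∃ j, v (σ (pathExits h₀ γ (Fin.last i))) = (Sum.elim α γ j).vert

lemma Escapes.hasLasso_or {σ : H → H} {α : J → Turn v}
    (hα : Function.Injective (fun j => (α j).vert)) {h : H} (hr : Escapes σ α h) :
    HasLasso σ α ∨ ∃ (i : ℕ) (γ : Fin i → Turn v) (h₀ : H), IsEscapePath σ α h₀ γ ∧
      pathExits h₀ γ (Fin.last i) = h := by
  induction hr with
  | @exit h j hv hu =>
    refine Or.inr ⟨0, Fin.elim0, h, ⟨?_, ⟨j, hv⟩, hu, fun l => l.elim0⟩, rfl⟩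
    rintro (a | a) (b | b) hab
    · exact congrArg Sum.inl (hα hab)
    · exact b.elim0
    · exact a.elim0
    · exact a.elim0
  | @step h h' _ hv hne ih =>
    rcases ih with ih | ⟨i, γ, h₀, hp, hl⟩
    · exact Or.inl ih
    by_cases hret : ∃ j, v (σ h) = (Sum.elim α γ j).vert
    · exact Or.inl ⟨i, γ, h₀, hp, by rwa [hl]⟩
    push Not at hret
    let p : Turn v := ⟨(σ h, h'), hv.symm, hne.symm⟩
    have hp1 : p.vert = v (σ h) := rfl
    refine Or.inr ⟨i + 1, Fin.snoc γ p, h₀, ⟨?_, hp.start, hp.not_uses, ?_⟩,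
      pathExits_snoc_last h₀ γ p⟩
    · have h1 : ∀ l, (Sum.elim α γ l).vert ≠ p.vert := fun l hl => hret l (hp1.symm.trans hl.symm)
      have h2 := hp.injective
      rintro (a | a) (b | b) hab
      · exact congrArg Sum.inl (hα hab)
      · exfalso
        revert hab
        refine Fin.lastCases ?_ (fun b => ?_) b
        · simp only [Sum.elim_inl, Sum.elim_inr, Fin.snoc_last]
          exact h1 (Sum.inl a)
        · simp only [Sum.elim_inl, Sum.elim_inr, Fin.snoc_castSucc]
          intro hab
          exact absurd (@h2 (Sum.inl a) (Sum.inr b) hab) (by simp)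
      · exfalso
        revert hab
        refine Fin.lastCases ?_ (fun a => ?_) a
        · simp only [Sum.elim_inl, Sum.elim_inr, Fin.snoc_last]
          exact fun hab => h1 (Sum.inl b) hab.symm
        · simp only [Sum.elim_inl, Sum.elim_inr, Fin.snoc_castSucc]
          intro hab
          exact absurd (@h2 (Sum.inr a) (Sum.inl b) hab) (by simp)
      · revert hab
        refine Fin.lastCases ?_ (fun a => ?_) a
        · refine Fin.lastCases ?_ (fun b => ?_) b
          · intro _; rfl
          · simp only [Sum.elim_inr, Fin.snoc_castSucc, Fin.snoc_last]
            exact fun hab => absurd hab.symm (h1 (Sum.inr b))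
        · refine Fin.lastCases ?_ (fun b => ?_) b
          · simp only [Sum.elim_inr, Fin.snoc_castSucc, Fin.snoc_last]
            exact fun hab => absurd hab (h1 (Sum.inr a))
          · simp only [Sum.elim_inr, Fin.snoc_castSucc]
            intro hab
            have := @h2 (Sum.inr a) (Sum.inr b) hab
            simpa using this
    · intro l
      rw [pathExits_snoc_castSucc]
      refine Fin.lastCases ?_ (fun l => ?_) l
      · rw [hl, Fin.snoc_last]; rfl
      · rw [hp.follows, Fin.snoc_castSucc]

lemma hasLasso_of_not_isolated {σ : H → H} {α : J → Turn v}
    (hα : Function.Injective (fun j => (α j).vert)) (h : ¬ Isolated σ α) : HasLasso σ α := by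
  unfold Isolated at h
  push Not at h
  obtain ⟨g, hg, j, hj⟩ := h
  rcases hg.hasLasso_or hα with h | ⟨i, γ, h₀, hp, hl⟩
  · exact h
  · exact ⟨i, γ, h₀, hp, Sum.inl j, by rw [hl, hj]; rfl⟩

/-- The half-edges of a transversal family of turns are distinct, and distinct from any unused
half-edge. -/
lemma injective_halves {K : Type*} {δ : K → Turn v}
    (hδ : Function.Injective (fun j => (δ j).vert)) {h₀ : H} (h : ¬ Uses δ h₀) :
    Function.Injective (fun o : Option (K ⊕ K) =>
      o.elim h₀ (Sum.elim (fun k => (δ k).leave) (fun k => (δ k).enter))) := by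
  have e1 : ∀ k l, (δ k).leave = (δ l).leave → k = l := fun k l hkl => hδ (Turn.vert_eq_of_leave_eq hkl)
  have e2 : ∀ k l, (δ k).enter = (δ l).enter → k = l := fun k l hkl => hδ (Turn.vert_eq_of_enter_eq hkl)
  have e3 : ∀ k l, (δ k).enter ≠ (δ l).leave := fun k l hkl => by
    have : k = l := hδ (Turn.vert_eq_of_enter_eq_leave hkl)
    subst this
    exact (δ k).enter_ne_leave hkl
  rintro (_ | a | a) (_ | b | b) hab
  · rfl
  · exact absurd ⟨b, Or.inr hab⟩ h
  · exact absurd ⟨b, Or.inl hab⟩ h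
  · exact absurd ⟨a, Or.inr hab.symm⟩ h
  · rw [e1 a b hab]
  · exact absurd hab.symm (e3 b a)
  · exact absurd ⟨a, Or.inl hab.symm⟩ h
  · exact absurd hab (e3 a b)
  · rw [e2 a b hab]

variable [Fintype H] [Fintype J]

lemma pairProb_follows {next : J → J} (hnext : Function.Injective next)
    (hne : (pairings H).Nonempty) {α : J → Turn v} (hα : α ∈ transversals v J) :
    pairProb (Follows next α) = pairWeight (Fintype.card H) (Fintype.card J) := by
  rw [mem_transversals] at hα
  apply pairProb_prescribed hne
  have e1 : ∀ k l, (α k).leave = (α l).leave → k = l := fun k l hkl => hα (Turn.vert_eq_of_leave_eq hkl)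
  have e2 : ∀ k l, (α k).enter = (α l).enter → k = l := fun k l hkl => hα (Turn.vert_eq_of_enter_eq hkl)
  have e3 : ∀ k l, (α k).enter ≠ (α l).leave := fun k l hkl => by
    have : k = l := hα (Turn.vert_eq_of_enter_eq_leave hkl)
    subst this
    exact (α k).enter_ne_leave hkl
  rintro (a | a) (b | b) hab
  · rw [e1 a b hab]
  · exact absurd hab.symm (e3 _ _)
  · exact absurd hab (e3 _ _)
  · rw [hnext (e2 _ _ hab)]

lemma pairProb_lasso_le {next : J → J} (hnext : Function.Injective next)
    (hne : (pairings H).Nonempty) {α : J → Turn v} {i : ℕ} {γ : Fin i → Turn v}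
    (hγ : Sum.elim α γ ∈ transversals v (J ⊕ Fin i)) {h₀ : H}
    (hs : ∃ j, v h₀ = (α j).vert) (hu : ¬ Uses α h₀) (t : H) :
    pairProb (fun σ => Follows next α σ ∧
        (∀ l : Fin i, σ (pathExits h₀ γ l.castSucc) = (γ l).enter) ∧
        σ (pathExits h₀ γ (Fin.last i)) = t)
      ≤ pairWeight (Fintype.card H) (Fintype.card J + i + 1) := by
  rw [mem_transversals] at hγ
  have hu' : ¬ Uses (Sum.elim α γ) h₀ := by
    obtain ⟨j, hj⟩ := hs
    rintro ⟨k | k, hk⟩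
    · exact hu ⟨k, hk⟩
    · have : v h₀ = (γ k).vert := by
        rcases hk with rfl | rfl
        · exact Turn.vert_enter _
        · exact Turn.vert_leave _
      exact absurd (@hγ (Sum.inl j) (Sum.inr k) (hj.symm.trans this)) (by simp)
  have hF := injective_halves hγ hu'
  set F : Option ((J ⊕ Fin i) ⊕ (J ⊕ Fin i)) → H := fun o =>
      o.elim h₀ (Sum.elim (fun k => (Sum.elim α γ k).leave) (fun k => (Sum.elim α γ k).enter)) with hFdef
  let E : Fin (i + 1) → Option ((J ⊕ Fin i) ⊕ (J ⊕ Fin i)) :=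
    Fin.cons none (fun l => some (Sum.inl (Sum.inr l)))
  have hE : Function.Injective E := by
    rw [Fin.cons_injective_iff]
    refine ⟨by simp, fun a b hab => by simpa using hab⟩
  have hEF : ∀ l, pathExits h₀ γ l = F (E l) := by
    intro l
    refine Fin.cases ?_ (fun l => ?_) l <;> simp [pathExits, E, F]
  have hE1 : ∀ l k, E l ≠ some (Sum.inr k) := by
    intro l k
    refine Fin.cases ?_ (fun l => ?_) l <;> simp [E]
  have hE2 : ∀ l k, E l ≠ some (Sum.inl (Sum.inl k)) := by
    intro l k
    refine Fin.cases ?_ (fun l => ?_) l <;> simp [E]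
  let x : J ⊕ Fin i → Option ((J ⊕ Fin i) ⊕ (J ⊕ Fin i)) :=
    Sum.elim (fun j => some (Sum.inl (Sum.inl j))) (fun l => E l.castSucc)
  let y : J ⊕ Fin i → Option ((J ⊕ Fin i) ⊕ (J ⊕ Fin i)) :=
    Sum.elim (fun j => some (Sum.inr (Sum.inl (next j)))) (fun l => some (Sum.inr (Sum.inr l)))
  have hxy : Function.Injective (Sum.elim x y) := by
    rintro ((a | a) | (a | a)) ((b | b) | (b | b)) hab <;>
      simp only [Sum.elim_inl, Sum.elim_inr, x, y, Option.some.injEq, Sum.inl.injEq,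
        Sum.inr.injEq, reduceCtorEq] at hab
    · rw [hab]
    · exact absurd hab.symm (hE2 _ _)
    · exact absurd hab (hE2 _ _)
    · rw [Fin.castSucc_injective _ (hE hab)]
    · exact absurd hab (hE1 _ _)
    · exact absurd hab (hE1 _ _)
    · exact absurd hab.symm (hE1 _ _)
    · rw [hnext hab]
    · exact absurd hab.symm (hE1 _ _)
    · rw [hab]
  have hinj : Function.Injective (Sum.elim (F ∘ x) (F ∘ y)) := by
    rw [← Sum.comp_elim]
    exact hF.comp hxy
  have ha : ∀ j, F (E (Fin.last i)) ≠ (F ∘ x) j ∧ F (E (Fin.last i)) ≠ (F ∘ y) j := by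
    intro j
    refine ⟨fun h => ?_, fun h => ?_⟩
    · have h := hF h
      rcases j with j | l
      · exact hE2 _ _ h
      · exact absurd (hE h).symm (Fin.castSucc_lt_last l).ne
    · have h := hF h
      rcases j with j | l
      · exact hE1 _ _ h
      · exact hE1 _ _ h
  have := pairProb_prescribed_and_le hne hinj ha t
  rw [Fintype.card_sum, Fintype.card_fin] at this
  refine le_trans (pairProb_mono ?_) this
  rintro σ _ ⟨h1, h2, h3⟩
  rw [hEF] at h3
  refine ⟨?_, h3⟩
  rintro (j | l)
  · exact h1 j
  · have := h2 l
    rw [hEF] at this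
    exact this

lemma card_halves_at_le {K : Type*} [Fintype K] {Δ : ℕ}
    (hΔ : ∀ u, (Finset.univ.filter (fun h => v h = u)).card ≤ Δ) (δ : K → Turn v) :
    (Finset.univ.filter (fun h => ∃ j, v h = (δ j).vert)).card ≤ Fintype.card K * Δ := by
  have : Finset.univ.filter (fun h => ∃ j, v h = (δ j).vert)
      = Finset.univ.biUnion (fun j : K => Finset.univ.filter (fun h => v h = (δ j).vert)) := by
    ext h; simp
  rw [this]
  exact Finset.card_biUnion_le_card_mul _ _ _ (fun j _ => hΔ _)

lemma pairProb_not_isolated_le {next : J → J} (hnext : Function.Injective next) {c : ℝ}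
    (hsub : Subcritical v c) {Δ : ℕ}
    (hΔ : ∀ u, (Finset.univ.filter (fun h => v h = u)).card ≤ Δ)
    {α : J → Turn v} (hα : α ∈ transversals v J) :
    pairProb (fun σ => Follows next α σ ∧ ¬ Isolated σ α)
      ≤ ∑ i ∈ Finset.range (Fintype.card H + 1),
        ((Finset.univ.filter (fun γ : Fin i → Turn v =>
          Sum.elim α γ ∈ transversals v (J ⊕ Fin i))).card : ℝ)
        * ((Fintype.card J * Δ) * ((Fintype.card J + i) * Δ)
          * pairWeight (Fintype.card H) (Fintype.card J + i + 1)) := by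
  have hne := pairings_nonempty hsub.even
  have hα' := mem_transversals.1 hα
  let S : Finset H := Finset.univ.filter (fun h => ∃ j, v h = (α j).vert)
  let R : ∀ i, (Fin i → Turn v) → Finset H := fun i γ =>
    Finset.univ.filter (fun h => ∃ j, v h = (Sum.elim α γ j).vert)
  let G : ∀ i, Finset (Fin i → Turn v) := fun i => 
    Finset.univ.filter (fun γ : Fin i → Turn v => Sum.elim α γ ∈ transversals v (J ⊕ Fin i))
  calc pairProb (fun σ => Follows next α σ ∧ ¬ Isolated σ α)
      ≤ pairProb (fun σ => ∃ i ∈ Finset.range (Fintype.card H + 1), ∃ γ ∈ G i,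
          ∃ h₀ ∈ S.filter (fun h => ¬ Uses α h), ∃ t ∈ R i γ,
          (Follows next α σ ∧
        (∀ l : Fin i, σ (pathExits h₀ γ l.castSucc) = (γ l).enter) ∧
        σ (pathExits h₀ γ (Fin.last i)) = t)) := by
        apply pairProb_mono
        rintro σ _ ⟨h1, h2⟩
        obtain ⟨i, γ, h₀, hp, j, hj⟩ := hasLasso_of_not_isolated hα' h2
        refine ⟨i, ?_, γ, ?_, h₀, ?_, _, ?_, h1, hp.follows, rfl⟩
        · rw [Finset.mem_range, Nat.lt_succ_iff, ← Fintype.card_fin i]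
          apply Fintype.card_le_of_injective (fun l => (γ l).enter)
          intro a b hab
          have h3 : (Sum.elim α γ (Sum.inr a)).vert = (Sum.elim α γ (Sum.inr b)).vert := by
            show (γ a).vert = (γ b).vert
            rw [← Turn.vert_enter, ← Turn.vert_enter]
            exact congrArg v hab
          have := hp.injective h3
          simpa using this
        · simp only [G, Finset.mem_filter, Finset.mem_univ, true_and, mem_transversals]
          exact hp.injective
        · simp only [S, Finset.mem_filter, Finset.mem_univ, true_and]
          exact ⟨hp.start, hp.not_uses⟩
        · simp only [R, Finset.mem_filter, Finset.mem_univ, true_and]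
          exact ⟨j, hj⟩
    _ ≤ ∑ i ∈ Finset.range (Fintype.card H + 1), ∑ γ ∈ G i,
          ∑ h₀ ∈ S.filter (fun h => ¬ Uses α h), ∑ t ∈ R i γ,
            pairWeight (Fintype.card H) (Fintype.card J + i + 1) := by
        refine (pairProb_exists_le _ _).trans (Finset.sum_le_sum fun i _ => ?_)
        refine (pairProb_exists_le _ _).trans (Finset.sum_le_sum fun γ hγ => ?_)
        refine (pairProb_exists_le _ _).trans (Finset.sum_le_sum fun h₀ hh₀ => ?_)
        refine (pairProb_exists_le _ _).trans (Finset.sum_le_sum fun t _ => ?_)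
        simp only [S, Finset.mem_filter, Finset.mem_univ, true_and] at hh₀
        simp only [G, Finset.mem_filter, Finset.mem_univ, true_and] at hγ
        exact pairProb_lasso_le hnext hne hγ hh₀.1 hh₀.2 t
    _ ≤ _ := by
        refine Finset.sum_le_sum fun i _ => ?_
        rw [← nsmul_eq_mul]
        apply Finset.sum_le_card_nsmul
        intro γ hγ
        simp only [G, Finset.mem_filter, Finset.mem_univ, true_and] at hγ
        have hN : numTrans v (Fintype.card J + i) ≠ 0 := by
          have h1 := card_transversals (v := v) (J := J ⊕ Fin i)
          rw [Fintype.card_sum, Fintype.card_fin] at h1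
          rw [numTrans, ← h1]
          exact (Finset.card_pos.2 ⟨_, hγ⟩).ne'
        have hw := hsub.pairWeight_nonneg hN le_rfl
        rw [Finset.sum_const, Finset.sum_const, nsmul_eq_mul, nsmul_eq_mul, ← mul_assoc]
        apply mul_le_mul_of_nonneg_right _ hw
        have hS : ((S.filter (fun h => ¬ Uses α h)).card : ℝ) ≤ Fintype.card J * Δ := by
          exact_mod_cast (Finset.card_filter_le _ _).trans (card_halves_at_le hΔ α)
        have hR : ((R i γ).card : ℝ) ≤ (Fintype.card J + i) * Δ := by
          have := card_halves_at_le hΔ (Sum.elim α γ)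
          rw [Fintype.card_sum, Fintype.card_fin] at this
          exact_mod_cast this
        gcongr

lemma sum_card_extensions (i : ℕ) :
    ∑ α ∈ transversals v J, (Finset.univ.filter (fun γ : Fin i → Turn v =>
          Sum.elim α γ ∈ transversals v (J ⊕ Fin i))).card
      = numTrans v (Fintype.card J + i) := by
  have h1 := card_transversals (v := v) (J := J ⊕ Fin i)
  rw [Fintype.card_sum, Fintype.card_fin] at h1
  rw [numTrans, ← h1, ← Finset.card_sigma]
  apply Finset.card_bij (fun x _ => Sum.elim x.1 x.2)
  · rintro ⟨α, γ⟩ h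
    simp only [Finset.mem_sigma, Finset.mem_filter, Finset.mem_univ, true_and] at h
    exact h.2
  · rintro ⟨α, γ⟩ _ ⟨β, δ⟩ _ h
    have h2 : α = β := funext fun j => congrFun h (Sum.inl j)
    have h3 : γ = δ := funext fun j => congrFun h (Sum.inr j)
    subst h2 h3
    rfl
  · intro δ hδ
    refine ⟨⟨fun j => δ (Sum.inl j), fun j => δ (Sum.inr j)⟩, ?_, ?_⟩
    · simp only [Finset.mem_sigma, Finset.mem_filter, Finset.mem_univ, true_and]
      have h2 : Sum.elim (fun j => δ (Sum.inl j)) (fun j => δ (Sum.inr j)) = δ := by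
        funext j; rcases j with j | j <;> rfl
      rw [h2]
      refine ⟨?_, hδ⟩
      rw [mem_transversals] at hδ ⊢
      intro a b hab
      have := @hδ (Sum.inl a) (Sum.inl b) hab
      simpa using this
    · funext j; rcases j with j | j <;> rfl

/-- First moment bound for cycles in components with more than one cycle. -/
lemma sum_pairProb_not_isolated_le {next : J → J} (hnext : Function.Injective next) {c : ℝ}
    (hsub : Subcritical v c) {Δ : ℕ}
    (hΔ : ∀ u, (Finset.univ.filter (fun h => v h = u)).card ≤ Δ) :
    ∑ α ∈ transversals v J, pairProb (fun σ => Follows next α σ ∧ ¬ Isolated σ α)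
      ≤ (Δ ^ 2 * (2 / ((1 - c) * ((Fintype.card H : ℝ) - 1)))) *
        ∑ i ∈ Finset.range (Fintype.card H + 1),
          (Fintype.card J * (Fintype.card J + i) : ℝ) * c ^ (Fintype.card J + i) := by
  calc _ ≤ ∑ α ∈ transversals v J, ∑ i ∈ Finset.range (Fintype.card H + 1),
        ((Finset.univ.filter (fun γ : Fin i → Turn v =>
          Sum.elim α γ ∈ transversals v (J ⊕ Fin i))).card : ℝ)
        * ((Fintype.card J * Δ) * ((Fintype.card J + i) * Δ)
          * pairWeight (Fintype.card H) (Fintype.card J + i + 1)) :=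
        Finset.sum_le_sum fun α hα => pairProb_not_isolated_le hnext hsub hΔ hα
    _ ≤ _ := by
        rw [Finset.sum_comm, Finset.mul_sum]
        refine Finset.sum_le_sum fun i _ => ?_
        rw [← Finset.sum_mul, ← Nat.cast_sum, sum_card_extensions]
        have := mul_le_mul_of_nonneg_left (hsub.numTrans_mul_pairWeight_succ_le (Fintype.card J + i))
          (show (0 : ℝ) ≤ (Fintype.card J * Δ) * ((Fintype.card J + i) * Δ) by positivity)
        calc _ = (Fintype.card J * Δ) * ((Fintype.card J + i) * Δ) *
              ((numTrans v (Fintype.card J + i) : ℝ)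
                * pairWeight (Fintype.card H) (Fintype.card J + i + 1)) := by ring
          _ ≤ _ := this
          _ = _ := by ring

end Follows

section Cycles

variable {H ι : Type*} {v : H → ι}

lemma Fin.forall_of_add_one {l : ℕ} {P : Fin (l + 1) → Prop} (j₀ : Fin (l + 1)) (h₀ : P j₀)
    (h : ∀ j, P j → P (j + 1)) (j : Fin (l + 1)) : P j := by
  have key : ∀ i : Fin (l + 1), P (j₀ + i) := by
    intro i
    induction i using Fin.induction with
    | zero => simpa using h₀
    | succ i ih =>
      have := h _ ih
      rwa [add_assoc, Fin.coeSucc_eq_succ] at this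
  have := key (j - j₀)
  rwa [add_sub_cancel] at this

/-- `α` is a cycle of the matching `σ`, with base point and orientation. -/
structure IsCycleOf (σ : H → H) {l : ℕ} (α : Fin (l + 1) → Turn v) : Prop where
  injective : Function.Injective (fun j => (α j).vert)
  follows : Follows (· + 1) α σ

/-- The vertices of a family of turns. -/
def turnSupport {J : Type*} [Fintype J] (α : J → Turn v) : Finset ι :=
  Finset.univ.image (fun j => (α j).vert)

lemma mem_turnSupport {J : Type*} [Fintype J] {α : J → Turn v} {u : ι} :
    u ∈ turnSupport α ↔ ∃ j, (α j).vert = u := by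
  simp [turnSupport]

lemma Uses.mem_turnSupport {J : Type*} [Fintype J] {α : J → Turn v} {h : H} (hu : Uses α h) :
    v h ∈ turnSupport α := by
  rw [_root_.mem_turnSupport]
  obtain ⟨j, rfl | rfl⟩ := hu
  · exact ⟨j, (Turn.vert_enter _).symm⟩
  · exact ⟨j, (Turn.vert_leave _).symm⟩

variable {σ : H → H} {l l' : ℕ} {α : Fin (l + 1) → Turn v} {β : Fin (l' + 1) → Turn v}

lemma IsCycleOf.enter_eq (hα : IsCycleOf σ α) (j : Fin (l + 1)) :
    (α j).enter = σ (α (j - 1)).leave := by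
  rw [hα.follows (j - 1)]
  simp

lemma IsCycleOf.uses_partner (hσ : ∀ h, σ (σ h) = h) (hα : IsCycleOf σ α) {h : H}
    (hu : Uses α h) : Uses α (σ h) := by
  obtain ⟨j, rfl | rfl⟩ := hu
  · exact ⟨j - 1, Or.inr (by rw [hα.enter_eq, hσ])⟩
  · exact ⟨j + 1, Or.inl (hα.follows j)⟩

lemma IsCycleOf.card_support (hα : IsCycleOf σ α) : (turnSupport α).card = l + 1 := by
  rw [turnSupport, Finset.card_image_of_injective _ hα.injective, Finset.card_univ,
    Fintype.card_fin]

/-- A cycle that meets an isolated cycle stays on its vertices. -/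
lemma IsCycleOf.support_subset (hσ : ∀ h, σ (σ h) = h) (hα : IsCycleOf σ α)
    (hiso : Isolated σ α) (hβ : IsCycleOf σ β) {j₀ : Fin (l' + 1)}
    (h₀ : (β j₀).vert ∈ turnSupport α) : turnSupport β ⊆ turnSupport α := by
  have key : ∀ j, (β j).vert ∈ turnSupport α := by
    apply Fin.forall_of_add_one (P := fun j => (β j).vert ∈ turnSupport α) j₀ h₀
    intro j hj
    by_contra hcon
    have hj' := mem_turnSupport.1 hj
    obtain ⟨i, hi⟩ := hj'
    have hesc : Escapes σ α (β j).leave := by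
      refine Escapes.exit i (by rw [Turn.vert_leave (v := v), hi]) (fun hu => hcon ?_)
      have := (hα.uses_partner hσ hu).mem_turnSupport
      rwa [hβ.follows j, Turn.vert_enter (v := v)] at this
    have hall : ∀ k, Escapes σ α (β k).leave := by
      apply Fin.forall_of_add_one (P := fun k => Escapes σ α (β k).leave) j hesc
      intro k hk
      refine Escapes.step hk ?_ ?_
      · rw [hβ.follows k, Turn.vert_leave (v := v), Turn.vert_enter (v := v)]
      · rw [hβ.follows k]; exact (Turn.enter_ne_leave _).symm
    apply hiso _ (hall (j - 1)) i
    rw [← hβ.enter_eq, Turn.vert_enter (v := v), hi]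
  intro u hu
  obtain ⟨j, rfl⟩ := mem_turnSupport.1 hu
  exact key j

lemma IsCycleOf.support_eq (hσ : ∀ h, σ (σ h) = h) (hα : IsCycleOf σ α)
    (hiso : Isolated σ α) (hβ : IsCycleOf σ β) (hiso' : Isolated σ β)
    (h : ¬ Disjoint (turnSupport α) (turnSupport β)) : turnSupport α = turnSupport β := by
  rw [Finset.not_disjoint_iff] at h
  obtain ⟨u, h1, h2⟩ := h
  obtain ⟨i, hi⟩ := mem_turnSupport.1 h1
  obtain ⟨j, hj⟩ := mem_turnSupport.1 h2
  exact Finset.Subset.antisymm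
    (hβ.support_subset hσ hiso' hα (j₀ := i) (by rwa [hi]))
    (hα.support_subset hσ hiso hβ (j₀ := j) (by rwa [hj]))

lemma IsCycleOf.uses_of_uses (hσ : ∀ h, σ (σ h) = h) (hα : IsCycleOf σ α)
    (hiso : Isolated σ α) (hβ : IsCycleOf σ β) (h : turnSupport β ⊆ turnSupport α) {g : H}
    (hg : Uses β g) : Uses α g := by
  have key : ∀ j, Uses α (β j).leave := by
    intro j
    by_contra hcon
    obtain ⟨i, hi⟩ := mem_turnSupport.1 (h (mem_turnSupport.2 ⟨j, rfl⟩))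
    obtain ⟨k, hk⟩ := mem_turnSupport.1 (h (mem_turnSupport.2 ⟨j + 1, rfl⟩))
    refine hiso _ (Escapes.exit i ((Turn.vert_leave _).trans hi.symm) hcon) k ?_
    rw [hβ.follows j, Turn.vert_enter (v := v), hk]
  obtain ⟨j, rfl | rfl⟩ := hg
  · rw [hβ.enter_eq]
    exact hα.uses_partner hσ (key _)
  · exact key j

/-- A turn made of half-edges used by `α` is determined by one of its half-edges. -/
lemma turn_eq_of_uses {J : Type*} {α : J → Turn v}
    (hα : Function.Injective (fun j => (α j).vert))
    {p q : Turn v} (hp : Uses α p.enter ∧ Uses α p.leave) (hq : Uses α q.enter ∧ Uses α q.leave)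
    (h : p.enter = q.enter ∨ p.leave = q.leave) : p = q := by
  have huse : ∀ {g : H} {j : J}, Uses α g → v g = (α j).vert →
      g = (α j).enter ∨ g = (α j).leave := by
    rintro g j ⟨i, hi⟩ hv
    have : i = j := hα (by
      rcases hi with rfl | rfl
      · exact (Turn.vert_enter _).symm.trans hv
      · exact (Turn.vert_leave _).symm.trans hv)
    exact this ▸ hi
  have hv : q.vert = p.vert := by
    rcases h with h | h
    · exact (Turn.vert_eq_of_enter_eq h).symm
    · exact (Turn.vert_eq_of_leave_eq h).symm
  have hj : ∃ j, p.vert = (α j).vert := by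
    obtain ⟨j, hj | hj⟩ := hp.1
    · exact ⟨j, by rw [← Turn.vert_enter p, hj, Turn.vert_enter (v := v)]⟩
    · exact ⟨j, by rw [← Turn.vert_enter p, hj, Turn.vert_leave (v := v)]⟩
  obtain ⟨j, hj⟩ := hj
  have h1 := huse hp.1 ((Turn.vert_enter p).trans hj)
  have h2 := huse hp.2 ((Turn.vert_leave p).trans hj)
  have h3 := huse hq.1 ((Turn.vert_enter q).trans (hv.trans hj))
  have h4 := huse hq.2 ((Turn.vert_leave q).trans (hv.trans hj))
  have h5 := p.enter_ne_leave
  have h6 := q.enter_ne_leave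
  apply Turn.ext_halves
  · rcases h with h | h
    · exact h
    · grind
  · rcases h with h | h
    · grind
    · exact h

lemma IsCycleOf.eq_of_leave_eq {β' : Fin (l' + 1) → Turn v}
    {J : Type*} {α : J → Turn v} (hα : Function.Injective (fun j => (α j).vert))
    (hβ : IsCycleOf σ β) (hβ' : IsCycleOf σ β')
    (hu : ∀ g, Uses β g → Uses α g) (hu' : ∀ g, Uses β' g → Uses α g)
    (h : (β 0).leave = (β' 0).leave) : β = β' := by
  have hb : ∀ j, Uses α (β j).enter ∧ Uses α (β j).leave := fun j =>
    ⟨hu _ ⟨j, Or.inl rfl⟩, hu _ ⟨j, Or.inr rfl⟩⟩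
  have hb' : ∀ j, Uses α (β' j).enter ∧ Uses α (β' j).leave := fun j =>
    ⟨hu' _ ⟨j, Or.inl rfl⟩, hu' _ ⟨j, Or.inr rfl⟩⟩
  funext j
  apply Fin.forall_of_add_one (P := fun j => β j = β' j) 0
    (turn_eq_of_uses hα (hb 0) (hb' 0) (Or.inr h))
  intro j hj
  refine turn_eq_of_uses hα (hb _) (hb' _) (Or.inl ?_)
  rw [← hβ.follows j, ← hβ'.follows j, hj]

lemma Escapes.congr {J J' : Type*} [Fintype J] [Fintype J'] {α : J → Turn v} {β : J' → Turn v}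
    (hs : turnSupport α = turnSupport β) (hu : ∀ g, Uses α g ↔ Uses β g) {h : H}
    (he : Escapes σ α h) : Escapes σ β h := by
  induction he with
  | @exit h j hv h1 =>
    obtain ⟨i, hi⟩ := mem_turnSupport.1 (hs ▸ mem_turnSupport.2 ⟨j, rfl⟩)
    exact Escapes.exit i (by rw [hv, hi]) (by rwa [← hu])
  | step _ hv hne ih => exact Escapes.step ih hv hne

lemma Isolated.congr {J J' : Type*} [Fintype J] [Fintype J'] {α : J → Turn v} {β : J' → Turn v}
    (hs : turnSupport α = turnSupport β) (hu : ∀ g, Uses α g ↔ Uses β g)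
    (h : Isolated σ α) : Isolated σ β := by
  intro g hg j hj
  obtain ⟨i, hi⟩ := mem_turnSupport.1 (hs.symm ▸ mem_turnSupport.2 ⟨j, rfl⟩)
  exact h g (hg.congr hs.symm (fun g => (hu g).symm)) i (by rw [hj, hi])

/-- The rotations (`true`) and reflections (`false`) of a cyclic family of turns. -/
def dihedral (α : Fin (l + 1) → Turn v) (s : Fin (l + 1)) : Bool → Fin (l + 1) → Turn v
  | true => fun i => α (i + s)
  | false => fun i => (α (s - i)).rev

lemma IsCycleOf.dihedral (hσ : ∀ h, σ (σ h) = h) (hα : IsCycleOf σ α) (s : Fin (l + 1))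
    (b : Bool) : IsCycleOf σ (dihedral α s b) := by
  cases b with
  | true =>
    refine ⟨fun i j hij => ?_, fun j => ?_⟩
    · have := hα.injective hij
      simpa using this
    · have := hα.follows (j + s)
      simp only [_root_.dihedral]
      rw [this, add_right_comm]
  | false =>
    refine ⟨fun i j hij => ?_, fun j => ?_⟩
    · simp only [_root_.dihedral, Turn.vert_rev] at hij
      have := hα.injective hij
      simpa using this
    · simp only [_root_.dihedral, Turn.leave_rev, Turn.enter_rev]
      rw [hα.enter_eq, hσ, sub_sub]

lemma turnSupport_dihedral (s : Fin (l + 1)) (b : Bool) :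
    turnSupport (dihedral α s b) = turnSupport α := by
  ext u
  rw [mem_turnSupport, mem_turnSupport]
  cases b with
  | true =>
    constructor
    · rintro ⟨j, hj⟩; exact ⟨_, hj⟩
    · rintro ⟨j, hj⟩; exact ⟨j - s, by simpa [dihedral] using hj⟩
  | false =>
    constructor
    · rintro ⟨j, hj⟩; exact ⟨_, by rw [← hj, dihedral, Turn.vert_rev]⟩
    · rintro ⟨j, hj⟩; exact ⟨s - j, by simpa [dihedral] using hj⟩

lemma uses_dihedral (s : Fin (l + 1)) (b : Bool) (g : H) :
    Uses (dihedral α s b) g ↔ Uses α g := by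
  cases b with
  | true =>
    constructor
    · rintro ⟨j, hj⟩; exact ⟨_, hj⟩
    · rintro ⟨j, hj⟩; exact ⟨j - s, by simpa [dihedral] using hj⟩
  | false =>
    constructor
    · rintro ⟨j, hj⟩; exact ⟨_, hj.symm⟩
    · rintro ⟨j, hj⟩; exact ⟨s - j, by simpa [dihedral] using hj.symm⟩

/-- An isolated cycle of length `l + 1` has exactly `2 (l + 1)` parametrizations. -/
lemma card_parametrizations [Fintype H] (hσ : ∀ h, σ (σ h) = h) (hα : IsCycleOf σ α)
    (hiso : Isolated σ α) :
    (Finset.univ.filter (fun β : Fin (l + 1) → Turn v =>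
      (IsCycleOf σ β ∧ Isolated σ β) ∧ turnSupport β = turnSupport α)).card = 2 * (l + 1) := by
  have hcard : (Finset.univ : Finset (Fin (l + 1) × Bool)).card = 2 * (l + 1) := by
    rw [Finset.card_univ, Fintype.card_prod, Fintype.card_fin, Fintype.card_bool, mul_comm]
  rw [← hcard]
  symm
  apply Finset.card_bij (fun x _ => dihedral α x.1 x.2)
  · rintro ⟨s, b⟩ _
    simp only [Finset.mem_filter, Finset.mem_univ, true_and]
    exact ⟨⟨hα.dihedral hσ s b, hiso.congr (turnSupport_dihedral s b).symm
      (fun g => (uses_dihedral s b g).symm)⟩, turnSupport_dihedral s b⟩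
  · rintro ⟨s, b⟩ _ ⟨t, b'⟩ _ h
    have h0 : (dihedral α s b 0).leave = (dihedral α t b' 0).leave := by
      rw [show dihedral α s b = dihedral α t b' from h]
    cases b <;> cases b' <;> simp only [dihedral, zero_add, sub_zero, Turn.leave_rev] at h0
    · rw [hα.injective (Turn.vert_eq_of_enter_eq h0)]
    · have := hα.injective (Turn.vert_eq_of_enter_eq_leave h0)
      subst this
      exact absurd h0 (Turn.enter_ne_leave _)
    · have := hα.injective (Turn.vert_eq_of_enter_eq_leave h0.symm)
      subst this
      exact absurd h0.symm (Turn.enter_ne_leave _)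
    · rw [hα.injective (Turn.vert_eq_of_leave_eq h0)]
  · intro β hβ
    simp only [Finset.mem_filter, Finset.mem_univ, true_and] at hβ
    obtain ⟨⟨hβ1, hβ2⟩, hs⟩ := hβ
    have hu : ∀ g, Uses β g → Uses α g := fun g hg =>
      hα.uses_of_uses hσ hiso hβ1 hs.subset hg
    have hd : ∀ s b, ∀ g, Uses (dihedral α s b) g → Uses α g := fun s b g hg =>
      (uses_dihedral s b g).1 hg
    obtain ⟨s, hs | hs⟩ := hu _ ⟨0, Or.inr rfl⟩
    · refine ⟨(s, false), Finset.mem_univ _, ?_⟩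
      refine IsCycleOf.eq_of_leave_eq hα.injective (hα.dihedral hσ s false) hβ1 (hd _ _) hu ?_
      simp [dihedral, hs]
    · refine ⟨(s, true), Finset.mem_univ _, ?_⟩
      refine IsCycleOf.eq_of_leave_eq hα.injective (hα.dihedral hσ s true) hβ1 (hd _ _) hu ?_
      simp [dihedral, hs]

end Cycles

section Counting

/-- If a weight sums to one on every fibre of `s`, then weighted tuples in distinct fibres are
counted by a descending factorial. -/
lemma sum_tuples_eq_descFactorial {X Y : Type*} [Fintype X] (A : Finset X) (s : X → Y)
    (w : X → ℝ) (hw : ∀ a ∈ A, ∑ x ∈ A.filter (fun x => s x = s a), w x = 1) (r : ℕ) :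
    ∑ τ : Fin r → X, (if (∀ i, τ i ∈ A) ∧ Function.Injective (fun i => s (τ i))
      then ∏ i, w (τ i) else 0) = ((A.image s).card.descFactorial r : ℝ) := by
  set B := A.image s with hB
  have hcard : (Fintype.card (Fin r ↪ B)) = B.card.descFactorial r := by
    rw [Fintype.card_embedding_eq, Fintype.card_coe, Fintype.card_fin]
  rw [← hcard, ← Finset.card_univ, Finset.cast_card]
  rw [← Finset.sum_filter]
  have hmaps : ∀ τ ∈ Finset.univ.filter (fun τ : Fin r → X => (∀ i, τ i ∈ A) ∧
      Function.Injective (fun i => s (τ i))),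
      (fun i => s (τ i)) ∈ (Finset.univ : Finset (Fin r ↪ B)).image
        (fun y => fun i => ((y i : B) : Y)) := by
    intro τ hτ
    rw [Finset.mem_filter] at hτ
    rw [Finset.mem_image]
    refine ⟨⟨fun i => ⟨s (τ i), Finset.mem_image_of_mem s (hτ.2.1 i)⟩, fun i j h => ?_⟩,
      Finset.mem_univ _, rfl⟩
    exact hτ.2.2 (congrArg Subtype.val h)
  rw [← Finset.sum_fiberwise_of_maps_to hmaps, Finset.sum_image]
  · apply Finset.sum_congr rfl
    intro y _
    have hset : (Finset.univ.filter (fun τ : Fin r → X => (∀ i, τ i ∈ A) ∧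
      Function.Injective (fun i => s (τ i)))).filter
        (fun τ => (fun i => s (τ i)) = fun i => ((y i : B) : Y))
        = Fintype.piFinset (fun i => A.filter (fun x => s x = y i)) := by
      ext τ
      simp only [Finset.mem_filter, Finset.mem_univ, true_and, Fintype.mem_piFinset]
      constructor
      · rintro ⟨⟨h1, _⟩, h3⟩ i
        exact ⟨h1 i, congrFun h3 i⟩
      · intro h
        have h3 : (fun i => s (τ i)) = fun i => ((y i : B) : Y) := funext fun i => (h i).2
        refine ⟨⟨fun i => (h i).1, ?_⟩, h3⟩
        rw [h3]
        exact Subtype.val_injective.comp y.injective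
    rw [hset, ← Finset.prod_univ_sum]
    apply Finset.prod_eq_one
    intro i _
    obtain ⟨a, ha, hay⟩ := Finset.mem_image.1 (y i).2
    rw [← hay]
    exact hw a ha
  · intro y _ y' _ h
    ext i
    exact congrFun h i

end Counting

section IsolatedCycles

variable {H ι : Type*} [Fintype H] (v : H → ι) (L : Finset ℕ)

/-- Parametrized candidates for cycles whose length minus one lies in `L`. -/
abbrev CycleParam : Type _ := Σ l : L, (Fin (l.1 + 1) → Turn v)

variable {v L}

/-- The isolated cycles of `σ`, with base point and orientation. -/
def isolatedCycles (v : H → ι) (L : Finset ℕ) (σ : H → H) : Finset (CycleParam v L) :=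
  Finset.univ.filter (fun x => IsCycleOf σ x.2 ∧ Isolated σ x.2)

/-- The number of isolated cycles of `σ` whose length minus one lies in `L`. -/
def numIsolated (v : H → ι) (L : Finset ℕ) (σ : H → H) : ℕ :=
  ((isolatedCycles v L σ).image (fun x => turnSupport x.2)).card

lemma mem_isolatedCycles {σ : H → H} {x : CycleParam v L} :
    x ∈ isolatedCycles v L σ ↔ IsCycleOf σ x.2 ∧ Isolated σ x.2 := by
  simp [isolatedCycles]

lemma sum_weight_fibre {σ : H → H} (hσ : ∀ h, σ (σ h) = h) {a : CycleParam v L}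
    (ha : a ∈ isolatedCycles v L σ) :
    ∑ x ∈ (isolatedCycles v L σ).filter (fun x => turnSupport x.2 = turnSupport a.2),
      (1 / (2 * ((x.1.1 : ℝ) + 1))) = 1 := by
  rw [mem_isolatedCycles] at ha
  obtain ⟨l, α⟩ := a
  have hset : (isolatedCycles v L σ).filter (fun x => turnSupport x.2 = turnSupport α)
      = (Finset.univ.filter (fun β : Fin (l.1 + 1) → Turn v =>
      (IsCycleOf σ β ∧ Isolated σ β) ∧ turnSupport β = turnSupport α)).map
        ⟨Sigma.mk l, sigma_mk_injective⟩ := by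
    ext ⟨l', β⟩
    simp only [Finset.mem_filter, mem_isolatedCycles, Finset.mem_map, Finset.mem_univ, true_and,
      Function.Embedding.coeFn_mk]
    constructor
    · rintro ⟨h1, h2⟩
      have h3 : l' = l := by
        have h4 := h1.1.card_support
        rw [h2, ha.1.card_support] at h4
        exact Subtype.ext (Nat.succ_injective h4.symm)
      subst h3
      exact ⟨β, ⟨h1, h2⟩, rfl⟩
    · rintro ⟨γ, h1, h2⟩
      have h3 : l = l' := congrArg Sigma.fst h2
      subst h3
      have h4 : γ = β := by simpa using h2
      subst h4
      exact h1
  rw [hset, Finset.sum_map]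
  simp only [Function.Embedding.coeFn_mk, Finset.sum_const, nsmul_eq_mul]
  rw [card_parametrizations hσ ha.1 ha.2]
  push_cast
  field_simp

lemma sum_isolated_tuples {σ : H → H} (hσ : ∀ h, σ (σ h) = h) (r : ℕ) :
    ∑ τ : Fin r → CycleParam v L, (if (∀ i, IsCycleOf σ (τ i).2 ∧ Isolated σ (τ i).2) ∧
        Function.Injective (fun i => turnSupport (τ i).2)
      then ∏ i, (1 / (2 * (((τ i).1.1 : ℝ) + 1))) else 0)
      = ((numIsolated v L σ).descFactorial r : ℝ) := by
  have := sum_tuples_eq_descFactorial (isolatedCycles v L σ) (fun x => turnSupport x.2)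
    (fun x : CycleParam v L => 1 / (2 * ((x.1.1 : ℝ) + 1)))
    (fun a ha => by convert sum_weight_fibre hσ ha) r
  simp only [mem_isolatedCycles] at this
  rw [numIsolated]
  convert this

lemma numIsolated_eq_zero {σ : H → H} :
    numIsolated v L σ = 0 ↔ ∀ l ∈ L, ∀ α : Fin (l + 1) → Turn v, IsCycleOf σ α →
      ¬ Isolated σ α := by
  rw [numIsolated, Finset.card_eq_zero, Finset.image_eq_empty, Finset.eq_empty_iff_forall_notMem]
  constructor
  · intro h l hl α h1 h2
    exact h ⟨⟨l, hl⟩, α⟩ (mem_isolatedCycles.2 ⟨h1, h2⟩)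
  · rintro h ⟨⟨l, hl⟩, α⟩ h1
    rw [mem_isolatedCycles] at h1
    exact h l hl α h1.1 h1.2

end IsolatedCycles

section Analysis

lemma tendsto_of_approx {A : Type*} {l : Filter A} {p : A → ℝ} {x : ℝ} {f : ℕ → A → ℝ}
    {y e : ℕ → ℝ} (hf : ∀ K, Tendsto (f K) l (𝓝 (y K))) (hy : Tendsto y atTop (𝓝 x))
    (he : Tendsto e atTop (𝓝 0)) (h : ∀ K, ∀ᶠ a in l, |p a - f K a| ≤ e K) :
    Tendsto p l (𝓝 x) := by
  rw [Metric.tendsto_nhds]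
  intro ε hε
  have h1 := (Metric.tendsto_nhds.1 hy (ε / 3) (by positivity))
  have h2 := (he.eventually_lt_const (show (0 : ℝ) < ε / 3 by positivity))
  obtain ⟨K, hK1, hK2⟩ := (h1.and h2).exists
  filter_upwards [h K, Metric.tendsto_nhds.1 (hf K) (ε / 3) (by positivity)] with a h3 h4
  rw [Real.dist_eq, abs_lt] at *
  rw [abs_le] at h3
  constructor <;> linarith [h3.1, h3.2, h4.1, h4.2, hK1.1, hK1.2]

lemma abs_indicator_sub_alternating_le (Z q : ℕ) :
    |(if Z = 0 then (1 : ℝ) else 0) - ∑ j ∈ Finset.range q, (-1) ^ j * (Z.choose j : ℝ)|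
      ≤ (Z.choose q : ℝ) := by
  rcases q with _ | q
  · split_ifs <;> simp
  rcases Z with _ | n
  · rw [Finset.sum_range_succ']
    simp
  · have h := Int.alternating_sum_range_choose_eq_choose (n := n) (m := q)
    have h' : ∑ j ∈ Finset.range (q + 1), (-1 : ℝ) ^ j * ((n + 1).choose j : ℝ)
        = (-1) ^ q * (n.choose q : ℝ) := by
      exact_mod_cast h
    rw [h']
    simp only [Nat.succ_ne_zero, if_false, zero_sub, abs_neg, abs_mul, abs_pow, abs_one, one_pow,
      one_mul, Nat.abs_cast]
    rw [Nat.choose_succ_succ]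
    exact_mod_cast Nat.le_add_right _ _

lemma exists_geometric_bound {c : ℝ} (h0 : 0 ≤ c) (h1 : c < 1) :
    ∃ B q : ℝ, 0 ≤ B ∧ 0 ≤ q ∧ q < 1 ∧ ∀ s N : ℕ,
      ∑ i ∈ Finset.range N, (s * (s + i) : ℝ) * c ^ (s + i) ≤ B * q ^ s := by
  set q := (1 + c) / 2 with hq
  have hq0 : 0 < q := by positivity
  have hq1 : q < 1 := by rw [hq]; linarith
  have hcq : c / q < 1 := by rw [div_lt_one hq0, hq]; linarith
  have hcq0 : 0 ≤ c / q := by positivity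
  have hlim := tendsto_pow_const_mul_const_pow_of_abs_lt_one 2
    (show |c / q| < 1 by rwa [abs_of_nonneg hcq0])
  obtain ⟨B, hB⟩ := hlim.bddAbove_range
  have hB' : ∀ n : ℕ, (n : ℝ) ^ 2 * c ^ n ≤ max B 0 * q ^ n := by
    intro n
    have h2 : (n : ℝ) ^ 2 * (c / q) ^ n ≤ max B 0 := (hB ⟨n, rfl⟩).trans (le_max_left _ _)
    rw [div_pow, ← mul_div_assoc, div_le_iff₀ (by positivity)] at h2
    exact h2
  refine ⟨max B 0 * (1 - q)⁻¹, q, ?_, hq0.le, hq1, fun s N => ?_⟩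
  · have : 0 ≤ (1 - q)⁻¹ := inv_nonneg.2 (by linarith)
    positivity
  calc ∑ i ∈ Finset.range N, (s * (s + i) : ℝ) * c ^ (s + i)
      ≤ ∑ i ∈ Finset.range N, max B 0 * q ^ s * q ^ i := by
        refine Finset.sum_le_sum fun i _ => ?_
        have h3 := hB' (s + i)
        rw [pow_add q] at h3
        push_cast at h3
        refine le_trans ?_ (h3.trans (le_of_eq (by ring)))
        gcongr
        nlinarith [(Nat.cast_nonneg s : (0 : ℝ) ≤ s), (Nat.cast_nonneg i : (0 : ℝ) ≤ i)]
    _ = max B 0 * q ^ s * ∑ i ∈ Finset.range N, q ^ i := by rw [Finset.mul_sum]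
    _ ≤ max B 0 * q ^ s * (1 - q)⁻¹ := by
        gcongr
        exact (summable_geometric_of_lt_one hq0.le hq1).sum_le_tsum _ (fun _ _ => by positivity)
          |>.trans (tsum_geometric_of_lt_one hq0.le hq1).le
    _ = _ := by ring

end Analysis

section Tuples

variable {H ι : Type*} {v : H → ι} {r : ℕ} {k : Fin r → ℕ}

/-- The successor on a disjoint union of cyclically ordered sets. -/
def sigmaSucc (k : Fin r → ℕ) (x : Σ i, Fin (k i + 1)) : Σ i, Fin (k i + 1) := ⟨x.1, x.2 + 1⟩

lemma sigmaSucc_injective : Function.Injective (sigmaSucc k) := by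
  rintro ⟨i, a⟩ ⟨j, b⟩ h
  have h1 : i = j := congrArg Sigma.fst h
  subst h1
  have h2 : a + 1 = b + 1 := by simpa [sigmaSucc] using h
  rw [add_right_cancel h2]

variable {α : (Σ i, Fin (k i + 1)) → Turn v} {σ : H → H}

lemma follows_of_isolated_tuple (hσ : ∀ h, σ (σ h) = h)
    (h : ∀ i, IsCycleOf σ (fun j => α ⟨i, j⟩) ∧ Isolated σ (fun j => α ⟨i, j⟩))
    (hs : Function.Injective (fun i => turnSupport (fun j => α ⟨i, j⟩))) :
    Function.Injective (fun x => (α x).vert) ∧ Follows (sigmaSucc k) α σ := by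
  refine ⟨?_, ?_⟩
  · rintro ⟨i, a⟩ ⟨j, b⟩ hab
    have h1 : i = j := by
      apply hs
      apply (h i).1.support_eq hσ (h i).2 (h j).1 (h j).2
      rw [Finset.not_disjoint_iff]
      exact ⟨_, mem_turnSupport.2 ⟨a, rfl⟩, mem_turnSupport.2 ⟨b, hab.symm⟩⟩
    subst h1
    rw [(h i).1.injective hab]
  · rintro ⟨i, a⟩
    exact (h i).1.follows a

lemma isolated_tuple_of_follows (hα : Function.Injective (fun x => (α x).vert))
    (hf : Follows (sigmaSucc k) α σ) (hiso : Isolated σ α) :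
    (∀ i, IsCycleOf σ (fun j => α ⟨i, j⟩) ∧ Isolated σ (fun j => α ⟨i, j⟩)) ∧
      Function.Injective (fun i => turnSupport (fun j => α ⟨i, j⟩)) := by
  refine ⟨fun i => ⟨⟨fun a b hab => ?_, fun j => hf ⟨i, j⟩⟩, ?_⟩, fun i j hij => ?_⟩
  · have := @hα ⟨i, a⟩ ⟨i, b⟩ hab
    simpa using this
  · have hesc : ∀ h, Escapes σ (fun j => α ⟨i, j⟩) h → Escapes σ α h := by
      intro h he
      induction he with
      | @exit h j hv hu =>
        refine Escapes.exit ⟨i, j⟩ hv ?_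
        rintro ⟨⟨i', j'⟩, hx⟩
        have h1 : v h = (α ⟨i', j'⟩).vert := by
          rcases hx with rfl | rfl
          · exact Turn.vert_enter _
          · exact Turn.vert_leave _
        have h2 := @hα ⟨i, j⟩ ⟨i', j'⟩ (hv.symm.trans h1)
        have h3 : i = i' := congrArg Sigma.fst h2
        subst h3
        exact hu ⟨j', hx⟩
      | step _ hv hne ih => exact Escapes.step ih hv hne
    intro h he j
    exact hiso h (hesc h he) ⟨i, j⟩
  · have h1 : (α ⟨i, 0⟩).vert ∈ turnSupport (fun b => α ⟨j, b⟩) := by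
      rw [← show turnSupport (fun a => α ⟨i, a⟩) = turnSupport (fun b => α ⟨j, b⟩) from hij]
      exact mem_turnSupport.2 ⟨0, rfl⟩
    obtain ⟨b, hb⟩ := mem_turnSupport.1 h1
    exact (congrArg Sigma.fst (@hα ⟨j, b⟩ ⟨i, 0⟩ hb)).symm

/-- Tuples of parametrized cycles, sorted by their lengths. -/
def tupleEquiv (v : H → ι) (L : Finset ℕ) (r : ℕ) :
    (Σ k : Fin r → L, ((Σ i, Fin ((k i).1 + 1)) → Turn v)) ≃ (Fin r → CycleParam v L) where
  toFun x := fun i => ⟨x.1 i, fun j => x.2 ⟨i, j⟩⟩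
  invFun τ := ⟨fun i => (τ i).1, fun x => (τ x.1).2 x.2⟩
  left_inv _ := rfl
  right_inv _ := rfl

variable [Fintype H]

/-- The expected number of tuples of distinct isolated cycles with prescribed lengths. -/
def meanTuples (v : H → ι) (k : Fin r → ℕ) : ℝ :=
  ∑ α : (Σ i, Fin (k i + 1)) → Turn v, pairProb (fun σ =>
    (∀ i, IsCycleOf σ (fun j => α ⟨i, j⟩) ∧ Isolated σ (fun j => α ⟨i, j⟩)) ∧
      Function.Injective (fun i => turnSupport (fun j => α ⟨i, j⟩)))

lemma mean_descFactorial_numIsolated (v : H → ι) (L : Finset ℕ) (r : ℕ) :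
    (∑ σ ∈ pairings H, ((numIsolated v L σ).descFactorial r : ℝ)) / (pairings H).card
      = ∑ k : Fin r → L, (∏ i, (1 / (2 * (((k i).1 : ℝ) + 1)))) * meanTuples v (fun i => (k i).1) := by
  have h1 : ∀ σ ∈ pairings H, ((numIsolated v L σ).descFactorial r : ℝ)
      = ∑ x : Σ k : Fin r → L, ((Σ i, Fin ((k i).1 + 1)) → Turn v),
        (∏ i, (1 / (2 * (((x.1 i).1 : ℝ) + 1)))) *
        (if (∀ i, IsCycleOf σ (fun j => x.2 ⟨i, j⟩) ∧ Isolated σ (fun j => x.2 ⟨i, j⟩)) ∧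
          Function.Injective (fun i => turnSupport (fun j => x.2 ⟨i, j⟩)) then (1 : ℝ) else 0) := by
    intro σ hσ
    rw [mem_pairings] at hσ
    rw [← sum_isolated_tuples hσ.1, ← (tupleEquiv v L r).sum_comp]
    apply Finset.sum_congr rfl
    intro x _
    rw [mul_ite, mul_one, mul_zero]
    rfl
  rw [Finset.sum_congr rfl h1, Finset.sum_comm, Finset.sum_div, Fintype.sum_sigma]
  apply Finset.sum_congr rfl
  intro k _
  rw [meanTuples, Finset.mul_sum]
  apply Finset.sum_congr rfl
  intro α _
  rw [pairProb_eq_sum, ← Finset.mul_sum, mul_div_assoc]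
  congr!

lemma sum_pairProb_follows {J : Type*} [Fintype J] {next : J → J}
    (hnext : Function.Injective next) (hne : (pairings H).Nonempty) :
    ∑ α ∈ transversals v J, pairProb (Follows next α) = meanTrans v (Fintype.card J) := by
  rw [Finset.sum_congr rfl (fun α hα => pairProb_follows hnext hne hα), Finset.sum_const,
    nsmul_eq_mul, card_transversals, meanTrans, numTrans]

lemma pairProb_eq_zero {E : (H → H) → Prop} (h : ∀ σ ∈ pairings H, ¬ E σ) : pairProb E = 0 := by
  rw [pairProb, Finset.filter_eq_empty_iff.2 (fun σ hσ => h σ hσ)]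
  simp

lemma meanTuples_eq :
    meanTuples v k = ∑ α ∈ transversals v (Σ i, Fin (k i + 1)), pairProb (fun σ =>
      (∀ i, IsCycleOf σ (fun j => α ⟨i, j⟩) ∧ Isolated σ (fun j => α ⟨i, j⟩)) ∧
      Function.Injective (fun i => turnSupport (fun j => α ⟨i, j⟩))) := by
  symm
  apply Finset.sum_subset (Finset.subset_univ _)
  intro α _ hα
  apply pairProb_eq_zero
  rintro σ hσ ⟨h1, h2⟩
  exact hα (mem_transversals.2 (follows_of_isolated_tuple (mem_pairings.1 hσ).1 h1 h2).1)

lemma meanTuples_le (hne : (pairings H).Nonempty) :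
    meanTuples v k ≤ meanTrans v (∑ i, (k i + 1)) := by
  have h1 := sum_pairProb_follows (v := v) (sigmaSucc_injective (k := k)) hne
  simp only [Fintype.card_sigma, Fintype.card_fin] at h1
  rw [← h1, meanTuples_eq]
  refine Finset.sum_le_sum fun α _ => pairProb_mono fun σ hσ h => ?_
  exact (follows_of_isolated_tuple (mem_pairings.1 hσ).1 h.1 h.2).2

lemma le_meanTuples (hne : (pairings H).Nonempty) :
    meanTrans v (∑ i, (k i + 1)) - ∑ α ∈ transversals v (Σ i, Fin (k i + 1)),
      pairProb (fun σ => Follows (sigmaSucc k) α σ ∧ ¬ Isolated σ α) ≤ meanTuples v k := by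
  have h1 := sum_pairProb_follows (v := v) (sigmaSucc_injective (k := k)) hne
  simp only [Fintype.card_sigma, Fintype.card_fin] at h1
  rw [← h1, meanTuples_eq, sub_le_iff_le_add, ← Finset.sum_add_distrib]
  refine Finset.sum_le_sum fun α hα => ?_
  refine (pairProb_mono fun σ hσ h => ?_).trans (pairProb_or_le _ _)
  by_cases hiso : Isolated σ α
  · exact Or.inl (isolated_tuple_of_follows (mem_transversals.1 hα) h hiso)
  · exact Or.inr ⟨h, hiso⟩

end Tuples

section Limits

variable {A : Type*} {l : Filter A} {H ι : A → Type} [∀ a, Fintype (H a)]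
    {v : ∀ a, H a → ι a} {Δ : A → ℕ} {ν : ℝ}

lemma ConfigLimit.nu_nonneg [l.NeBot] (h : ConfigLimit l v Δ ν) : 0 ≤ ν :=
  ge_of_tendsto h.tendsto_ratio (Eventually.of_forall fun a => by positivity)

/-- Uniform geometric bound for the expected number of cycles, with prescribed connections,
that are not isolated. -/
lemma ConfigLimit.exists_not_isolated_bound (h : ConfigLimit l v Δ ν) :
    ∃ (q : ℝ) (E : A → ℝ), 0 ≤ q ∧ q < 1 ∧ Tendsto E l (𝓝 0) ∧
      (∀ᶠ a in l, 0 ≤ E a) ∧ ∀ᶠ a in l,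
      ∀ (J : Type) [Fintype J] (next : J → J), Function.Injective next →
      ∑ α ∈ transversals (v a) J, pairProb (fun σ => Follows next α σ ∧ ¬ Isolated σ α)
        ≤ E a * q ^ Fintype.card J := by
  obtain ⟨c, hc0, hc1, hsub⟩ := h.exists_subcritical
  obtain ⟨B, q, hB, hq0, hq1, hbound⟩ := exists_geometric_bound hc0 hc1
  have hnn : ∀ᶠ a in l, 0 ≤ (Δ a : ℝ) ^ 2 * (2 / ((1 - c) * ((Fintype.card (H a) : ℝ) - 1))) := by
    filter_upwards [hsub] with a ha
    have := ha.large
    have : 0 ≤ 2 / ((1 - c) * ((Fintype.card (H a) : ℝ) - 1)) := div_nonneg (by norm_num) (by linarith)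
    positivity
  refine ⟨q, fun a => Δ a ^ 2 * (2 / ((1 - c) * ((Fintype.card (H a) : ℝ) - 1))) * B, hq0, hq1,
    ?_, ?_, ?_⟩
  · have h1 := ((h.tendsto_div_sub h.tendsto_max 1).const_mul (2 / (1 - c))).mul_const B
    rw [mul_zero, zero_mul] at h1
    refine h1.congr fun a => ?_
    simp only [div_eq_mul_inv, mul_inv]
    ring
  · filter_upwards [hnn] with a ha
    exact mul_nonneg ha hB
  · filter_upwards [hsub, h.degree_le, hnn] with a ha hΔ hn J _ next hnext
    refine (sum_pairProb_not_isolated_le hnext ha hΔ).trans ?_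
    rw [mul_assoc _ B]
    exact mul_le_mul_of_nonneg_left (hbound _ _) hn

lemma ConfigLimit.tendsto_meanTuples (h : ConfigLimit l v Δ ν) {r : ℕ} (k : Fin r → ℕ) :
    Tendsto (fun a => meanTuples (v a) k) l (𝓝 (∏ i, ν ^ (k i + 1))) := by
  obtain ⟨c, hc0, hc1, hsub⟩ := h.exists_subcritical
  obtain ⟨q, E, hq0, hq1, hE, -, hbound⟩ := h.exists_not_isolated_bound
  rw [Finset.prod_pow_eq_pow_sum]
  have h1 := h.tendsto_meanTrans (∑ i, (k i + 1))
  have h2 := h1.sub (hE.mul_const (q ^ Fintype.card (Σ i, Fin (k i + 1))))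
  rw [zero_mul, sub_zero] at h2
  refine tendsto_of_tendsto_of_tendsto_of_le_of_le' h2 h1 ?_ ?_
  · filter_upwards [hsub, hbound] with a ha hb
    refine le_trans ?_ (le_meanTuples (pairings_nonempty ha.even))
    exact sub_le_sub_left (hb _ _ sigmaSucc_injective) _
  · filter_upwards [hsub] with a ha
    exact meanTuples_le (pairings_nonempty ha.even)

/-- The limiting mean of the number of cycles whose length minus one lies in `L`. -/
def cycleMean (ν : ℝ) (L : Finset ℕ) : ℝ := ∑ l ∈ L, ν ^ (l + 1) / (2 * ((l : ℝ) + 1))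

lemma ConfigLimit.tendsto_descFactorial (h : ConfigLimit l v Δ ν) (L : Finset ℕ) (r : ℕ) :
    Tendsto (fun a => (∑ σ ∈ pairings (H a), ((numIsolated (v a) L σ).descFactorial r : ℝ))
      / (pairings (H a)).card) l (𝓝 (cycleMean ν L ^ r)) := by
  simp only [mean_descFactorial_numIsolated]
  have h1 : cycleMean ν L ^ r = ∑ k : Fin r → L, (∏ i, (1 / (2 * (((k i).1 : ℝ) + 1))))
      * ∏ i, ν ^ ((k i).1 + 1) := by
    rw [cycleMean, ← Finset.sum_coe_sort, Finset.sum_pow', Fintype.piFinset_univ]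
    refine Finset.sum_congr rfl fun k _ => ?_
    rw [← Finset.prod_mul_distrib]
    exact Finset.prod_congr rfl fun i _ => by ring
  rw [h1]
  exact tendsto_finsetSum _ fun k _ => (h.tendsto_meanTuples _).const_mul _

lemma ConfigLimit.tendsto_numIsolated_eq_zero (h : ConfigLimit l v Δ ν) (L : Finset ℕ) :
    Tendsto (fun a => pairProb (fun σ => numIsolated (v a) L σ = 0)) l
      (𝓝 (Real.exp (-cycleMean ν L))) := by
  set μ := cycleMean ν L with hμ
  let m : ℕ → A → ℝ := fun j a =>
    (∑ σ ∈ pairings (H a), ((numIsolated (v a) L σ).choose j : ℝ)) / (pairings (H a)).card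
  have hm : ∀ j, Tendsto (m j) l (𝓝 (μ ^ j / j !)) := by
    intro j
    refine ((h.tendsto_descFactorial L j).div_const (j ! : ℝ)).congr fun a => ?_
    rw [div_right_comm, Finset.sum_div]
    congr 1
    refine Finset.sum_congr rfl fun σ _ => ?_
    rw [Nat.descFactorial_eq_factorial_mul_choose]
    push_cast
    field_simp
  have hexp : HasSum (fun j : ℕ => (-1 : ℝ) ^ j * (μ ^ j / j !)) (Real.exp (-μ)) := by
    have := NormedSpace.expSeries_div_hasSum_exp (-μ)
    rw [← Real.exp_eq_exp_ℝ] at this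
    have e : (fun j : ℕ => (-1 : ℝ) ^ j * (μ ^ j / j !)) = fun j : ℕ => (-μ) ^ j / j ! :=
      funext fun j => by rw [neg_pow μ]; ring
    rwa [e]
  refine tendsto_of_approx (f := fun q a => ∑ j ∈ Finset.range q, (-1) ^ j * m j a)
    (e := fun q => μ ^ q / q ! + 1 / ((q : ℝ) + 1)) (fun q => tendsto_finsetSum _ fun j _ =>
      (hm j).const_mul _) hexp.tendsto_sum_nat ?_ fun q => ?_
  · simpa using (FloorSemiring.tendsto_pow_div_factorial_atTop μ).add
      tendsto_one_div_add_atTop_nhds_zero_nat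
  · have hq : (0 : ℝ) < 1 / ((q : ℝ) + 1) := by positivity
    filter_upwards [(hm q).eventually_lt_const (show μ ^ q / q ! < μ ^ q / q ! + 1 / ((q : ℝ) + 1)
      by linarith)] with a ha
    refine le_trans ?_ ha.le
    have h1 : ∑ j ∈ Finset.range q, (-1) ^ j * m j a
        = (∑ σ ∈ pairings (H a), ∑ j ∈ Finset.range q,
          (-1) ^ j * ((numIsolated (v a) L σ).choose j : ℝ)) / (pairings (H a)).card := by
      rw [Finset.sum_comm, Finset.sum_div]
      refine Finset.sum_congr rfl fun j _ => ?_
      rw [← Finset.mul_sum, mul_div_assoc]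
    rw [pairProb_eq_sum, h1, ← sub_div, ← Finset.sum_sub_distrib, abs_div, Nat.abs_cast]
    refine div_le_div_of_nonneg_right ?_ (by positivity)
    refine (Finset.abs_sum_le_sum_abs _ _).trans (Finset.sum_le_sum fun σ _ => ?_)
    refine le_trans (le_of_eq ?_) (abs_indicator_sub_alternating_le (numIsolated (v a) L σ) q)
    congr!

lemma IsCycleOf.lt_card {H ι : Type*} [Fintype H] {v : H → ι} {σ : H → H} {l : ℕ}
    {α : Fin (l + 1) → Turn v} (hα : IsCycleOf σ α) : l < Fintype.card H := by
  have : Fintype.card (Fin (l + 1)) ≤ Fintype.card H :=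
    Fintype.card_le_of_injective (fun j => (α j).enter) fun i j hij =>
      hα.injective (Turn.vert_eq_of_enter_eq hij)
  rw [Fintype.card_fin] at this
  exact this

lemma add_one_injective (l : ℕ) : Function.Injective (fun j : Fin (l + 1) => j + 1) :=
  add_left_injective 1

lemma sum_geometric_Ico_le {q : ℝ} (hq0 : 0 ≤ q) (hq1 : q < 1) (K N : ℕ) :
    ∑ l ∈ Finset.Ico K N, q ^ (l + 1) ≤ q ^ K / (1 - q) := by
  rw [Finset.sum_Ico_eq_sum_range]
  calc _ ≤ ∑ i ∈ Finset.range (N - K), q ^ K * q ^ i := by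
        refine Finset.sum_le_sum fun i _ => ?_
        rw [← pow_add]
        exact pow_le_pow_of_le_one hq0 hq1.le (by omega)
    _ = q ^ K * ∑ i ∈ Finset.range (N - K), q ^ i := by rw [Finset.mul_sum]
    _ ≤ q ^ K * (1 - q)⁻¹ := by
        gcongr
        exact ((summable_geometric_of_lt_one hq0 hq1).sum_le_tsum _ (fun _ _ => by positivity)).trans
          (tsum_geometric_of_lt_one hq0 hq1).le
    _ = _ := rfl

/-- With high probability all cycles are isolated. -/
lemma ConfigLimit.tendsto_not_isolated (h : ConfigLimit l v Δ ν) :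
    Tendsto (fun a => pairProb (fun σ => ∃ (l : ℕ) (α : Fin (l + 1) → Turn (v a)),
      IsCycleOf σ α ∧ ¬ Isolated σ α)) l (𝓝 0) := by
  obtain ⟨q, E, hq0, hq1, hE, hE0, hbound⟩ := h.exists_not_isolated_bound
  have h1 := hE.mul_const (1 / (1 - q))
  rw [zero_mul] at h1
  refine tendsto_of_tendsto_of_tendsto_of_le_of_le' tendsto_const_nhds h1
    (Eventually.of_forall fun a => pairProb_nonneg _) ?_
  filter_upwards [hbound, hE0] with a hb he
  calc _ ≤ pairProb (fun σ => ∃ l ∈ Finset.Ico 0 (Fintype.card (H a)),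
          ∃ α ∈ transversals (v a) (Fin (l + 1)), Follows (· + 1) α σ ∧ ¬ Isolated σ α) := by
        apply pairProb_mono
        rintro σ _ ⟨l, α, h2, h3⟩
        exact ⟨l, Finset.mem_Ico.2 ⟨Nat.zero_le _, h2.lt_card⟩, α,
          mem_transversals.2 h2.injective, h2.follows, h3⟩
    _ ≤ ∑ l ∈ Finset.Ico 0 (Fintype.card (H a)), ∑ α ∈ transversals (v a) (Fin (l + 1)),
          pairProb (fun σ => Follows (· + 1) α σ ∧ ¬ Isolated σ α) := by
        refine (pairProb_exists_le _ _).trans (Finset.sum_le_sum fun l _ => ?_)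
        exact pairProb_exists_le _ _
    _ ≤ ∑ l ∈ Finset.Ico 0 (Fintype.card (H a)), E a * q ^ (l + 1) := by
        refine Finset.sum_le_sum fun l _ => ?_
        have := hb (Fin (l + 1)) (· + 1) (add_one_injective l)
        rwa [Fintype.card_fin] at this
    _ ≤ E a * (1 / (1 - q)) := by
        rw [← Finset.mul_sum]
        have := sum_geometric_Ico_le hq0 hq1 0 (Fintype.card (H a))
        rw [pow_zero] at this
        exact mul_le_mul_of_nonneg_left this he

lemma Subcritical.pairProb_long_cycle_le {H ι : Type*} [Fintype H] {v : H → ι} {c : ℝ}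
    (h : Subcritical v c) (K : ℕ) :
    pairProb (fun σ => ∃ l, K ≤ l ∧ ∃ α : Fin (l + 1) → Turn v, IsCycleOf σ α)
      ≤ c ^ K / (1 - c) := by
  calc _ ≤ pairProb (fun σ => ∃ l ∈ Finset.Ico K (Fintype.card H),
          ∃ α ∈ transversals v (Fin (l + 1)), Follows (· + 1) α σ) := by
        apply pairProb_mono
        rintro σ _ ⟨l, hl, α, h2⟩
        exact ⟨l, Finset.mem_Ico.2 ⟨hl, h2.lt_card⟩, α, mem_transversals.2 h2.injective, h2.follows⟩
    _ ≤ ∑ l ∈ Finset.Ico K (Fintype.card H), ∑ α ∈ transversals v (Fin (l + 1)),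
          pairProb (fun σ => Follows (· + 1) α σ) := by
        refine (pairProb_exists_le _ _).trans (Finset.sum_le_sum fun l _ => ?_)
        exact pairProb_exists_le _ _
    _ ≤ ∑ l ∈ Finset.Ico K (Fintype.card H), c ^ (l + 1) := by
        refine Finset.sum_le_sum fun l _ => ?_
        have := sum_pairProb_follows (v := v) (add_one_injective l) (pairings_nonempty h.even)
        rw [Fintype.card_fin] at this
        exact this.trans_le (h.meanTrans_le _)
    _ ≤ _ := sum_geometric_Ico_le h.nonneg h.lt_one _ _

lemma tendsto_of_abs_sub_le {f g e : A → ℝ} {x : ℝ} (hg : Tendsto g l (𝓝 x))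
    (he : Tendsto e l (𝓝 0)) (h : ∀ᶠ a in l, |f a - g a| ≤ e a) : Tendsto f l (𝓝 x) := by
  have := (squeeze_zero_norm' h he).add hg
  simpa using this

/-- Asymptotic probability that no cycle has a length in a given finite set. -/
theorem ConfigLimit.tendsto_no_cycle_in (h : ConfigLimit l v Δ ν) (L : Finset ℕ) :
    Tendsto (fun a => pairProb (fun σ => ∀ l ∈ L, ∀ α : Fin (l + 1) → Turn (v a),
      ¬ IsCycleOf σ α)) l (𝓝 (Real.exp (-cycleMean ν L))) := by
  refine tendsto_of_abs_sub_le (h.tendsto_numIsolated_eq_zero L) h.tendsto_not_isolated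
    (Eventually.of_forall fun a => abs_pairProb_sub_le fun σ _ hB => ?_)
  rw [numIsolated_eq_zero]
  push Not at hB
  constructor
  · intro h1 l hl α h2
    exact absurd h2 (h1 l hl α)
  · intro h1 l hl α h2
    exact h1 l hl α h2 (hB l α h2)

/-- Asymptotic probability that there are no cycles. -/
theorem ConfigLimit.tendsto_no_cycle (h : ConfigLimit l v Δ ν) :
    Tendsto (fun a => pairProb (fun σ => ∀ l, ∀ α : Fin (l + 1) → Turn (v a),
      ¬ IsCycleOf σ α)) l (𝓝 (Real.sqrt (1 - ν))) := by
  obtain ⟨c, hc0, hc1, hsub⟩ := h.exists_subcritical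
  rcases l.eq_or_neBot with rfl | hl
  · exact tendsto_bot
  have hν0 := h.nu_nonneg
  have hν1 := h.lt_one
  refine tendsto_of_approx (fun K => h.tendsto_no_cycle_in (Finset.range K))
    (e := fun K => c ^ K / (1 - c)) ?_ ?_ fun K => ?_
  · have h1 : HasSum (fun n : ℕ => ν ^ (n + 1) / (2 * ((n : ℝ) + 1))) (-Real.log (1 - ν) / 2) := by
      have := (Real.hasSum_pow_div_log_of_abs_lt_one
        (show |ν| < 1 by rwa [abs_of_nonneg hν0])).div_const 2
      have e : (fun n : ℕ => ν ^ (n + 1) / (2 * ((n : ℝ) + 1)))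
          = fun n : ℕ => ν ^ (n + 1) / ((n : ℝ) + 1) / 2 :=
        funext fun n => by rw [div_div, mul_comm (2 : ℝ)]
      rwa [e]
    have h2 : Real.sqrt (1 - ν) = Real.exp (-(-Real.log (1 - ν) / 2)) := by
      rw [Real.sqrt_eq_rpow, Real.rpow_def_of_pos (by linarith)]
      congr 1
      ring
    rw [h2]
    exact (Real.continuous_exp.tendsto _).comp h1.tendsto_sum_nat.neg
  · simpa using (tendsto_pow_atTop_nhds_zero_of_lt_one hc0 hc1).div_const (1 - c)
  · filter_upwards [hsub] with a ha
    refine (abs_pairProb_sub_le fun σ _ hB => ?_).trans (ha.pairProb_long_cycle_le K)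
    push Not at hB
    constructor
    · intro h1 l _
      exact h1 l
    · intro h1 l α
      by_cases hl : l < K
      · exact h1 l (Finset.mem_range.2 hl) α
      · exact hB l (not_lt.1 hl) α

end Limits

section MatchGraph

variable {H ι : Type*} (v : H → ι)

/-- The simple graph underlying the multigraph obtained by connecting matched half-edges. -/
def matchGraph (σ : H → H) : SimpleGraph ι :=
  SimpleGraph.fromRel (fun a b => ∃ h, v h = a ∧ v (σ h) = b)

/-- The multigraph has neither loops nor multiple edges. -/
def IsSimpleMatching (σ : H → H) : Prop :=
  (∀ h, v (σ h) ≠ v h) ∧ ∀ h h', v h = v h' → v (σ h) = v (σ h') → h = h'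

variable {v} {σ : H → H}

lemma matchGraph_adj (hσ : ∀ h, σ (σ h) = h) {a b : ι} :
    (matchGraph v σ).Adj a b ↔ a ≠ b ∧ ∃ h, v h = a ∧ v (σ h) = b := by
  rw [matchGraph, SimpleGraph.fromRel_adj]
  refine and_congr_right fun _ => ⟨?_, Or.inl⟩
  rintro (h | ⟨h, h1, h2⟩)
  · exact h
  · exact ⟨σ h, h2, by rw [hσ, h1]⟩

lemma IsSimpleMatching.adj_iff (hs : IsSimpleMatching v σ) (hσ : ∀ h, σ (σ h) = h) {a b : ι} :
    (matchGraph v σ).Adj a b ↔ ∃ h, v h = a ∧ v (σ h) = b := by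
  rw [matchGraph_adj hσ]
  refine ⟨fun h => h.2, ?_⟩
  rintro ⟨h, rfl, rfl⟩
  exact ⟨(hs.1 h).symm, h, rfl, rfl⟩

/-- A matching is simple if and only if it has no cycles of length one or two. -/
lemma isSimpleMatching_iff (hσ : σ ∈ {τ : H → H | (∀ h, τ (τ h) = h) ∧ ∀ h, τ h ≠ h}) :
    IsSimpleMatching v σ ↔ ∀ l ∈ ({0, 1} : Finset ℕ), ∀ α : Fin (l + 1) → Turn v,
      ¬ IsCycleOf σ α := by
  obtain ⟨hσ1, hσ2⟩ := hσ
  constructor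
  · rintro ⟨h1, h2⟩ l hl α hα
    simp only [Finset.mem_insert, Finset.mem_singleton] at hl
    rcases hl with rfl | rfl
    · apply h1 (α 0).leave
      rw [hα.follows 0, Turn.vert_enter (v := v), Turn.vert_leave (v := v)]
      rfl
    · have e0 := hα.follows 0
      have e1 := hα.follows 1
      simp only [zero_add, show (1 + 1 : Fin 2) = 0 from rfl] at e0 e1
      refine (α 0).enter_ne_leave (h2 _ _ ?_ ?_)
      · rw [Turn.vert_enter (v := v), Turn.vert_leave (v := v)]
      · rw [e0, ← e1, hσ1, Turn.vert_leave (v := v), Turn.vert_enter (v := v)]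
  · intro h
    have hloop : ∀ g, v (σ g) ≠ v g := by
      intro g hg
      refine h 0 (by simp) (fun _ => ⟨(σ g, g), hg, hσ2 g⟩) ⟨fun i j _ => Subsingleton.elim (α := Fin 1) i j, ?_⟩
      intro j
      rfl
    refine ⟨hloop, fun g g' h1 h2 => ?_⟩
    by_contra hne
    have hne2 : σ g ≠ σ g' := fun heq => hne (by rw [← hσ1 g, heq, hσ1])
    refine h 1 (by simp) ![⟨(g', g), h1.symm, fun heq => hne heq.symm⟩, ⟨(σ g, σ g'), h2, hne2⟩] ⟨?_, ?_⟩
    · intro i j hij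
      fin_cases i <;> fin_cases j
      · rfl
      · exact absurd (hij.trans rfl).symm (fun heq => hloop g (heq.trans h1.symm))
      · exact absurd hij (fun heq => hloop g (heq.trans h1.symm))
      · rfl
    · intro j
      fin_cases j
      · rfl
      · exact hσ1 g'

/-- No component is unicyclic. -/
def NoUnicyclic {V : Type*} [Finite V] (Γ : SimpleGraph V) : Prop :=
  ∀ u, ¬ IsUnicyclic (Γ.connectedComponentMk u).toSimpleGraph

lemma noUnicyclic_of_isAcyclic {V : Type*} [Finite V] {Γ : SimpleGraph V} (h : Γ.IsAcyclic) :
    NoUnicyclic Γ := by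
  rintro u ⟨h1, h2⟩
  have := (SimpleGraph.isTree_iff_connected_and_card.1
    (h.isTree_connectedComponent (Γ.connectedComponentMk u))).2
  omega

lemma isAcyclic_matchGraph (hσ : ∀ h, σ (σ h) = h)
    (h : ∀ l, ∀ α : Fin (l + 1) → Turn v, ¬ IsCycleOf σ α) : (matchGraph v σ).IsAcyclic := by
  rw [SimpleGraph.isAcyclic_iff_free_cycleGraph]
  rintro n hn ⟨f⟩
  obtain ⟨m, rfl⟩ : ∃ m, n = m + 3 := ⟨n - 3, by omega⟩
  have hadj : ∀ i : Fin (m + 3), ∃ g, v g = f i ∧ v (σ g) = f (i + 1) := by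
    intro i
    have h1 : (SimpleGraph.cycleGraph (m + 3)).Adj i (i + 1) := by
      rw [SimpleGraph.cycleGraph_adj]
      right
      simp
    exact ((matchGraph_adj hσ).1 (f.toHom.map_adj h1)).2
  choose g hg1 hg2 using hadj
  have hne : ∀ i : Fin (m + 3), σ (g (i - 1)) ≠ g i := by
    intro i heq
    have h1 : f (i - 1) = f (i + 1) := by
      rw [← hg1, ← hg2, ← heq, hσ]
    have h2 : i - 1 = i + 1 := f.injective h1
    have h3 : (1 + 1 : Fin (m + 3)) = 0 := by
      have : i + 1 - (i - 1) = 0 := by rw [h2, sub_self]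
      rw [← this]; abel
    have h4 := congrArg Fin.val h3
    rw [Fin.val_add] at h4
    have h5 : (1 + 1) % (m + 3) = 0 := h4
    rw [Nat.mod_eq_of_lt (by omega)] at h5
    omega
  have hv : ∀ i : Fin (m + 3), v (σ (g (i - 1))) = v (g i) := by
    intro i
    rw [hg2, hg1, sub_add_cancel]
  refine h (m + 2) (fun i => ⟨(σ (g (i - 1)), g i), hv i, hne i⟩) ⟨fun i j hij => ?_, fun j => ?_⟩
  · have h1 : v (σ (g (i - 1))) = v (σ (g (j - 1))) := hij
    rw [hv, hv, hg1, hg1] at h1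
    exact f.injective h1
  · show σ (g j) = σ (g (j + 1 - 1))
    rw [add_sub_cancel_right]

lemma Escapes.not_uses {l : ℕ} {α : Fin (l + 1) → Turn v}
    (hiso : Isolated σ α) {h : H} (he : Escapes σ α h) : ¬ Uses α h := by
  cases he with
  | exit j hv hu => exact hu
  | @step g _ hr hv hne =>
    intro hu
    obtain ⟨j, hj⟩ := mem_turnSupport.1 hu.mem_turnSupport
    exact hiso g hr j (by rw [← hv, hj])

lemma Escapes.not_escapes_partner {J : Type*} (hσ : ∀ h, σ (σ h) = h) {α : J → Turn v}
    (hiso : Isolated σ α) {h : H} (he : Escapes σ α h) : ¬ Escapes σ α (σ h) := by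
  induction he with
  | @exit h j hv hu =>
    intro h'
    exact hiso _ h' j (by rw [hσ, hv])
  | @step g h hr hv hne ih =>
    intro h'
    apply ih
    refine Escapes.step h' ?_ ?_
    · rw [hσ, hv]
    · rw [hσ]; exact hne.symm

/-- In a simple multigraph the component of an isolated cycle is unicyclic. -/
lemma isUnicyclic_of_isolated [Finite ι] (hσ : ∀ h, σ (σ h) = h) (hs : IsSimpleMatching v σ)
    {l : ℕ} {α : Fin (l + 1) → Turn v} (hα : IsCycleOf σ α) (hiso : Isolated σ α) :
    IsUnicyclic ((matchGraph v σ).connectedComponentMk (α 0).vert).toSimpleGraph := by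
  set Γ := matchGraph v σ with hΓ
  set C := Γ.connectedComponentMk (α 0).vert with hC
  refine ⟨C.connected_toSimpleGraph, ?_⟩
  have hadj : ∀ h, Γ.Adj (v h) (v (σ h)) := fun h => (hs.adj_iff hσ).2 ⟨h, rfl, rfl⟩
  have hmem : ∀ h, v h ∈ C → v (σ h) ∈ C := fun h hh =>
    (SimpleGraph.ConnectedComponent.mem_supp_congr_adj C (hadj h)).1 hh
  have hcyc : ∀ j, (α j).vert ∈ C := by
    apply Fin.forall_of_add_one (P := fun j => (α j).vert ∈ C) 0
    · exact SimpleGraph.ConnectedComponent.connectedComponentMk_mem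
    · intro j hj
      have := hmem (α j).leave (by rwa [Turn.vert_leave (v := v)])
      rwa [hα.follows, Turn.vert_enter (v := v)] at this
  have hreach : ∀ u ∈ C, (∃ j, u = (α j).vert) ∨ ∃ g, Escapes σ α g ∧ v (σ g) = u := by
    intro u hu
    have hu' : Γ.Reachable (α 0).vert u := by
      have : Γ.connectedComponentMk u = C := hu
      exact (SimpleGraph.ConnectedComponent.exact this).symm
    rw [SimpleGraph.reachable_iff_reflTransGen] at hu'
    clear hu
    induction hu' with
    | refl => exact Or.inl ⟨0, rfl⟩
    | @tail a b _ hab ih =>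
      obtain ⟨h, rfl, rfl⟩ := (hs.adj_iff hσ).1 hab
      rcases ih with ⟨j, hj⟩ | ⟨g, hg, hgv⟩
      · by_cases hu : Uses α h
        · obtain ⟨k, hk⟩ := mem_turnSupport.1 (hα.uses_partner hσ hu).mem_turnSupport
          exact Or.inl ⟨k, hk.symm⟩
        · exact Or.inr ⟨h, Escapes.exit j hj hu, rfl⟩
      · by_cases hh : h = σ g
        · subst hh
          rw [hσ]
          cases hg with
          | exit j hv hu => exact Or.inl ⟨j, hv⟩
          | @step g' _ hr hv hne => exact Or.inr ⟨g', hr, hv.symm⟩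
        · exact Or.inr ⟨h, Escapes.step hg hgv.symm hh, rfl⟩
  let P : C → H → Prop := fun u h => (∃ j, u.1 = (α j).vert ∧ h = (α j).leave) ∨
    (Escapes σ α h ∧ v (σ h) = u.1)
  have hP : ∀ u : C, ∃ h, P u h := by
    rintro ⟨u, hu⟩
    rcases hreach u hu with ⟨j, hj⟩ | ⟨g, hg⟩
    · exact ⟨_, Or.inl ⟨j, hj, rfl⟩⟩
    · exact ⟨g, Or.inr hg⟩
  choose ψ hψ using hP
  have hψC : ∀ u, v (ψ u) ∈ C := by
    intro u
    rcases hψ u with ⟨j, hj, h⟩ | ⟨_, h⟩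
    · rw [h, Turn.vert_leave (v := v)]; exact hcyc j
    · have := hmem (σ (ψ u)) (by rw [h]; exact u.2)
      rwa [hσ] at this
  have huniq : ∀ u u' h, P u h → P u' h → u = u' := by
    rintro u u' h (⟨j, hj, rfl⟩ | ⟨h1, h2⟩) (⟨j', hj', h'⟩ | ⟨h1', h2'⟩)
    · rw [Subtype.ext_iff, hj, hj']
      exact Turn.vert_eq_of_leave_eq h'
    · exact absurd ⟨j, Or.inr rfl⟩ (h1'.not_uses hiso)
    · exact absurd ⟨j', Or.inr h'⟩ (h1.not_uses hiso)
    · rw [Subtype.ext_iff, ← h2, ← h2']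
  have hopp : ∀ u u' h, P u h → P u' (σ h) → False := by
    rintro u u' h (⟨j, hj, rfl⟩ | ⟨h1, h2⟩) (⟨j', hj', h'⟩ | ⟨h1', h2'⟩)
    · rw [hα.follows j] at h'
      have : j + 1 = j' := hα.injective (Turn.vert_eq_of_enter_eq_leave h')
      subst this
      exact Turn.enter_ne_leave _ h'
    · exact h1'.not_uses hiso (hα.uses_partner hσ ⟨j, Or.inr rfl⟩)
    · apply h1.not_uses hiso
      rw [← hσ h]
      exact hα.uses_partner hσ ⟨j', Or.inr h'⟩
    · exact h1.not_escapes_partner hσ hiso h1'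
  let e : C → C.toSimpleGraph.edgeSet := fun u =>
    ⟨s(⟨v (ψ u), hψC u⟩, ⟨v (σ (ψ u)), hmem _ (hψC u)⟩), hadj (ψ u)⟩
  symm
  apply Nat.card_congr (Equiv.ofBijective e ⟨?_, ?_⟩)
  · intro u u' huu
    have h1 := congrArg Subtype.val huu
    simp only [e, Sym2.eq_iff, Subtype.mk.injEq] at h1
    rcases h1 with ⟨h2, h3⟩ | ⟨h2, h3⟩
    · have := hs.2 _ _ h2 h3
      exact huniq u u' (ψ u) (hψ u) (this ▸ hψ u')
    · have := hs.2 (σ (ψ u)) (ψ u') h3 (by rw [hσ, h2])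
      exact (hopp u u' (ψ u) (hψ u) (this ▸ hψ u')).elim
  · have hsurj : ∀ h (hh : v h ∈ C), ∃ u, P u h ∨ P u (σ h) := by
      intro h hh
      by_cases hu : Uses α h
      · obtain ⟨j, rfl | rfl⟩ := hu
        · refine ⟨⟨(α (j - 1)).vert, hcyc _⟩, Or.inr (Or.inl ⟨j - 1, rfl, ?_⟩)⟩
          rw [hα.enter_eq, hσ]
        · exact ⟨⟨(α j).vert, hcyc _⟩, Or.inl (Or.inl ⟨j, rfl, rfl⟩)⟩
      · have hesc : Escapes σ α h ∨ Escapes σ α (σ h) := by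
          rcases hreach _ hh with ⟨j, hj⟩ | ⟨g, hg, hgv⟩
          · exact Or.inl (Escapes.exit j hj hu)
          · by_cases hhg : h = σ g
            · right; rwa [hhg, hσ]
            · exact Or.inl (Escapes.step hg hgv.symm hhg)
        rcases hesc with he | he
        · exact ⟨⟨v (σ h), hmem _ hh⟩, Or.inl (Or.inr ⟨he, rfl⟩)⟩
        · exact ⟨⟨v h, hh⟩, Or.inr (Or.inr ⟨he, by rw [hσ]⟩)⟩
    rintro ⟨x, hx⟩
    induction x using Sym2.ind with
    | _ a b =>
      obtain ⟨a, ha⟩ := a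
      obtain ⟨b, hb⟩ := b
      have hab : Γ.Adj a b := hx
      obtain ⟨h, rfl, rfl⟩ := (hs.adj_iff hσ).1 hab
      obtain ⟨u, hu⟩ := hsurj h ha
      refine ⟨u, Subtype.ext ?_⟩
      simp only [e, Sym2.eq_iff, Subtype.mk.injEq]
      have hdet : ∀ h, P u h → ψ u = h := by
        intro h hh
        rcases hψ u with ⟨j, hj, h1⟩ | ⟨h1, h2⟩ <;> rcases hh with ⟨j', hj', h1'⟩ | ⟨h1', h2'⟩
        · rw [h1, h1', hα.injective (hj.symm.trans hj')]
        · exact absurd (h2'.trans hj) (hiso _ h1' j)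
        · exact absurd (h2.trans hj') (hiso _ h1 j')
        · by_contra hne
          have h3 : σ h ≠ σ (ψ u) := fun h4 => hne (by rw [← hσ (ψ u), ← h4, hσ])
          exact h1'.not_escapes_partner hσ hiso (Escapes.step h1 (h2'.trans h2.symm) h3)
      rcases hu with hu | hu
      · left; rw [hdet _ hu]; exact ⟨rfl, rfl⟩
      · right; rw [hdet _ hu, hσ]; exact ⟨rfl, rfl⟩

lemma no_cycle_iff [Finite ι] (hσ : σ ∈ {τ : H → H | (∀ h, τ (τ h) = h) ∧ ∀ h, τ h ≠ h})
    (hiso : ∀ l, ∀ α : Fin (l + 1) → Turn v, IsCycleOf σ α → Isolated σ α) :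
    (∀ l, ∀ α : Fin (l + 1) → Turn v, ¬ IsCycleOf σ α) ↔
      IsSimpleMatching v σ ∧ NoUnicyclic (matchGraph v σ) := by
  constructor
  · intro h
    exact ⟨(isSimpleMatching_iff hσ).2 fun l _ => h l,
      noUnicyclic_of_isAcyclic (isAcyclic_matchGraph hσ.1 h)⟩
  · rintro ⟨h1, h2⟩ l α hα
    exact h2 _ (isUnicyclic_of_isolated hσ.1 h1 hα (hiso l α hα))

end MatchGraph

section Counting

variable {n : ℕ} (d : Fin n → ℕ)

/-- The half-edges of the configuration model with degree sequence `d`. -/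
abbrev HalfEdge : Type := Σ i : Fin n, Fin (d i)

/-- The vertex of a half-edge. -/
abbrev HalfEdge.vert (h : HalfEdge d) : Fin n := h.1

variable {d}

/-- The matching of half-edges given by an enumeration of the neighbours of every vertex. -/
def matchingOf {Γ : SimpleGraph (Fin n)} (e : ∀ i, Fin (d i) ≃ Γ.neighborSet i)
    (h : HalfEdge d) : HalfEdge d :=
  ⟨(e h.1 h.2).1, (e (e h.1 h.2).1).symm ⟨h.1, (e h.1 h.2).2.symm⟩⟩

lemma matchingOf_symm {Γ : SimpleGraph (Fin n)} (e : ∀ i, Fin (d i) ≃ Γ.neighborSet i)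
    (i : Fin n) (x : Γ.neighborSet i) :
    matchingOf e ⟨i, (e i).symm x⟩ = ⟨x.1, (e x.1).symm ⟨i, x.2.symm⟩⟩ := by
  let F : Γ.neighborSet i → HalfEdge d := fun x => ⟨x.1, (e x.1).symm ⟨i, x.2.symm⟩⟩
  show F (e i ((e i).symm x)) = F x
  rw [Equiv.apply_symm_apply]

lemma matchingOf_matchingOf {Γ : SimpleGraph (Fin n)} (e : ∀ i, Fin (d i) ≃ Γ.neighborSet i)
    (h : HalfEdge d) : matchingOf e (matchingOf e h) = h := by
  obtain ⟨i, a⟩ := h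
  rw [show matchingOf e ⟨i, a⟩ = ⟨(e i a).1, (e (e i a).1).symm ⟨i, (e i a).2.symm⟩⟩ from rfl,
    matchingOf_symm]
  show (⟨i, (e i).symm (e i a)⟩ : HalfEdge d) = ⟨i, a⟩
  rw [Equiv.symm_apply_apply]

lemma matchingOf_mem {Γ : SimpleGraph (Fin n)} (e : ∀ i, Fin (d i) ≃ Γ.neighborSet i) :
    matchingOf e ∈ pairings (HalfEdge d) ∧ IsSimpleMatching (HalfEdge.vert d) (matchingOf e) ∧
      matchGraph (HalfEdge.vert d) (matchingOf e) = Γ := by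
  have hne : ∀ h : HalfEdge d, (matchingOf e h).1 ≠ h.1 := fun h => (e h.1 h.2).2.ne'
  have hs : IsSimpleMatching (HalfEdge.vert d) (matchingOf e) := by
    refine ⟨hne, ?_⟩
    rintro ⟨i, a⟩ ⟨j, b⟩ (rfl : i = j) h2
    have h3 : e i a = e i b := Subtype.ext h2
    rw [(e i).injective h3]
  refine ⟨mem_pairings.2 ⟨matchingOf_matchingOf e, fun h hh => hne h (by rw [hh])⟩, hs, ?_⟩
  ext u w
  rw [hs.adj_iff (matchingOf_matchingOf e)]
  constructor
  · rintro ⟨⟨i, a⟩, rfl, rfl⟩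
    exact (e i a).2
  · intro h
    refine ⟨⟨u, (e u).symm ⟨w, h⟩⟩, rfl, ?_⟩
    rw [matchingOf_symm]

lemma hasDegreeSequence_matchGraph {σ : HalfEdge d → HalfEdge d} (hσ : ∀ h, σ (σ h) = h)
    (hs : IsSimpleMatching (HalfEdge.vert d) σ) :
    HasDegreeSequence d (matchGraph (HalfEdge.vert d) σ) := by
  intro u
  have : (matchGraph (HalfEdge.vert d) σ).neighborSet u
      = Set.range (fun a : Fin (d u) => (σ ⟨u, a⟩).1) := by
    ext w
    rw [SimpleGraph.mem_neighborSet, hs.adj_iff hσ]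
    constructor
    · rintro ⟨⟨i, a⟩, rfl, rfl⟩
      exact ⟨a, rfl⟩
    · rintro ⟨a, rfl⟩
      exact ⟨⟨u, a⟩, rfl, rfl⟩
  rw [this, ← Set.image_univ, Set.ncard_image_of_injective, Set.ncard_univ, Nat.card_eq_fintype_card,
    Fintype.card_fin]
  intro a b hab
  have := hs.2 ⟨u, a⟩ ⟨u, b⟩ rfl hab
  simpa using this

lemma card_matchings_of_graph {Γ : SimpleGraph (Fin n)} (hΓ : HasDegreeSequence d Γ) :
    ((pairings (HalfEdge d)).filter (fun σ => IsSimpleMatching (HalfEdge.vert d) σ ∧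
      matchGraph (HalfEdge.vert d) σ = Γ)).card = ∏ i, (d i)! := by
  have hcard : Fintype.card (∀ i, Fin (d i) ≃ Γ.neighborSet i) = ∏ i, (d i)! := by
    rw [Fintype.card_pi]
    refine Finset.prod_congr rfl fun i _ => ?_
    have h1 : Fintype.card (Fin (d i)) = Fintype.card (Γ.neighborSet i) := by
      rw [Fintype.card_fin, ← hΓ i, ← Nat.card_coe_set_eq, Nat.card_eq_fintype_card]
    rw [Fintype.card_equiv (Fintype.equivOfCardEq h1), Fintype.card_fin]
  rw [← hcard, ← Finset.card_univ]
  symm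
  apply Finset.card_bij (fun e _ => matchingOf e)
  · intro e _
    rw [Finset.mem_filter]
    exact matchingOf_mem e
  · intro e _ e' _ h
    funext i
    ext a
    have := congrArg Sigma.fst (congrFun h ⟨i, a⟩)
    exact congrArg Fin.val this
  · intro σ hσ
    rw [Finset.mem_filter, mem_pairings] at hσ
    obtain ⟨⟨h1, h2⟩, hs, rfl⟩ := hσ
    have hadj : ∀ (i : Fin n) (a : Fin (d i)),
        (σ ⟨i, a⟩).1 ∈ (matchGraph (HalfEdge.vert d) σ).neighborSet i := fun i a =>
      (hs.adj_iff h1).2 ⟨⟨i, a⟩, rfl, rfl⟩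
    let e : ∀ i, Fin (d i) ≃ (matchGraph (HalfEdge.vert d) σ).neighborSet i := fun i =>
      Equiv.ofBijective (fun a => ⟨(σ ⟨i, a⟩).1, hadj i a⟩) ⟨by
        intro a b hab
        have := hs.2 ⟨i, a⟩ ⟨i, b⟩ rfl (congrArg Subtype.val hab)
        simpa using this, by
        rintro ⟨w, hw⟩
        obtain ⟨⟨j, a⟩, rfl, rfl⟩ := (hs.adj_iff h1).1 hw
        exact ⟨a, rfl⟩⟩
    refine ⟨e, Finset.mem_univ _, ?_⟩
    funext ⟨i, a⟩
    have h3 : ∀ (w : Fin n) (b : Fin (d w)) (hb : σ ⟨i, a⟩ = ⟨w, b⟩)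
        (hw : i ∈ (matchGraph (HalfEdge.vert d) σ).neighborSet w),
        (⟨w, (e w).symm ⟨i, hw⟩⟩ : HalfEdge d) = ⟨w, b⟩ := by
      intro w b hb hw
      have : (e w).symm ⟨i, hw⟩ = b := by
        rw [Equiv.symm_apply_eq]
        apply Subtype.ext
        show i = (σ ⟨w, b⟩).1
        rw [← hb, h1]
      rw [this]
    exact h3 _ (σ ⟨i, a⟩).2 rfl _

/-- Every graph with degree sequence `d` comes from `∏ (d i)!` matchings. -/
lemma card_simple_matchings (Q : SimpleGraph (Fin n) → Prop) :
    ((pairings (HalfEdge d)).filter (fun σ => IsSimpleMatching (HalfEdge.vert d) σ ∧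
      Q (matchGraph (HalfEdge.vert d) σ))).card
      = (∏ i, (d i)!) * {Γ | HasDegreeSequence d Γ ∧ Q Γ}.ncard := by
  set T : Finset (SimpleGraph (Fin n)) := Finset.univ.filter (fun Γ => HasDegreeSequence d Γ ∧ Q Γ)
  have hT : {Γ | HasDegreeSequence d Γ ∧ Q Γ}.ncard = T.card := by
    rw [← Set.ncard_coe_finset]
    congr 1
    ext Γ
    simp [T]
  have hmaps : ∀ σ ∈ (pairings (HalfEdge d)).filter (fun σ =>
      IsSimpleMatching (HalfEdge.vert d) σ ∧ Q (matchGraph (HalfEdge.vert d) σ)),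
      matchGraph (HalfEdge.vert d) σ ∈ T := by
    intro σ hσ
    rw [Finset.mem_filter, mem_pairings] at hσ
    simp only [T, Finset.mem_filter, Finset.mem_univ, true_and]
    exact ⟨hasDegreeSequence_matchGraph hσ.1.1 hσ.2.1, hσ.2.2⟩
  rw [hT, Finset.card_eq_sum_card_fiberwise hmaps, mul_comm, ← smul_eq_mul, ← Finset.sum_const]
  refine Finset.sum_congr rfl fun Γ hΓ => ?_
  simp only [T, Finset.mem_filter, Finset.mem_univ, true_and] at hΓ
  rw [← card_matchings_of_graph hΓ.1, Finset.filter_filter]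
  congr 1
  refine Finset.filter_congr fun σ _ => ?_
  constructor
  · rintro ⟨⟨h1, _⟩, h3⟩; exact ⟨h1, h3⟩
  · rintro ⟨h1, rfl⟩; exact ⟨⟨h1, hΓ.2⟩, rfl⟩

end Counting

section Limits

variable {A : Type*} {l : Filter A} {H : A → Type} {m : A → ℕ} [∀ a, Fintype (H a)]
    {v : ∀ a, H a → Fin (m a)} {Δ : A → ℕ} {ν : ℝ}

lemma ConfigLimit.tendsto_simple (h : ConfigLimit l v Δ ν) :
    Tendsto (fun a => pairProb (IsSimpleMatching (v a))) l
      (𝓝 (Real.exp (-(ν / 2 + ν ^ 2 / 4)))) := by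
  have h1 := h.tendsto_no_cycle_in {0, 1}
  have h2 : cycleMean ν {0, 1} = ν / 2 + ν ^ 2 / 4 := by
    rw [cycleMean, Finset.sum_pair (by norm_num)]
    norm_num
  rw [h2] at h1
  refine h1.congr fun a => ?_
  apply le_antisymm <;> refine pairProb_mono fun σ hσ => ?_
  · exact (isSimpleMatching_iff (mem_pairings.1 hσ)).2
  · exact (isSimpleMatching_iff (mem_pairings.1 hσ)).1

lemma ConfigLimit.tendsto_simple_noUnicyclic (h : ConfigLimit l v Δ ν) :
    Tendsto (fun a => pairProb (fun σ => IsSimpleMatching (v a) σ ∧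
      NoUnicyclic (matchGraph (v a) σ))) l (𝓝 (Real.sqrt (1 - ν))) := by
  refine tendsto_of_abs_sub_le h.tendsto_no_cycle h.tendsto_not_isolated
    (Eventually.of_forall fun a => abs_pairProb_sub_le fun σ hσ hB => ?_)
  push Not at hB
  exact (no_cycle_iff (mem_pairings.1 hσ) hB).symm

end Limits

section Components

variable {V W : Type*} [Finite V] [Finite W]

lemma IsUnicyclic.of_iso {G : SimpleGraph V} {G' : SimpleGraph W} (e : G ≃g G')
    (h : IsUnicyclic G) : IsUnicyclic G' :=
  ⟨e.connected_iff.1 h.1, by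
    rw [← Nat.card_congr e.mapEdgeSet, h.2, Nat.card_congr e.toEquiv]⟩

/-- An induced embedding onto a union of components preserves the unicyclic components. -/
lemma isUnicyclic_component_iff {G : SimpleGraph V} {Γ : SimpleGraph W} (f : V ↪ W)
    (hadj : ∀ x y, G.Adj x y ↔ Γ.Adj (f x) (f y))
    (hclosed : ∀ x w, Γ.Adj (f x) w → w ∈ Set.range f) (x : V) :
    IsUnicyclic (G.connectedComponentMk x).toSimpleGraph ↔
      IsUnicyclic (Γ.connectedComponentMk (f x)).toSimpleGraph := by
  have h1 : ∀ u, G.Reachable x u → Γ.Reachable (f x) (f u) := by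
    intro u hu
    exact hu.map ⟨f, fun {a b} h => (hadj a b).1 h⟩
  have h2 : ∀ w, Γ.Reachable (f x) w → ∃ u, f u = w ∧ G.Reachable x u := by
    intro w hw
    rw [SimpleGraph.reachable_iff_reflTransGen] at hw
    induction hw with
    | refl => exact ⟨x, rfl, SimpleGraph.Reachable.refl x⟩
    | @tail a b _ hab ih =>
      obtain ⟨u, rfl, hu⟩ := ih
      obtain ⟨y, rfl⟩ := hclosed u b hab
      exact ⟨y, rfl, hu.trans ((hadj u y).2 hab).reachable⟩
  let C := G.connectedComponentMk x
  let D := Γ.connectedComponentMk (f x)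
  have hC : ∀ u, u ∈ C ↔ G.Reachable x u := fun u =>
    (SimpleGraph.ConnectedComponent.eq (G := G)).trans ⟨fun h => h.symm, fun h => h.symm⟩
  have hD : ∀ u, u ∈ D ↔ Γ.Reachable (f x) u := fun u =>
    (SimpleGraph.ConnectedComponent.eq (G := Γ)).trans ⟨fun h => h.symm, fun h => h.symm⟩
  let e : C.toSimpleGraph ≃g D.toSimpleGraph :=
    { toEquiv := Equiv.ofBijective
        (fun u : C => (⟨f u.1, (hD _).2 (h1 _ ((hC _).1 u.2))⟩ : D)) ⟨by
          intro a b hab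
          exact Subtype.ext (f.injective (congrArg Subtype.val hab)), by
          rintro ⟨w, hw⟩
          obtain ⟨u, rfl, hu⟩ := h2 w ((hD _).1 hw)
          exact ⟨⟨u, (hC _).2 hu⟩, rfl⟩⟩
      map_rel_iff' := fun {a b} => (hadj a.1 b.1).symm }
  exact ⟨fun h => h.of_iso e, fun h => h.of_iso e.symm⟩

lemma isUnicyclic_component_congr {Γ Γ' : SimpleGraph W} (S : Set W)
    (h : ∀ u ∈ S, ∀ w, Γ.Adj u w ↔ Γ'.Adj u w) (hclosed : ∀ u ∈ S, ∀ w, Γ.Adj u w → w ∈ S)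
    {u : W} (hu : u ∈ S) :
    IsUnicyclic (Γ.connectedComponentMk u).toSimpleGraph ↔
      IsUnicyclic (Γ'.connectedComponentMk u).toSimpleGraph := by
  have h1 := isUnicyclic_component_iff (G := Γ.induce S) (Γ := Γ) (Function.Embedding.subtype S)
    (fun x y => Iff.rfl) (fun x w hw => ⟨⟨w, hclosed _ x.2 _ hw⟩, rfl⟩) ⟨u, hu⟩
  have h2 := isUnicyclic_component_iff (G := Γ.induce S) (Γ := Γ') (Function.Embedding.subtype S)
    (fun x y => h x.1 x.2 y.1)
    (fun x w hw => ⟨⟨w, hclosed _ x.2 _ ((h x.1 x.2 w).2 hw)⟩, rfl⟩) ⟨u, hu⟩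
  exact h1.symm.trans h2

lemma not_isUnicyclic_of_isolated_vertex {Γ : SimpleGraph W} {u : W} (h : ∀ w, ¬ Γ.Adj u w) :
    ¬ IsUnicyclic (Γ.connectedComponentMk u).toSimpleGraph := by
  rintro ⟨_, h2⟩
  have hu : u ∈ Γ.connectedComponentMk u :=
    SimpleGraph.ConnectedComponent.connectedComponentMk_mem
  have : Nonempty (Γ.connectedComponentMk u) := ⟨⟨u, hu⟩⟩
  have hpos : 0 < Nat.card (Γ.connectedComponentMk u).toSimpleGraph.edgeSet := by
    rw [h2]; exact Nat.card_pos
  obtain ⟨⟨x, hx⟩⟩ := (Nat.card_pos_iff.1 hpos).1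
  induction x using Sym2.ind with
  | _ a b =>
    have ha : Γ.Reachable u a.1 := (SimpleGraph.ConnectedComponent.exact a.2).symm
    have hab : Γ.Adj a.1 b.1 := hx
    rw [SimpleGraph.reachable_iff_reflTransGen] at ha
    rcases Relation.ReflTransGen.cases_head ha with h3 | ⟨c, h3, _⟩
    · exact h _ (Eq.subst (motive := fun z => Γ.Adj z b.1) h3.symm hab)
    · exact h _ h3

lemma mem_fragVerts_of_adj {Γ : SimpleGraph W} {u w : W} (h : Γ.Adj u w) (hu : u ∈ fragVerts Γ) :
    w ∈ fragVerts Γ := by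
  have : Γ.connectedComponentMk w = Γ.connectedComponentMk u :=
    SimpleGraph.ConnectedComponent.sound h.symm.reachable
  show IsUnicyclic (Γ.connectedComponentMk w).toSimpleGraph
  rw [this]
  exact hu

end Components

section DegreeSum

variable {V : Type*} [Fintype V]

lemma sum_ncard_neighborSet (G : SimpleGraph V) :
    ∑ x, (G.neighborSet x).ncard = 2 * Nat.card G.edgeSet := by
  have := G.sum_degrees_eq_twice_card_edges
  rw [Nat.card_eq_fintype_card, ← SimpleGraph.edgeFinset_card, ← this]
  refine Finset.sum_congr rfl fun x _ => ?_
  rw [← Nat.card_coe_set_eq, Nat.card_eq_fintype_card, SimpleGraph.card_neighborSet_eq_degree]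

lemma IsSimpleFragment.sum_degree {G : SimpleGraph V} (hG : IsSimpleFragment G) :
    ∑ x, (G.neighborSet x).ncard = 2 * Fintype.card V := by
  have hsum : ∀ f : V → ℕ, ∑ x, f x = ∑ C : G.ConnectedComponent, ∑ x : C, f x.1 := by
    intro f
    rw [← (Equiv.sigmaFiberEquiv G.connectedComponentMk).sum_comp, Fintype.sum_sigma]
    rfl
  rw [hsum]
  have hcard : Fintype.card V = ∑ C : G.ConnectedComponent, Nat.card C := by
    rw [← Finset.card_univ, Finset.card_eq_sum_ones, hsum]
    refine Finset.sum_congr rfl fun C _ => ?_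
    rw [Finset.sum_const, smul_eq_mul, mul_one, Nat.card_eq_fintype_card, Finset.card_univ]
  rw [hcard, Finset.mul_sum]
  refine Finset.sum_congr rfl fun C _ => ?_
  rw [← (hG C).2, ← sum_ncard_neighborSet]
  refine Finset.sum_congr rfl fun x _ => ?_
  have : G.neighborSet x.1 = Subtype.val '' (C.toSimpleGraph.neighborSet x) := by
    ext w
    simp only [SimpleGraph.mem_neighborSet, Set.mem_image]
    constructor
    · intro h
      exact ⟨⟨w, (SimpleGraph.ConnectedComponent.mem_supp_congr_adj C h).1 x.2⟩, h, rfl⟩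
    · rintro ⟨y, hy, rfl⟩
      exact hy
  rw [this, Set.ncard_image_of_injective _ Subtype.val_injective]

end DegreeSum

section Decomposition

variable {V : Type*} {G : SimpleGraph V} {n : ℕ}

/-- `f` is an isomorphism of `G` onto the fragment of `Γ`. -/
def IsFragEmbedding (G : SimpleGraph V) (f : V ↪ Fin n) (Γ : SimpleGraph (Fin n)) : Prop :=
  Set.range f = fragVerts Γ ∧ ∀ x y, G.Adj x y ↔ Γ.Adj (f x) (f y)

/-- The degree sequence that remains when the vertices in the range of `f` are isolated. -/
def restDegree (d : Fin n → ℕ) (f : V ↪ Fin n) (i : Fin n) : ℕ := if i ∈ Set.range f then 0 else d i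

/-- The graph `Γ` with all edges at vertices of `S` removed. -/
def isolateVerts (S : Set (Fin n)) (Γ : SimpleGraph (Fin n)) : SimpleGraph (Fin n) where
  Adj a b := Γ.Adj a b ∧ a ∉ S ∧ b ∉ S
  symm := ⟨fun _ _ h => ⟨h.1.symm, h.2.2, h.2.1⟩⟩
  loopless := ⟨fun _ h => h.1.ne rfl⟩

variable {f : V ↪ Fin n}

lemma IsFragEmbedding.closed {Γ : SimpleGraph (Fin n)} (h : IsFragEmbedding G f Γ) {a b : Fin n}
    (hab : Γ.Adj a b) : a ∈ Set.range f ↔ b ∈ Set.range f := by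
  rw [h.1]
  exact ⟨mem_fragVerts_of_adj hab, mem_fragVerts_of_adj hab.symm⟩

lemma neighborSet_of_closed {Γ : SimpleGraph (Fin n)} (hadj : ∀ x y, G.Adj x y ↔ Γ.Adj (f x) (f y))
    (hcl : ∀ x w, Γ.Adj (f x) w → w ∈ Set.range f) (x : V) :
    (Γ.neighborSet (f x)).ncard = (G.neighborSet x).ncard := by
  have : Γ.neighborSet (f x) = f '' (G.neighborSet x) := by
    ext w
    simp only [SimpleGraph.mem_neighborSet, Set.mem_image]
    constructor
    · intro h
      obtain ⟨y, rfl⟩ := hcl x w h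
      exact ⟨y, (hadj x y).2 h, rfl⟩
    · rintro ⟨y, hy, rfl⟩
      exact (hadj x y).1 hy
  rw [this, Set.ncard_image_of_injective _ f.injective]

variable {d : Fin n → ℕ}

lemma IsFragEmbedding.degree_eq {Γ : SimpleGraph (Fin n)} (h : IsFragEmbedding G f Γ)
    (hd : HasDegreeSequence d Γ) (x : V) : d (f x) = (G.neighborSet x).ncard := by
  rw [← hd, neighborSet_of_closed h.2 (fun x w hw => (h.closed hw).1 ⟨x, rfl⟩)]

variable [Fintype V]

lemma autCount_pos (G : SimpleGraph V) : 0 < autCount G := by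
  unfold autCount
  have : Finite (G ≃g G) := Finite.of_injective (fun e : G ≃g G => e.toEquiv) fun e e' h => by
    ext x; exact congrArg (fun e : V ≃ V => e x) h
  have : Nonempty (G ≃g G) := ⟨SimpleGraph.Iso.refl⟩
  exact Nat.card_pos

lemma card_fragEmbedding (Γ : SimpleGraph (Fin n)) :
    (Finset.univ.filter (fun f : V ↪ Fin n => IsFragEmbedding G f Γ)).card
      = if Nonempty (Frag Γ ≃g G) then autCount G else 0 := by
  have h1 : (Finset.univ.filter (fun f : V ↪ Fin n => IsFragEmbedding G f Γ)).card
      = Nat.card (G ≃g Frag Γ) := by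
    rw [← Fintype.card_subtype, ← Nat.card_eq_fintype_card]
    symm
    refine Nat.card_congr (Equiv.ofBijective (fun e : G ≃g Frag Γ =>
      (⟨e.toEquiv.toEmbedding.trans (Function.Embedding.subtype _), ?_, ?_⟩ :
        {f : V ↪ Fin n // IsFragEmbedding G f Γ})) ⟨?_, ?_⟩)
    · ext w
      constructor
      · rintro ⟨x, rfl⟩
        exact (e x).2
      · intro hw
        exact ⟨e.symm ⟨w, hw⟩, by simp⟩
    · intro x y
      exact (e.map_rel_iff (a := x) (b := y)).symm
    · intro e e' h
      ext x
      have := congrArg (fun f : {f : V ↪ Fin n // IsFragEmbedding G f Γ} => f.1 x) h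
      simpa using congrArg Fin.val this
    · rintro ⟨f, hf1, hf2⟩
      let e : G ≃g Frag Γ :=
        { toEquiv := (Equiv.ofInjective f f.injective).trans (Equiv.setCongr hf1)
          map_rel_iff' := fun {a b} => (hf2 a b).symm }
      refine ⟨e, ?_⟩
      apply Subtype.ext
      ext x
      rfl
  rw [h1]
  split_ifs with h
  · obtain ⟨e⟩ := h
    rw [autCount]
    exact Nat.card_congr
      { toFun := fun g => g.trans e
        invFun := fun g => g.trans e.symm
        left_inv := fun g => by ext x; simp
        right_inv := fun g => by ext x; simp }
  · have : IsEmpty (G ≃g Frag Γ) := ⟨fun e => h ⟨e.symm⟩⟩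
    exact Nat.card_of_isEmpty

lemma IsFragEmbedding.isolateVerts {Γ : SimpleGraph (Fin n)} (h : IsFragEmbedding G f Γ)
    (hd : HasDegreeSequence d Γ) :
    HasDegreeSequence (restDegree d f) (isolateVerts (Set.range f) Γ) ∧
      NoUnicyclic (isolateVerts (Set.range f) Γ) := by
  have hadj : ∀ u ∈ (Set.range f)ᶜ, ∀ w, Γ.Adj u w ↔ (_root_.isolateVerts (Set.range f) Γ).Adj u w :=
    fun u hu w => ⟨fun hw => ⟨hw, hu, fun hw' => hu ((h.closed hw).2 hw')⟩, fun hw => hw.1⟩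
  have hiso : ∀ u ∈ Set.range f, ∀ w, ¬ (_root_.isolateVerts (Set.range f) Γ).Adj u w :=
    fun u hu w hw => hw.2.1 hu
  refine ⟨fun u => ?_, fun u => ?_⟩
  · unfold restDegree
    split_ifs with hu
    · rw [Set.ncard_eq_zero, Set.eq_empty_iff_forall_notMem]
      exact fun w hw => hiso u hu w hw
    · rw [← hd]
      congr 1
      ext w
      exact (hadj u hu w).symm
  · by_cases hu : u ∈ Set.range f
    · exact not_isUnicyclic_of_isolated_vertex (hiso u hu)
    · rw [← isUnicyclic_component_congr _ hadj
        (fun u hu w hw hw' => hu ((h.closed hw).2 hw')) hu]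
      rw [h.1] at hu
      exact hu

lemma IsFragEmbedding.eq_of_isolateVerts_eq {Γ Γ' : SimpleGraph (Fin n)}
    (h : IsFragEmbedding G f Γ) (h' : IsFragEmbedding G f Γ')
    (heq : _root_.isolateVerts (Set.range f) Γ = _root_.isolateVerts (Set.range f) Γ') :
    Γ = Γ' := by
  have key : ∀ {Γ Γ' : SimpleGraph (Fin n)}, IsFragEmbedding G f Γ → IsFragEmbedding G f Γ' →
      _root_.isolateVerts (Set.range f) Γ = _root_.isolateVerts (Set.range f) Γ' →
      ∀ a b, Γ.Adj a b → Γ'.Adj a b := by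
    intro Γ Γ' h h' heq a b hab
    by_cases ha : a ∈ Set.range f
    · obtain ⟨y, rfl⟩ := (h.closed hab).1 ha
      obtain ⟨x, rfl⟩ := ha
      rwa [← h'.2, h.2]
    · have : (_root_.isolateVerts (Set.range f) Γ).Adj a b :=
        ⟨hab, ha, fun hb => ha ((h.closed hab).2 hb)⟩
      rw [heq] at this
      exact this.1
  ext a b
  exact ⟨key h h' heq a b, key h' h heq.symm a b⟩

lemma exists_fragEmbedding (hG : IsSimpleFragment G) (hf : ∀ x, d (f x) = (G.neighborSet x).ncard)
    {Γ' : SimpleGraph (Fin n)} (hd : HasDegreeSequence (restDegree d f) Γ')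
    (hΓ' : NoUnicyclic Γ') :
    ∃ Γ, HasDegreeSequence d Γ ∧ IsFragEmbedding G f Γ ∧ isolateVerts (Set.range f) Γ = Γ' := by
  have hiso : ∀ u ∈ Set.range f, ∀ w, ¬ Γ'.Adj u w := by
    intro u hu w hw
    have := hd u
    rw [restDegree, if_pos hu, Set.ncard_eq_zero] at this
    exact (Set.eq_empty_iff_forall_notMem.1 this) w hw
  have hmap : ∀ {a b}, (G.map f).Adj a b → a ∈ Set.range f ∧ b ∈ Set.range f := by
    intro a b hab
    rw [SimpleGraph.map_adj] at hab
    obtain ⟨x, y, _, rfl, rfl⟩ := hab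
    exact ⟨⟨x, rfl⟩, ⟨y, rfl⟩⟩
  have hadj : ∀ x y, G.Adj x y ↔ (Γ' ⊔ G.map f).Adj (f x) (f y) := by
    intro x y
    rw [SimpleGraph.sup_adj, SimpleGraph.map_adj_apply]
    exact ⟨Or.inr, fun h => h.resolve_left (hiso _ ⟨x, rfl⟩ _)⟩
  have hcl : ∀ x w, (Γ' ⊔ G.map f).Adj (f x) w → w ∈ Set.range f := by
    intro x w hw
    rcases hw with hw | hw
    · exact absurd hw (hiso _ ⟨x, rfl⟩ _)
    · exact (hmap hw).2
  have hout : ∀ u ∈ (Set.range f)ᶜ, ∀ w, Γ'.Adj u w ↔ (Γ' ⊔ G.map f).Adj u w := by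
    intro u hu w
    rw [SimpleGraph.sup_adj]
    exact ⟨Or.inl, fun h => h.resolve_right fun h => hu (hmap h).1⟩
  have hcl' : ∀ u ∈ (Set.range f)ᶜ, ∀ w, Γ'.Adj u w → w ∈ (Set.range f)ᶜ :=
    fun u _ w hw hw' => hiso w hw' u hw.symm
  refine ⟨Γ' ⊔ G.map f, fun u => ?_, ⟨?_, hadj⟩, ?_⟩
  · by_cases hu : u ∈ Set.range f
    · obtain ⟨x, rfl⟩ := hu
      rw [neighborSet_of_closed hadj hcl, hf]
    · have h1 := hd u
      rw [restDegree, if_neg hu] at h1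
      rw [← h1]
      congr 1
      ext w
      exact (hout u hu w).symm
  · ext u
    constructor
    · rintro ⟨x, rfl⟩
      show IsUnicyclic _
      rw [← isUnicyclic_component_iff f hadj hcl x]
      exact hG _
    · intro hu
      by_contra hcon
      apply hΓ' u
      rw [isUnicyclic_component_congr _ hout hcl' hcon]
      exact hu
  · ext a b
    constructor
    · rintro ⟨h1 | h1, h2, _⟩
      · exact h1
      · exact absurd (hmap h1).1 h2
    · intro hab
      exact ⟨Or.inl hab, fun ha => hiso a ha b hab, fun hb => hiso b hb a hab.symm⟩

/-- The number of graphs with given degree sequence and given fragment, in terms of the number of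
graphs without unicyclic components. -/
lemma autCount_mul_ncard (hG : IsSimpleFragment G) (d : Fin n → ℕ) :
    autCount G * {Γ | HasDegreeSequence d Γ ∧ Nonempty (Frag Γ ≃g G)}.ncard
      = ∑ f ∈ Finset.univ.filter (fun f : V ↪ Fin n => ∀ x, d (f x) = (G.neighborSet x).ncard),
        {Γ | HasDegreeSequence (restDegree d f) Γ ∧ NoUnicyclic Γ}.ncard := by
  have hset : ∀ P : SimpleGraph (Fin n) → Prop, {Γ | P Γ}.ncard = (Finset.univ.filter P).card := by
    intro P
    rw [← Set.ncard_coe_finset]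
    congr 1
    ext Γ
    simp
  have h1 : autCount G * {Γ | HasDegreeSequence d Γ ∧ Nonempty (Frag Γ ≃g G)}.ncard
      = ∑ Γ ∈ Finset.univ.filter (fun Γ => HasDegreeSequence d Γ),
        (Finset.univ.filter (fun f : V ↪ Fin n => IsFragEmbedding G f Γ)).card := by
    rw [Finset.sum_congr rfl (fun Γ _ => card_fragEmbedding Γ), ← Finset.sum_filter,
      Finset.filter_filter, Finset.sum_const, smul_eq_mul, mul_comm, hset]
    congr!
  rw [h1]
  simp only [Finset.card_filter]
  rw [Finset.sum_comm, Finset.sum_filter]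
  refine Finset.sum_congr rfl fun f _ => ?_
  rw [← Finset.card_filter, Finset.filter_filter]
  split_ifs with hf
  · rw [hset]
    apply Finset.card_bij (fun Γ _ => isolateVerts (Set.range f) Γ)
    · intro Γ hΓ
      simp only [Finset.mem_filter, Finset.mem_univ, true_and] at hΓ ⊢
      exact hΓ.2.isolateVerts hΓ.1
    · intro Γ hΓ Γ' hΓ' heq
      simp only [Finset.mem_filter, Finset.mem_univ, true_and] at hΓ hΓ'
      exact hΓ.2.eq_of_isolateVerts_eq hΓ'.2 heq
    · intro Γ' hΓ'
      simp only [Finset.mem_filter, Finset.mem_univ, true_and] at hΓ'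
      obtain ⟨Γ, h2, h3, h4⟩ := exists_fragEmbedding hG hf hΓ'.1 hΓ'.2
      exact ⟨Γ, by simp [h2, h3], h4⟩
  · rw [Finset.card_eq_zero, Finset.filter_eq_empty_iff]
    rintro Γ _ ⟨h2, h3⟩
    exact hf (fun x => h3.degree_eq h2 x)

end Decomposition

section Moments

lemma integral_degreeLaw {n : ℕ} (d : Fin n → ℕ) (f : ℕ → ℝ) :
    ∫ k, f k ∂(degreeLaw d) = (∑ i, f (d i)) / n := by
  rw [degreeLaw, integral_map (measurable_of_countable d).aemeasurable
    (measurable_of_countable f).aestronglyMeasurable, uniformOn, ProbabilityTheory.cond,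
    Measure.restrict_univ, integral_smul_measure, integral_count]
  simp [Measure.count_apply, div_eq_inv_mul]

variable {d : (n : ℕ) → Fin n → ℕ} {D : ProbabilityMeasure ℕ}

lemma DegreeAssumption.integrable_id (hd : DegreeAssumption d D) :
    Integrable (fun k : ℕ => (k : ℝ)) (D : Measure ℕ) := by
  refine hd.integrable_sq.mono (measurable_of_countable _).aestronglyMeasurable
    (Eventually.of_forall fun k => ?_)
  rw [Real.norm_of_nonneg (by positivity), Real.norm_of_nonneg (by positivity)]
  exact_mod_cast Nat.le_self_pow two_ne_zero k

lemma factorialMoment_one : factorialMoment D 1 = ∫ k, (k : ℝ) ∂(D : Measure ℕ) := by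
  simp [factorialMoment]

lemma DegreeAssumption.factorialMoment_two (hd : DegreeAssumption d D) :
    factorialMoment D 2 = ∫ k, (k : ℝ) ^ 2 ∂(D : Measure ℕ) - ∫ k, (k : ℝ) ∂(D : Measure ℕ) := by
  rw [← integral_sub hd.integrable_sq hd.integrable_id, factorialMoment]
  refine integral_congr_ae (Eventually.of_forall fun k => ?_)
  have h : ((k.descFactorial 2 : ℕ) : ℝ) = (k : ℝ) ^ 2 - k := by
    rcases k with _ | k
    · simp
    · simp only [Nat.succ_descFactorial_succ, Nat.descFactorial_one]
      push_cast
      ring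
  exact h

lemma DegreeAssumption.tendsto_sum (hd : DegreeAssumption d D) :
    Tendsto (fun n => (∑ i, (d n i : ℝ)) / n) atTop (𝓝 (factorialMoment D 1)) := by
  have := hd.tendsto_mean
  simp only [integral_degreeLaw] at this
  rwa [factorialMoment_one]

lemma DegreeAssumption.tendsto_sum_sq (hd : DegreeAssumption d D) :
    Tendsto (fun n => (∑ i, (d n i : ℝ) ^ 2) / n) atTop
      (𝓝 (∫ k, (k : ℝ) ^ 2 ∂(D : Measure ℕ))) := by
  have := hd.tendsto_sq
  simpa only [integral_degreeLaw (f := fun k : ℕ => (k : ℝ) ^ 2)] using this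

lemma DegreeAssumption.tendsto_count (hd : DegreeAssumption d D) (k : ℕ) :
    Tendsto (fun n => ((Finset.univ.filter (fun i => d n i = k)).card : ℝ) / n) atTop
      (𝓝 (limitMass D k)) := by
  let f : ℕ →ᵇ ℝ := BoundedContinuousFunction.ofNormedAddCommGroupDiscrete
    (fun j => if j = k then (1 : ℝ) else 0) 1 (fun j => by split_ifs <;> simp)
  have h1 := hd.tendsto_law f
  have h2 : ∀ n, ∫ j, f j ∂(degreeLaw (d n))
      = ((Finset.univ.filter (fun i => d n i = k)).card : ℝ) / n := by
    intro n
    rw [integral_degreeLaw, ← Finset.sum_boole]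
    rfl
  have h3 : ∫ j, f j ∂(D : Measure ℕ) = limitMass D k := by
    have h4 : (fun j => f j) = Set.indicator {k} (fun _ => (1 : ℝ)) := by
      funext j
      simp [f, Set.indicator_apply]
    rw [h4, integral_indicator_const _ (measurableSet_singleton k), limitMass, smul_eq_mul, mul_one]
  rw [h3] at h1
  exact h1.congr h2

/-- The largest degree is of smaller order than `√n`. -/
lemma DegreeAssumption.tendsto_max (hd : DegreeAssumption d D) :
    Tendsto (fun n => ((Finset.univ.sup (d n) : ℕ) : ℝ) ^ 2 / n) atTop (𝓝 0) := by
  let g : ℕ → ℕ → ℝ := fun K j => if j ≤ K then (j : ℝ) ^ 2 else 0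
  have hg0 : ∀ K j, 0 ≤ g K j := fun K j => by
    simp only [g]; split_ifs <;> positivity
  have hg1 : ∀ K j, g K j ≤ (j : ℝ) ^ 2 := fun K j => by
    simp only [g]; split_ifs
    · exact le_rfl
    · positivity
  have hg2 : ∀ K j, g K j ≤ (K : ℝ) ^ 2 := fun K j => by
    simp only [g]; split_ifs with h
    · have : (j : ℝ) ≤ K := by exact_mod_cast h
      gcongr
    · positivity
  let f : ℕ → ℕ →ᵇ ℝ := fun K => BoundedContinuousFunction.ofNormedAddCommGroupDiscrete
    (g K) ((K : ℝ) ^ 2) (fun j => by rw [Real.norm_of_nonneg (hg0 K j)]; exact hg2 K j)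
  have h1 : ∀ K, Tendsto (fun n => (∑ i, (d n i : ℝ) ^ 2) / n - (∑ i, g K (d n i)) / n) atTop
      (𝓝 (∫ k, (k : ℝ) ^ 2 ∂(D : Measure ℕ) - ∫ k, g K k ∂(D : Measure ℕ))) := by
    intro K
    have := hd.tendsto_law (f K)
    simp only [integral_degreeLaw] at this
    exact hd.tendsto_sum_sq.sub this
  have h2 : Tendsto (fun K => ∫ k, g K k ∂(D : Measure ℕ)) atTop
      (𝓝 (∫ k, (k : ℝ) ^ 2 ∂(D : Measure ℕ))) := by
    apply tendsto_integral_of_dominated_convergence (fun k : ℕ => (k : ℝ) ^ 2)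
      (fun K => (measurable_of_countable _).aestronglyMeasurable) hd.integrable_sq
    · exact fun K => Eventually.of_forall fun j => by
        rw [Real.norm_of_nonneg (hg0 K j)]; exact hg1 K j
    · refine Eventually.of_forall fun j => ?_
      refine tendsto_const_nhds.congr' ?_
      filter_upwards [eventually_ge_atTop j] with K hK
      simp [g, hK]
  have h2' := (tendsto_const_nhds (x := ∫ k, (k : ℝ) ^ 2 ∂(D : Measure ℕ))).sub h2
  rw [sub_self] at h2'
  refine tendsto_of_approx (f := fun K n => (K : ℝ) ^ 2 / n +
      ((∑ i, (d n i : ℝ) ^ 2) / n - (∑ i, g K (d n i)) / n))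
    (y := fun K => 0 + (∫ k, (k : ℝ) ^ 2 ∂(D : Measure ℕ) - ∫ k, g K k ∂(D : Measure ℕ)))
    (e := fun K => (∫ k, (k : ℝ) ^ 2 ∂(D : Measure ℕ) - ∫ k, g K k ∂(D : Measure ℕ))
      + 1 / ((K : ℝ) + 1))
    (fun K => (tendsto_const_nhds.div_atTop tendsto_natCast_atTop_atTop).add (h1 K)) ?_ ?_ ?_
  · simpa using h2'
  · simpa using h2'.add tendsto_one_div_add_atTop_nhds_zero_nat
  · intro K
    have hK : (0 : ℝ) < 1 / ((K : ℝ) + 1) := by positivity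
    have h3 := ((tendsto_const_nhds (x := (K : ℝ) ^ 2)).div_atTop
      (tendsto_natCast_atTop_atTop (R := ℝ))).add (h1 K)
    filter_upwards [h3.eventually_lt_const (show _ < (∫ k, (k : ℝ) ^ 2 ∂(D : Measure ℕ)
      - ∫ k, g K k ∂(D : Measure ℕ)) + 1 / ((K : ℝ) + 1) by linarith)] with n hn
    have hle : ((Finset.univ.sup (d n) : ℕ) : ℝ) ^ 2
        ≤ (K : ℝ) ^ 2 + (∑ i, (d n i : ℝ) ^ 2 - ∑ i, g K (d n i)) := by
      rw [← Finset.sum_sub_distrib]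
      have hnn : ∀ i ∈ Finset.univ, 0 ≤ (d n i : ℝ) ^ 2 - g K (d n i) :=
        fun i _ => sub_nonneg.2 (hg1 K _)
      rcases Finset.eq_empty_or_nonempty (Finset.univ : Finset (Fin n)) with he | hne
      · rw [he]; simp
      · obtain ⟨i, hi, hie⟩ := Finset.exists_mem_eq_sup _ hne (d n)
        rw [hie]
        have h5 := Finset.single_le_sum hnn hi
        have h6 := hg2 K (d n i)
        linarith
    have hle' : ((Finset.univ.sup (d n) : ℕ) : ℝ) ^ 2 / n
        ≤ (K : ℝ) ^ 2 / n + ((∑ i, (d n i : ℝ) ^ 2) / n - (∑ i, g K (d n i)) / n) := by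
      rw [← sub_div, ← add_div]
      gcongr
    have h0 : 0 ≤ ((Finset.univ.sup (d n) : ℕ) : ℝ) ^ 2 / n := by positivity
    rw [abs_sub_comm, abs_of_nonneg (by linarith)]
    linarith

lemma HasDegreeSequence.even_sum {n : ℕ} {d : Fin n → ℕ} {Γ : SimpleGraph (Fin n)}
    (h : HasDegreeSequence d Γ) : Even (∑ i, d i) := by
  rw [← Finset.sum_congr rfl (fun i _ => h i), sum_ncard_neighborSet]
  exact even_two_mul _

end Moments

section HalfEdges

lemma numTurns_eq_natCard {H ι : Type*} [Fintype H] (v : H → ι) :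
    numTurns v = Nat.card (Turn v) := by
  rw [numTurns, Nat.card_eq_fintype_card]

variable {n : ℕ} (d : Fin n → ℕ)

lemma card_halfEdge : Fintype.card (HalfEdge d) = ∑ i, d i := by
  simp [HalfEdge]

lemma card_halfEdge_at (u : Fin n) :
    (Finset.univ.filter (fun h => HalfEdge.vert d h = u)).card = d u := by
  rw [← Fintype.card_subtype]
  exact (Fintype.card_congr (Equiv.sigmaSubtype u)).trans (Fintype.card_fin _)

lemma numTurns_halfEdge :
    (numTurns (HalfEdge.vert d) : ℝ) = ∑ i, (d i : ℝ) ^ 2 - ∑ i, (d i : ℝ) := by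
  have h : numTurns (HalfEdge.vert d) =
      (Finset.univ.sigma (fun i => (Finset.univ : Finset (Fin (d i))).offDiag)).card := by
    rw [numTurns_eq_natCard, ← Nat.card_eq_finsetCard]
    let F : (Finset.univ.sigma (fun i => (Finset.univ : Finset (Fin (d i))).offDiag)) →
        Turn (HalfEdge.vert d) := fun q => ⟨(⟨q.1.1, q.1.2.1⟩, ⟨q.1.1, q.1.2.2⟩), rfl, fun h => by
      have := (Finset.mem_offDiag.1 (Finset.mem_sigma.1 q.2).2).2.2
      simp only [Sigma.mk.injEq, heq_eq_eq, true_and] at h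
      exact this h⟩
    refine (Nat.card_congr (Equiv.ofBijective F ⟨?_, ?_⟩)).symm
    · rintro ⟨⟨i, a, b⟩, _⟩ ⟨⟨j, a', b'⟩, _⟩ h
      simp only [F, Subtype.mk.injEq, Prod.mk.injEq, Sigma.mk.injEq] at h
      obtain ⟨⟨rfl, h1⟩, -, h2⟩ := h
      simp only [eq_of_heq h1, eq_of_heq h2]
    · rintro ⟨⟨⟨i, a⟩, ⟨j, b⟩⟩, h, hne⟩
      obtain rfl : i = j := h
      refine ⟨⟨⟨i, (a, b)⟩, ?_⟩, rfl⟩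
      simp only [Finset.mem_sigma, Finset.mem_univ, Finset.mem_offDiag, true_and]
      rintro rfl
      exact hne rfl
  rw [h, Finset.card_sigma, Nat.cast_sum, ← Finset.sum_sub_distrib]
  refine Finset.sum_congr rfl fun i _ => ?_
  rw [Finset.offDiag_card, Finset.card_univ, Fintype.card_fin,
    Nat.cast_sub (Nat.le_mul_self _)]
  push_cast
  ring

end HalfEdges

section RestDegree

variable {V : Type*} [Fintype V] {n : ℕ}

@[to_additive]
lemma prod_restDegree {M : Type*} [CommMonoid M] (d : Fin n → ℕ) (f : V ↪ Fin n) (g : ℕ → M)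
    (hg : g 0 = 1) : (∏ i, g (restDegree d f i)) * ∏ x, g (d (f x)) = ∏ i, g (d i) := by
  have h1 : ∏ x, g (d (f x)) = ∏ i, if i ∈ Set.range f then g (d i) else 1 := by
    rw [← Finset.prod_filter, ← Finset.prod_map Finset.univ f (fun i => g (d i))]
    congr 1
    ext i
    simp
  rw [h1, ← Finset.prod_mul_distrib]
  refine Finset.prod_congr rfl fun i _ => ?_
  unfold restDegree
  split_ifs <;> simp [hg]

lemma restDegree_le (d : Fin n → ℕ) (f : V ↪ Fin n) (i : Fin n) : restDegree d f i ≤ d i := by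
  unfold restDegree
  split_ifs <;> simp

/-- The injections of `V` into `Fin n` that carry the degrees of `G` to the prescribed degrees. -/
def degreeEmbeddings (G : SimpleGraph V) (d : Fin n → ℕ) : Finset (V ↪ Fin n) :=
  Finset.univ.filter (fun f => ∀ x, d (f x) = (G.neighborSet x).ncard)

lemma mem_degreeEmbeddings {G : SimpleGraph V} {d : Fin n → ℕ} {f : V ↪ Fin n} :
    f ∈ degreeEmbeddings G d ↔ ∀ x, d (f x) = (G.neighborSet x).ncard := by
  simp [degreeEmbeddings]

lemma sum_restDegree_add {G : SimpleGraph V} (hG : IsSimpleFragment G) {d : Fin n → ℕ}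
    {f : V ↪ Fin n} (hf : f ∈ degreeEmbeddings G d) :
    ∑ i, restDegree d f i + 2 * Fintype.card V = ∑ i, d i := by
  rw [← hG.sum_degree, ← sum_restDegree d f (fun j => j) rfl]
  simp only [mem_degreeEmbeddings.1 hf]

end RestDegree

section Transfer

variable {V : Type*} [Fintype V] {G : SimpleGraph V} {n : ℕ}

/-- The probability that a random matching of the half-edges outside the range of `f` is simple and
yields no unicyclic component. -/
def restProb (d : Fin n → ℕ) (f : V ↪ Fin n) : ℝ :=
  pairProb (fun σ => IsSimpleMatching (HalfEdge.vert (restDegree d f)) σ ∧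
    NoUnicyclic (matchGraph (HalfEdge.vert (restDegree d f)) σ))

lemma prod_factorial_mul_ncard_div (d : Fin n → ℕ) (Q : SimpleGraph (Fin n) → Prop) :
    ((∏ i, ((d i)! : ℝ)) * ({Γ | HasDegreeSequence d Γ ∧ Q Γ}.ncard : ℝ))
        / numPairings (∑ i, d i)
      = pairProb (fun σ => IsSimpleMatching (HalfEdge.vert d) σ ∧
          Q (matchGraph (HalfEdge.vert d) σ)) := by
  rw [pairProb, card_pairings, card_halfEdge]
  congr 1
  have := card_simple_matchings (d := d) Q
  rw [← Nat.cast_prod, ← Nat.cast_mul, ← this]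
  congr!

lemma autCount_mul_randomGraphProb (hG : IsSimpleFragment G) {d : Fin n → ℕ} (hd : Feasible d) :
    (autCount G : ℝ) * randomGraphProb d (fun Γ => Nonempty (Frag Γ ≃g G))
      = (∏ x, (((G.neighborSet x).ncard)! : ℝ)) * pairWeight (∑ i, d i) (Fintype.card V)
        * (∑ f ∈ degreeEmbeddings G d, restProb d f)
        / pairProb (IsSimpleMatching (HalfEdge.vert d)) := by
  obtain ⟨Γ₀, hΓ₀⟩ := hd
  have hP := prod_factorial_mul_ncard_div d (fun _ => True)
  simp only [and_true] at hP
  have hS : ({Γ | HasDegreeSequence d Γ}.ncard : ℝ) ≠ 0 := by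
    have : 0 < {Γ | HasDegreeSequence d Γ}.ncard :=
      (Set.ncard_pos (Set.toFinite _)).2 ⟨Γ₀, hΓ₀⟩
    positivity
  have hN : (numPairings (∑ i, d i) : ℝ) ≠ 0 := by
    have := numPairings_pos hΓ₀.even_sum
    positivity
  have hfac : (∏ i, ((d i)! : ℝ)) ≠ 0 :=
    Finset.prod_ne_zero_iff.2 fun i _ => by positivity
  have key : ∀ f ∈ degreeEmbeddings G d,
      ({Γ | HasDegreeSequence (restDegree d f) Γ ∧ NoUnicyclic Γ}.ncard : ℝ)
        / {Γ | HasDegreeSequence d Γ}.ncard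
      = (∏ x, (((G.neighborSet x).ncard)! : ℝ)) * pairWeight (∑ i, d i) (Fintype.card V)
        * restProb d f / pairProb (IsSimpleMatching (HalfEdge.vert d)) := by
    intro f hf
    have hsum := sum_restDegree_add hG hf
    have heven : Even (∑ i, restDegree d f i) := by
      have := hΓ₀.even_sum
      rw [← hsum] at this
      exact (Nat.even_add.1 this).2 (even_two_mul _)
    have hN' : (numPairings (∑ i, restDegree d f i) : ℝ) ≠ 0 := by
      have := numPairings_pos heven
      positivity
    have hfac' : (∏ i, ((restDegree d f i)! : ℝ)) ≠ 0 :=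
      Finset.prod_ne_zero_iff.2 fun i _ => by positivity
    have h1 := numPairings_div _ (Fintype.card V) heven
    rw [hsum] at h1
    have h2 := prod_restDegree d f (fun j => (j ! : ℝ)) (by simp)
    simp only [mem_degreeEmbeddings.1 hf] at h2
    rw [restProb, ← prod_factorial_mul_ncard_div (restDegree d f) NoUnicyclic, ← hP, ← h1, ← h2]
    have hfac'' : (∏ x, (((G.neighborSet x).ncard)! : ℝ)) ≠ 0 :=
      Finset.prod_ne_zero_iff.2 fun i _ => by positivity
    field_simp
  have h3 := autCount_mul_ncard hG d
  rw [randomGraphProb, ← mul_div_assoc, ← Nat.cast_mul, h3, Nat.cast_sum, Finset.sum_div,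
    Finset.mul_sum, Finset.sum_div]
  exact Finset.sum_congr rfl key

end Transfer

section DegreeZero

variable {V : Type*}

lemma randomGraphProb_eq_zero_of_degree_zero [Nonempty V] (G : SimpleGraph V) {n : ℕ}
    {d : Fin n → ℕ} (h0 : ∀ i, d i = 0) :
    randomGraphProb d (fun Γ => Nonempty (Frag Γ ≃g G)) = 0 := by
  have : {Γ | HasDegreeSequence d Γ ∧ Nonempty (Frag Γ ≃g G)} = ∅ := by
    refine Set.eq_empty_of_forall_notMem ?_
    rintro Γ ⟨h1, ⟨e⟩⟩
    refine not_isUnicyclic_of_isolated_vertex (u := (e.symm (Classical.arbitrary V)).1)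
      (fun w hw => ?_) (e.symm (Classical.arbitrary V)).2
    have h2 := h1 (e.symm (Classical.arbitrary V)).1
    rw [h0, Set.ncard_eq_zero] at h2
    exact Set.eq_empty_iff_forall_notMem.1 h2 w hw
  rw [randomGraphProb, this, Set.ncard_empty, Nat.cast_zero, zero_div]

lemma randomGraphProb_eq_one_of_degree_zero [IsEmpty V] (G : SimpleGraph V) {n : ℕ}
    {d : Fin n → ℕ} (hd : Feasible d) (h0 : ∀ i, d i = 0) :
    randomGraphProb d (fun Γ => Nonempty (Frag Γ ≃g G)) = 1 := by
  have h1 : {Γ | HasDegreeSequence d Γ ∧ Nonempty (Frag Γ ≃g G)} = {Γ | HasDegreeSequence d Γ} := by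
    ext Γ
    refine ⟨fun h => h.1, fun h => ⟨h, ?_⟩⟩
    have : IsEmpty (fragVerts Γ) := by
      refine ⟨fun u => not_isUnicyclic_of_isolated_vertex (fun w hw => ?_) u.2⟩
      have h2 := h u.1
      rw [h0, Set.ncard_eq_zero] at h2
      exact Set.eq_empty_iff_forall_notMem.1 h2 w hw
    exact ⟨⟨Equiv.equivOfIsEmpty _ _, fun {a} => isEmptyElim a⟩⟩
  have h2 : 0 < {Γ | HasDegreeSequence d Γ}.ncard := (Set.ncard_pos (Set.toFinite _)).2 hd
  rw [randomGraphProb, h1, div_self (by positivity)]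

lemma autCount_of_isEmpty [IsEmpty V] (G : SimpleGraph V) : autCount G = 1 := by
  unfold autCount
  rw [Nat.card_eq_one_iff_unique]
  exact ⟨⟨fun a b => by ext x; exact isEmptyElim x⟩, ⟨SimpleGraph.Iso.refl⟩⟩

end DegreeZero

section Limits

variable {d : (n : ℕ) → Fin n → ℕ} {D : ProbabilityMeasure ℕ}

lemma DegreeAssumption.configLimit (hd : DegreeAssumption d D) (hρ : 0 < factorialMoment D 1)
    (hν : nuParam D < 1) {A : Type*} {l : Filter A} {N : A → ℕ} (hN : Tendsto N l atTop)
    (dd : ∀ a, Fin (N a) → ℕ) (C₁ C₂ : ℕ) (h1 : ∀ a, ∑ i, dd a i + C₁ = ∑ i, d (N a) i)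
    (h2 : ∀ a, ∑ i, dd a i ^ 2 + C₂ = ∑ i, d (N a) i ^ 2)
    (hle : ∀ a i, dd a i ≤ d (N a) i) (heven : ∀ a, Even (∑ i, dd a i)) :
    ConfigLimit l (fun a => HalfEdge.vert (dd a)) (fun a => Finset.univ.sup (d (N a)))
      (nuParam D) := by
  have hNR : Tendsto (fun a => (N a : ℝ)) l atTop := tendsto_natCast_atTop_atTop.comp hN
  have hc : Tendsto (fun a => (∑ i, (dd a i : ℝ)) / N a) l (𝓝 (factorialMoment D 1)) := by
    have h3 := (hd.tendsto_sum.comp hN).sub (hNR.const_div_atTop (C₁ : ℝ))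
    rw [sub_zero] at h3
    refine h3.congr fun a => ?_
    have h4 : (∑ i, (dd a i : ℝ)) + C₁ = ∑ i, (d (N a) i : ℝ) := by exact_mod_cast h1 a
    simp only [Function.comp_apply]
    rw [← h4, ← sub_div, add_sub_cancel_right]
  have hs : Tendsto (fun a => (∑ i, (dd a i : ℝ) ^ 2) / N a) l
      (𝓝 (∫ k, (k : ℝ) ^ 2 ∂(D : Measure ℕ))) := by
    have h3 := (hd.tendsto_sum_sq.comp hN).sub (hNR.const_div_atTop (C₂ : ℝ))
    rw [sub_zero] at h3
    refine h3.congr fun a => ?_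
    have h4 : (∑ i, (dd a i : ℝ) ^ 2) + C₂ = ∑ i, (d (N a) i : ℝ) ^ 2 := by exact_mod_cast h2 a
    simp only [Function.comp_apply]
    rw [← h4, ← sub_div, add_sub_cancel_right]
  have hcard : ∀ a, (Fintype.card (HalfEdge (dd a)) : ℝ) = ∑ i, (dd a i : ℝ) := fun a => by
    rw [card_halfEdge]; push_cast; rfl
  have hne : ∀ᶠ a in l, (N a : ℝ) ≠ 0 := hNR.eventually_ne_atTop 0
  refine ⟨Eventually.of_forall fun a => ?_, Eventually.of_forall fun a u => ?_, ?_, ?_, ?_, hν⟩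
  · rw [card_halfEdge]; exact heven a
  · refine le_trans (le_of_eq ?_)
      ((hle a u).trans (Finset.le_sup (f := d (N a)) (Finset.mem_univ u)))
    convert card_halfEdge_at (dd a) u
  · refine (hc.pos_mul_atTop hρ hNR).congr' ?_
    filter_upwards [hne] with a ha
    rw [hcard, div_mul_cancel₀ _ ha]
  · have h3 := (hs.sub hc).div hc hρ.ne'
    rw [factorialMoment_one, ← hd.factorialMoment_two, ← factorialMoment_one] at h3
    refine h3.congr' ?_
    filter_upwards [hne] with a ha
    rw [numTurns_halfEdge, hcard, Pi.div_apply, ← sub_div]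
    exact div_div_div_cancel_right₀ ha _ _
  · have h3 := (hd.tendsto_max.comp hN).div hc hρ.ne'
    rw [zero_div] at h3
    refine h3.congr' ?_
    filter_upwards [hne] with a ha
    rw [hcard]
    exact div_div_div_cancel_right₀ ha _ _

lemma DegreeAssumption.even_sum (hd : DegreeAssumption d D) (n : ℕ) : Even (∑ i, d n i) := by
  obtain ⟨Γ, hΓ⟩ := hd.feasible n
  exact hΓ.even_sum

lemma DegreeAssumption.tendsto_simple (hd : DegreeAssumption d D) (hρ : 0 < factorialMoment D 1)
    (hν : nuParam D < 1) :
    Tendsto (fun n => pairProb (IsSimpleMatching (HalfEdge.vert (d n)))) atTop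
      (𝓝 (Real.exp (-(nuParam D / 2 + nuParam D ^ 2 / 4)))) :=
  (hd.configLimit hρ hν tendsto_id d 0 0 (fun _ => rfl) (fun _ => rfl) (fun _ _ => le_rfl)
    hd.even_sum).tendsto_simple

variable {V : Type*} [Fintype V] {G : SimpleGraph V}

/-- The convergence of `restProb` is uniform in the embedding. -/
lemma DegreeAssumption.eventually_restProb (hd : DegreeAssumption d D)
    (hρ : 0 < factorialMoment D 1) (hν : nuParam D < 1) (hG : IsSimpleFragment G) {ε : ℝ}
    (hε : 0 < ε) :
    ∀ᶠ n in atTop, ∀ f ∈ degreeEmbeddings G (d n),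
      |restProb (d n) f - Real.sqrt (1 - nuParam D)| < ε := by
  let A := {p : Σ n, (V ↪ Fin n) // p.2 ∈ degreeEmbeddings G (d p.1)}
  let N : A → ℕ := fun a => a.1.1
  have h1 : ∀ a : A, ∑ i, restDegree (d (N a)) a.1.2 i + 2 * Fintype.card V = ∑ i, d (N a) i :=
    fun a => sum_restDegree_add hG a.2
  have h := (hd.configLimit (l := comap N atTop) hρ hν tendsto_comap
    (fun a => restDegree (d (N a)) a.1.2) (2 * Fintype.card V)
    (∑ x, (G.neighborSet x).ncard ^ 2) h1 (fun a => ?_)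
    (fun a i => restDegree_le _ _ _) (fun a => ?_)).tendsto_simple_noUnicyclic
  · have h2 := eventually_comap.1 (Metric.tendsto_nhds.1 h ε hε)
    filter_upwards [h2] with n hn f hf
    exact hn ⟨⟨n, f⟩, hf⟩ rfl
  · rw [← sum_restDegree (d (N a)) a.1.2 (fun j => j ^ 2) rfl]
    have h2 : ∀ x, d (N a) (a.1.2 x) = (G.neighborSet x).ncard := mem_degreeEmbeddings.1 a.2
    simp only [h2]
  · have := hd.even_sum (N a)
    rw [← h1 a] at this
    exact (Nat.even_add.1 this).2 (even_two_mul _)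

lemma tendsto_descFactorial_div_pow (k : ℕ) :
    Tendsto (fun n : ℕ => (n.descFactorial k : ℝ) / (n : ℝ) ^ k) atTop (𝓝 1) := by
  refine (Asymptotics.isEquivalent_iff_tendsto_one ?_).1 (isEquivalent_descFactorial k)
  filter_upwards [eventually_ne_atTop 0] with n hn
  positivity

lemma card_degreeMaps (G : SimpleGraph V) {n : ℕ} (d : Fin n → ℕ) :
    (Finset.univ.filter (fun f : V → Fin n => ∀ x, d (f x) = (G.neighborSet x).ncard)).card
      = ∏ x, (Finset.univ.filter (fun i => d i = (G.neighborSet x).ncard)).card := by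
  rw [← Fintype.card_piFinset]
  congr 1
  ext f
  simp [Fintype.mem_piFinset]

lemma card_degreeEmbeddings_eq (G : SimpleGraph V) {n : ℕ} (d : Fin n → ℕ) :
    (degreeEmbeddings G d).card = (Finset.univ.filter (fun f : V → Fin n =>
      (∀ x, d (f x) = (G.neighborSet x).ncard) ∧ Function.Injective f)).card := by
  refine Finset.card_bij (fun f _ => f) (fun f hf => ?_) (fun f _ g _ h => DFunLike.coe_injective h)
    (fun f hf => ?_)
  · simpa using ⟨mem_degreeEmbeddings.1 hf, f.injective⟩
  · simp only [Finset.mem_filter, Finset.mem_univ, true_and] at hf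
    exact ⟨⟨f, hf.2⟩, mem_degreeEmbeddings.2 hf.1, rfl⟩

lemma card_degreeEmbeddings_le (G : SimpleGraph V) {n : ℕ} (d : Fin n → ℕ) :
    (degreeEmbeddings G d).card
      ≤ ∏ x, (Finset.univ.filter (fun i => d i = (G.neighborSet x).ncard)).card := by
  rw [← card_degreeMaps, card_degreeEmbeddings_eq]
  exact Finset.card_le_card fun f hf => by
    simp only [Finset.mem_filter, Finset.mem_univ, true_and] at hf ⊢
    exact hf.1

lemma prod_card_le (G : SimpleGraph V) {n : ℕ} (d : Fin n → ℕ) :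
    ∏ x, (Finset.univ.filter (fun i => d i = (G.neighborSet x).ncard)).card
        + n.descFactorial (Fintype.card V)
      ≤ (degreeEmbeddings G d).card + n ^ Fintype.card V := by
  have h1 : n.descFactorial (Fintype.card V)
      = (Finset.univ.filter (fun f : V → Fin n => Function.Injective f)).card := by
    have := Fintype.card_embedding_eq (α := V) (β := Fin n)
    rw [Fintype.card_fin] at this
    rw [← this, ← Fintype.card_subtype]
    exact Fintype.card_congr (Equiv.subtypeInjectiveEquivEmbedding V (Fin n)).symm
  have h2 : n ^ Fintype.card V = (Finset.univ : Finset (V → Fin n)).card := by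
    simp
  rw [← card_degreeMaps, card_degreeEmbeddings_eq, h1, h2, ← Finset.card_union_add_card_inter,
    add_comm, ← Finset.filter_and]
  gcongr
  exact Finset.subset_univ _

lemma DegreeAssumption.tendsto_card_degreeEmbeddings (hd : DegreeAssumption d D) :
    Tendsto (fun n => ((degreeEmbeddings G (d n)).card : ℝ) / (n : ℝ) ^ Fintype.card V) atTop
      (𝓝 (∏ x, limitMass D (G.neighborSet x).ncard)) := by
  have h1 : Tendsto (fun n => ((∏ x, (Finset.univ.filter
      (fun i => d n i = (G.neighborSet x).ncard)).card : ℕ) : ℝ) / (n : ℝ) ^ Fintype.card V) atTop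
      (𝓝 (∏ x, limitMass D (G.neighborSet x).ncard)) := by
    refine (tendsto_finsetProd Finset.univ
      (fun x _ => hd.tendsto_count (G.neighborSet x).ncard)).congr fun n => ?_
    rw [Finset.prod_div_distrib, Finset.prod_const, Finset.card_univ]
    push_cast
    rfl
  have h2 := (h1.add (tendsto_descFactorial_div_pow (Fintype.card V))).sub
    (tendsto_const_nhds (x := (1 : ℝ)))
  rw [add_sub_cancel_right] at h2
  refine tendsto_of_tendsto_of_tendsto_of_le_of_le' h2 h1 ?_ (Eventually.of_forall fun n => ?_)
  · filter_upwards [eventually_ne_atTop 0] with n hn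
    have hn' : (0 : ℝ) < (n : ℝ) ^ Fintype.card V := by positivity
    rw [sub_le_iff_le_add, ← div_self hn'.ne', ← add_div, ← add_div]
    refine div_le_div_of_nonneg_right ?_ hn'.le
    exact_mod_cast prod_card_le G (d n)
  · gcongr
    exact card_degreeEmbeddings_le G (d n)

lemma DegreeAssumption.tendsto_sum_restProb (hd : DegreeAssumption d D)
    (hρ : 0 < factorialMoment D 1) (hν : nuParam D < 1) (hG : IsSimpleFragment G) :
    Tendsto (fun n => (∑ f ∈ degreeEmbeddings G (d n), restProb (d n) f)
      / (n : ℝ) ^ Fintype.card V) atTop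
      (𝓝 (Real.sqrt (1 - nuParam D) * ∏ x, limitMass D (G.neighborSet x).ncard)) := by
  have h1 := (hd.tendsto_card_degreeEmbeddings (G := G)).const_mul (Real.sqrt (1 - nuParam D))
  have h2 : Tendsto (fun n => (∑ f ∈ degreeEmbeddings G (d n), restProb (d n) f)
      / (n : ℝ) ^ Fintype.card V - Real.sqrt (1 - nuParam D)
        * (((degreeEmbeddings G (d n)).card : ℝ) / (n : ℝ) ^ Fintype.card V)) atTop (𝓝 0) := by
    refine Metric.tendsto_nhds.2 fun ε hε => ?_
    filter_upwards [hd.eventually_restProb hρ hν hG (half_pos hε), eventually_ne_atTop 0]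
      with n hn hn0
    have hn' : (0 : ℝ) < (n : ℝ) ^ Fintype.card V := by positivity
    have h3 : ((degreeEmbeddings G (d n)).card : ℝ) ≤ (n : ℝ) ^ Fintype.card V := by
      have h5 : (degreeEmbeddings G (d n)).card ≤ n ^ Fintype.card V := by
        refine (Finset.card_le_univ _).trans ?_
        rw [Fintype.card_embedding_eq, Fintype.card_fin]
        exact Nat.descFactorial_le_pow _ _
      exact_mod_cast h5
    rw [dist_zero_right, Real.norm_eq_abs, ← mul_div_assoc, ← sub_div, abs_div, abs_of_pos hn',
      div_lt_iff₀ hn', mul_comm (Real.sqrt _), ← nsmul_eq_mul, ← Finset.sum_const,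
      ← Finset.sum_sub_distrib]
    calc |∑ f ∈ degreeEmbeddings G (d n), (restProb (d n) f - Real.sqrt (1 - nuParam D))|
        ≤ ∑ f ∈ degreeEmbeddings G (d n), |restProb (d n) f - Real.sqrt (1 - nuParam D)| :=
          Finset.abs_sum_le_sum_abs _ _
      _ ≤ ∑ _f ∈ degreeEmbeddings G (d n), ε / 2 := Finset.sum_le_sum fun f hf => (hn f hf).le
      _ = (degreeEmbeddings G (d n)).card * (ε / 2) := by rw [Finset.sum_const, nsmul_eq_mul]
      _ ≤ (n : ℝ) ^ Fintype.card V * (ε / 2) := by gcongr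
      _ < ε * (n : ℝ) ^ Fintype.card V := by nlinarith
  have h3 := h2.add h1
  rw [zero_add] at h3
  exact h3.congr fun n => sub_add_cancel _ _

lemma DegreeAssumption.tendsto_pairWeight (hd : DegreeAssumption d D)
    (hρ : 0 < factorialMoment D 1) (k : ℕ) :
    Tendsto (fun n => pairWeight (∑ i, d n i) k * (n : ℝ) ^ k) atTop
      (𝓝 ((factorialMoment D 1)⁻¹ ^ k)) := by
  have h1 : ∀ j ∈ Finset.range k, Tendsto
      (fun n : ℕ => (((∑ i, (d n i : ℝ)) / n) - (1 + 2 * j) / n)⁻¹) atTop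
      (𝓝 (factorialMoment D 1)⁻¹) := by
    intro j _
    have h2 := hd.tendsto_sum.sub
      ((tendsto_natCast_atTop_atTop (R := ℝ)).const_div_atTop (1 + 2 * j : ℝ))
    rw [sub_zero] at h2
    exact h2.inv₀ hρ.ne'
  have h3 := tendsto_finsetProd _ h1
  rw [Finset.prod_const, Finset.card_range] at h3
  refine h3.congr fun n => ?_
  rw [pairWeight, ← Finset.card_range k, ← Finset.prod_const, Finset.card_range,
    ← Finset.prod_mul_distrib]
  refine Finset.prod_congr rfl fun j _ => ?_
  rw [← sub_div, inv_div, div_eq_inv_mul]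
  push_cast
  congr 2
  ring

lemma finprod_numDegree (G : SimpleGraph V) (w : ℕ → ℝ) :
    ∏ᶠ i, w i ^ numDegree G i = ∏ x, w (G.neighborSet x).ncard := by
  have hnum : ∀ i, numDegree G i
      = (Finset.univ.filter (fun x => (G.neighborSet x).ncard = i)).card := by
    intro i
    rw [numDegree, ← Set.ncard_coe_finset]
    congr 1
    ext x
    simp
  rw [finprod_eq_prod_of_mulSupport_subset (s := Finset.univ.image
    (fun x => (G.neighborSet x).ncard))]
  · rw [Finset.prod_comp w (fun x => (G.neighborSet x).ncard)]
    exact Finset.prod_congr rfl fun i _ => by rw [hnum]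
  · intro i hi
    by_contra hne
    refine hi ?_
    have : numDegree G i = 0 := by
      rw [hnum, Finset.card_eq_zero, Finset.filter_eq_empty_iff]
      intro x _ hx
      exact hne (by simp only [Finset.coe_image, Finset.coe_univ, Set.image_univ]; exact ⟨x, hx⟩)
    simp [this]

lemma DegreeAssumption.tendsto_randomGraphProb (hd : DegreeAssumption d D)
    (hρ : 0 < factorialMoment D 1) (hν : nuParam D < 1) (hG : IsSimpleFragment G) :
    Tendsto (fun n => randomGraphProb (d n) (fun Γ => Nonempty (Frag Γ ≃g G))) atTop
      (𝓝 (Real.sqrt (1 - nuParam D) * Real.exp (nuParam D / 2 + nuParam D ^ 2 / 4)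
            / (autCount G : ℝ)
          * ∏ᶠ i : ℕ, (limitMass D i * (i ! : ℝ) / factorialMoment D 1) ^ numDegree G i)) := by
  have haut : (autCount G : ℝ) ≠ 0 := by
    have := autCount_pos G
    positivity
  have h1 := ((((hd.tendsto_pairWeight hρ (Fintype.card V)).const_mul
    (∏ x, (((G.neighborSet x).ncard)! : ℝ))).mul (hd.tendsto_sum_restProb hρ hν hG)).div
    (hd.tendsto_simple hρ hν) (Real.exp_pos _).ne').div_const (autCount G : ℝ)
  have hlim : (∏ x, (((G.neighborSet x).ncard)! : ℝ)) * (factorialMoment D 1)⁻¹ ^ Fintype.card V *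
        (Real.sqrt (1 - nuParam D) * ∏ x, limitMass D (G.neighborSet x).ncard) /
        Real.exp (-(nuParam D / 2 + nuParam D ^ 2 / 4)) / (autCount G : ℝ)
      = Real.sqrt (1 - nuParam D) * Real.exp (nuParam D / 2 + nuParam D ^ 2 / 4)
          / (autCount G : ℝ)
        * ∏ᶠ i : ℕ, (limitMass D i * (i ! : ℝ) / factorialMoment D 1) ^ numDegree G i := by
    rw [finprod_numDegree G (fun i => limitMass D i * (i ! : ℝ) / factorialMoment D 1)]
    simp only [div_eq_mul_inv]
    rw [Finset.prod_mul_distrib, Finset.prod_mul_distrib, Finset.prod_const, Finset.card_univ,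
      Real.exp_neg, inv_inv]
    ring
  rw [← hlim]
  refine h1.congr' ?_
  filter_upwards [eventually_ne_atTop 0] with n hn
  have hn' : (n : ℝ) ^ Fintype.card V ≠ 0 := by positivity
  rw [div_eq_iff haut, mul_comm (randomGraphProb _ _), autCount_mul_randomGraphProb hG
    (hd.feasible n), Pi.div_apply]
  congr 1
  field_simp

lemma factorialMoment_one_nonneg : 0 ≤ factorialMoment D 1 :=
  integral_nonneg fun _ => by positivity

lemma DegreeAssumption.eventually_eq_zero (hd : DegreeAssumption d D)
    (hρ : factorialMoment D 1 = 0) : ∀ᶠ n in atTop, ∀ i, d n i = 0 := by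
  have h1 : (fun k : ℕ => (k : ℝ)) =ᵐ[(D : Measure ℕ)] 0 := by
    rw [← integral_eq_zero_iff_of_nonneg (fun k => Nat.cast_nonneg k) hd.integrable_id,
      ← factorialMoment_one, hρ]
  filter_upwards [hd.no_rare_degree] with n hn i
  by_contra hne
  refine hn (d n i) ?_ i rfl
  refine (measureReal_eq_zero_iff).2 (measure_mono_null ?_ (ae_iff.1 h1))
  rintro k rfl
  simpa using hne

lemma DegreeAssumption.tendsto_randomGraphProb_of_eq_zero (hd : DegreeAssumption d D)
    (hρ : factorialMoment D 1 = 0) (G : SimpleGraph V) :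
    Tendsto (fun n => randomGraphProb (d n) (fun Γ => Nonempty (Frag Γ ≃g G))) atTop
      (𝓝 (Real.sqrt (1 - nuParam D) * Real.exp (nuParam D / 2 + nuParam D ^ 2 / 4)
            / (autCount G : ℝ)
          * ∏ᶠ i : ℕ, (limitMass D i * (i ! : ℝ) / factorialMoment D 1) ^ numDegree G i)) := by
  rw [finprod_numDegree G (fun i => limitMass D i * (i ! : ℝ) / factorialMoment D 1)]
  have hν : nuParam D = 0 := by rw [nuParam, hρ, div_zero]
  refine tendsto_const_nhds.congr' ?_
  filter_upwards [hd.eventually_eq_zero hρ] with n hn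
  rcases isEmpty_or_nonempty V with hV | hV
  · rw [randomGraphProb_eq_one_of_degree_zero G (hd.feasible n) hn, autCount_of_isEmpty, hν]
    simp
  · rw [randomGraphProb_eq_zero_of_degree_zero G hn, hρ]
    simp

end Limits

end

theorem mainTheorem10 (d : (n : ℕ) → Fin n → ℕ) (D : ProbabilityMeasure ℕ)
    (hd : DegreeAssumption d D) (hν : nuParam D < 1)
    {V : Type*} [Finite V] (G : SimpleGraph V) (hG : IsSimpleFragment G) :
    Tendsto (fun n => randomGraphProb (d n) (fun Γ => Nonempty (Frag Γ ≃g G))) atTop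
      (𝓝 (Real.sqrt (1 - nuParam D) * Real.exp (nuParam D / 2 + nuParam D ^ 2 / 4)
            / (autCount G : ℝ)
          * ∏ᶠ i : ℕ, (limitMass D i * (i ! : ℝ) / factorialMoment D 1) ^ numDegree G i)) := by
  have := Fintype.ofFinite V
  rcases factorialMoment_one_nonneg.eq_or_lt with hρ | hρ
  · exact hd.tendsto_randomGraphProb_of_eq_zero hρ.symm G
  · exact hd.tendsto_randomGraphProb hρ hν hG
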